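/- Let $\Bbbk$ be a field of characteristic zero. All categories below are strict $\Bbbk$-linear monoidal categories presented by generators and relations; diagrams are read from bottom to top, their objects are the finite sequences of positive integers (the generating object $a\in\mathbb Z_{\ge1}$ is a strand of thickness $a$), the tensor product of objects is concatenation and the unit is the empty sequence. For $a,b\ge 1$ consider generating morphisms $$\mathsf m_{a,b}:(a,b)\to(a+b)\ \text{(merge)},\qquad \mathsf s_{a,b}:(a+b)\to(a,b)\ \text{(split)},\qquad \mathsf x_{a,b}:(a,b)\to(b,a)\ \text{(crossing)}.$$ A strand of thickness $0$ is the unit object, and merges, splits and crossings with a strand of thickness $0$ are identities. For $s,p,q,t\ge0$ and $m:(p,q)\to(q,p)$ put $$E_{s,t}(m)=(\mathsf m_{s,q}\otimes \mathsf m_{p,t})\circ(1_s\otimes m\otimes 1_t)\circ(\mathsf s_{s,p}\otimes \mathsf s_{q,t}):(s+p,\,q+t)\to(s+q,\,p+t).$$ The web relations are, for all $a,b,c,d\ge1$, with $a+c=b+d$ in the third line: $$\mathsf m_{a+b,c}(\mathsf m_{a,b}\otimes1_c)=\mathsf m_{a,b+c}(1_a\otimes \mathsf m_{b,c}),\qquad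 (\mathsf s_{a,b}\otimes1_c)\mathsf s_{a+b,c}=(1_a\otimes \mathsf s_{b,c})\mathsf s_{a,b+c},$$ $$\mathsf m_{a,b}\,\mathsf s_{a,b}=\binom{a+b}{a}1_{a+b},$$ $$\mathsf s_{b,d}\,\mathsf m_{a,c}=\sum_{\substack{0\le s\le\min(a,b)\\ 0\le t\le\min(c,d)\\ t-s=d-a}}E_{s,t}(\mathsf x_{a-s,\,c-t}).$$ The affine web category $\mathcal{AW}$ has generating morphisms $\mathsf m_{a,b},\mathsf s_{a,b},\mathsf x_{a,b}$ and $\omega_a:a\to a$ for $a,b\ge 1$, subject to the web relations and the following relations for $a,b\ge1$, where $\omega_0$ is the identity of the unit object: $$(\omega_b\otimes1_a)\,\mathsf x_{a,b}=\sum_{t=0}^{\min(a,b)}t!\,E_{t,t}\big(\mathsf x_{a-t,b-t}(1_{a-t}\otimes\omega_{b-t})\big),$$ $$\mathsf x_{b,a}\,(\omega_b\otimes1_a)=\sum_{t=0}^{\min(a,b)}t!\,E_{t,t}\big((1_{a-t}\otimes\omega_{b-t})\,\mathsf x_{b-t,a-t}\big),$$ $$\mathsf s_{a,b}\,\omega_{a+b}=(\omega_a\otimes\omega_b)\,\mathsf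 s_{a,b},\qquad \omega_{a+b}\,\mathsf m_{a,b}=\mathsf m_{a,b}(\omega_a\otimes\omega_b),$$ $$B_a(\omega_1)=a!\,\omega_a .$$ Here, for $x:1\to1$, the balloon $B_a(x):a\to a$ is the composite of the $a$-fold split $a\to(1,\dots,1)$, $x^{\otimes a}$, and the $a$-fold merge $(1,\dots,1)\to a$. The reduced affine web category $\mathcal{AW}'$ has generating morphisms $\mathsf m_{a,b},\mathsf s_{a,b},\mathsf x_{a,b}$ for $a,b\ge 1$ and a single dot $x:1\to 1$, subject to the web relations and $$(x\otimes1_1)\,\mathsf x_{1,1}=\mathsf x_{1,1}(1_1\otimes x)+1_{(1,1)},\qquad \mathsf x_{1,1}(x\otimes1_1)=(1_1\otimes x)\,\mathsf x_{1,1}+1_{(1,1)}.$$ **Theorem.** The monoidal categories $\mathcal{AW}$ and $\mathcal{AW}'$ are isomorphic. More precisely, there is an isomorphism of strict $\Bbbk$-linear monoidal categories $\mathcal{AW}\to\mathcal{AW}'$ which is the identity on objects, sends merges, splits and crossings to the morphisms of the same name, and sends $\omega_a$ to $\frac1{a!}B_a(x)$ for every $a\ge1$. -/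

import Mathlib

open CategoryTheory MonoidalCategory

universe u

/-! ## Strict `k`-linear monoidal categories given by generators and relations

The generating objects form a type `Γ`, and the objects are the words `List Γ`, with concatenation
as tensor product and the empty word as unit.  The generating morphisms form a family
`G : List Γ → List Γ → Type`. -/

namespace StrictPresentation

/-- Formal `k`-linear expressions in the generating morphisms, built from identities,
compositions (`comp f g` is "first `f`, then `g`"), tensor products and linear combinations. -/
inductive Expr (k : Type u) {Γ : Type} (G : List Γ → List Γ → Type) :
    List Γ → List Γ → Type u
  | gen {a b : List Γ} (g : G a b) : Expr k G a b
  | id (a : List Γ) : Expr k G a a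
  | comp {a b c : List Γ} (f : Expr k G a b) (g : Expr k G b c) : Expr k G a c
  | tensor {a b c d : List Γ} (f : Expr k G a b) (g : Expr k G c d) :
      Expr k G (a ++ c) (b ++ d)
  | zero (a b : List Γ) : Expr k G a b
  | add {a b : List Γ} (f g : Expr k G a b) : Expr k G a b
  | smul {a b : List Γ} (r : k) (f : Expr k G a b) : Expr k G a b

namespace Expr

variable {k : Type u} {Γ : Type} {G : List Γ → List Γ → Type}

instance (a b : List Γ) : Zero (Expr k G a b) := ⟨Expr.zero a b⟩
instance (a b : List Γ) : Add (Expr k G a b) := ⟨Expr.add⟩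
instance (a b : List Γ) : SMul k (Expr k G a b) := ⟨Expr.smul⟩

/-- The same expression, with its source and target rewritten along equalities of words. -/
def cast {a a' b b' : List Γ} (h : a = a') (h' : b = b') (f : Expr k G a b) : Expr k G a' b' :=
  h ▸ h' ▸ f

end Expr

/-- The smallest congruence on expressions that contains the defining relations `R` and the axioms
of a strict `k`-linear monoidal category. -/
inductive Cong {k : Type u} [CommRing k] {Γ : Type} {G : List Γ → List Γ → Type}
    (R : ∀ a b : List Γ, Expr k G a b → Expr k G a b → Prop) :
    ∀ {a b : List Γ}, Expr k G a b → Expr k G a b → Prop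
  -- the defining relations
  | rel {a b : List Γ} {f g : Expr k G a b} (h : R a b f g) : Cong R f g
  -- equivalence relation
  | refl {a b : List Γ} (f : Expr k G a b) : Cong R f f
  | symm {a b : List Γ} {f g : Expr k G a b} (h : Cong R f g) : Cong R g f
  | trans {a b : List Γ} {f g h : Expr k G a b} (h₁ : Cong R f g) (h₂ : Cong R g h) : Cong R f h
  -- compatibility with the operations
  | comp_congr {a b c : List Γ} {f f' : Expr k G a b} {g g' : Expr k G b c}
      (h₁ : Cong R f f') (h₂ : Cong R g g') : Cong R (f.comp g) (f'.comp g')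
  | tensor_congr {a b c d : List Γ} {f f' : Expr k G a b} {g g' : Expr k G c d}
      (h₁ : Cong R f f') (h₂ : Cong R g g') : Cong R (f.tensor g) (f'.tensor g')
  | add_congr {a b : List Γ} {f f' g g' : Expr k G a b}
      (h₁ : Cong R f f') (h₂ : Cong R g g') : Cong R (f + g) (f' + g')
  | smul_congr {a b : List Γ} (r : k) {f f' : Expr k G a b} (h : Cong R f f') :
      Cong R (r • f) (r • f')
  -- category axioms
  | id_comp {a b : List Γ} (f : Expr k G a b) : Cong R ((Expr.id a).comp f) f
  | comp_id {a b : List Γ} (f : Expr k G a b) : Cong R (f.comp (Expr.id b)) f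
  | comp_assoc {a b c d : List Γ} (f : Expr k G a b) (g : Expr k G b c) (h : Expr k G c d) :
      Cong R ((f.comp g).comp h) (f.comp (g.comp h))
  -- strict monoidal axioms
  | tensor_id (a b : List Γ) : Cong R ((Expr.id a).tensor (Expr.id b)) (Expr.id (a ++ b))
  | tensor_comp {a b c a' b' c' : List Γ} (f : Expr k G a b) (g : Expr k G b c)
      (f' : Expr k G a' b') (g' : Expr k G b' c') :
      Cong R ((f.comp g).tensor (f'.comp g')) ((f.tensor f').comp (g.tensor g'))
  | tensor_assoc {a b c a' b' c' : List Γ} (f : Expr k G a a') (g : Expr k G b b')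
      (h : Expr k G c c') :
      Cong R (((f.tensor g).tensor h).cast (List.append_assoc a b c) (List.append_assoc a' b' c'))
        (f.tensor (g.tensor h))
  | unit_tensor {a b : List Γ} (f : Expr k G a b) :
      Cong R (((Expr.id []).tensor f).cast (List.nil_append a) (List.nil_append b)) f
  | tensor_unit {a b : List Γ} (f : Expr k G a b) :
      Cong R ((f.tensor (Expr.id [])).cast (List.append_nil a) (List.append_nil b)) f
  -- the morphism sets are `k`-modules
  | add_assoc {a b : List Γ} (f g h : Expr k G a b) : Cong R (f + g + h) (f + (g + h))
  | add_comm {a b : List Γ} (f g : Expr k G a b) : Cong R (f + g) (g + f)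
  | zero_add {a b : List Γ} (f : Expr k G a b) : Cong R (0 + f) f
  | one_smul {a b : List Γ} (f : Expr k G a b) : Cong R ((1 : k) • f) f
  | mul_smul {a b : List Γ} (r s : k) (f : Expr k G a b) : Cong R ((r * s) • f) (r • s • f)
  | smul_add {a b : List Γ} (r : k) (f g : Expr k G a b) : Cong R (r • (f + g)) (r • f + r • g)
  | add_smul {a b : List Γ} (r s : k) (f : Expr k G a b) : Cong R ((r + s) • f) (r • f + s • f)
  | zero_smul {a b : List Γ} (f : Expr k G a b) : Cong R ((0 : k) • f) 0
  -- composition and tensor product are `k`-bilinear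
  | add_comp {a b c : List Γ} (f f' : Expr k G a b) (g : Expr k G b c) :
      Cong R ((f + f').comp g) (f.comp g + f'.comp g)
  | comp_add {a b c : List Γ} (f : Expr k G a b) (g g' : Expr k G b c) :
      Cong R (f.comp (g + g')) (f.comp g + f.comp g')
  | smul_comp {a b c : List Γ} (r : k) (f : Expr k G a b) (g : Expr k G b c) :
      Cong R ((r • f).comp g) (r • f.comp g)
  | comp_smul {a b c : List Γ} (r : k) (f : Expr k G a b) (g : Expr k G b c) :
      Cong R (f.comp (r • g)) (r • f.comp g)
  | add_tensor {a b c d : List Γ} (f f' : Expr k G a b) (g : Expr k G c d) :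
      Cong R ((f + f').tensor g) (f.tensor g + f'.tensor g)
  | tensor_add {a b c d : List Γ} (f : Expr k G a b) (g g' : Expr k G c d) :
      Cong R (f.tensor (g + g')) (f.tensor g + f.tensor g')
  | smul_tensor {a b c d : List Γ} (r : k) (f : Expr k G a b) (g : Expr k G c d) :
      Cong R ((r • f).tensor g) (r • f.tensor g)
  | tensor_smul {a b c d : List Γ} (r : k) (f : Expr k G a b) (g : Expr k G c d) :
      Cong R (f.tensor (r • g)) (r • f.tensor g)

section

variable {k : Type u} [CommRing k] {Γ : Type} {G : List Γ → List Γ → Type}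
variable (R : ∀ a b : List Γ, Expr k G a b → Expr k G a b → Prop)

/-- The congruence as a setoid. -/
def congSetoid (a b : List Γ) : Setoid (Expr k G a b) where
  r := Cong R
  iseqv := ⟨Cong.refl, Cong.symm, Cong.trans⟩

/-- The strict `k`-linear monoidal category presented by the generating morphisms `G` and the
relations `R`.  Its objects are the words in the generating objects. -/
@[ext] structure PresCat (R : ∀ a b : List Γ, Expr k G a b → Expr k G a b → Prop) : Type where
  word : List Γ

namespace PresCat

/-- Morphisms are expressions modulo the congruence. -/
def Hom (X Y : PresCat R) : Type u := Quotient (congSetoid R X.word Y.word)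

instance : CategoryStruct.{u} (PresCat R) where
  Hom X Y := Hom R X Y
  id X := Quotient.mk (congSetoid R X.word X.word) (Expr.id X.word)
  comp {X Y Z} f g := Quotient.map₂ (sa := congSetoid R X.word Y.word)
    (sb := congSetoid R Y.word Z.word) (sc := congSetoid R X.word Z.word) Expr.comp
    (fun _ _ h _ _ h' => Cong.comp_congr h h') f g

/-- The morphism represented by an expression. -/
def homMk {a b : List Γ} (f : Expr k G a b) : (⟨a⟩ : PresCat R) ⟶ ⟨b⟩ :=
  Quotient.mk (congSetoid R a b) f

variable {R}

theorem homMk_surj {X Y : PresCat R} (f : X ⟶ Y) : ∃ e : Expr k G X.word Y.word, f = homMk R e :=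
  ⟨Quotient.out (s := congSetoid R X.word Y.word) f,
    (Quotient.out_eq (s := congSetoid R X.word Y.word) f).symm⟩

theorem homMk_eq {a b : List Γ} {f g : Expr k G a b} (h : Cong R f g) : homMk R f = homMk R g :=
  Quotient.sound (s := congSetoid R a b) h

theorem homMk_comp {a b c : List Γ} (f : Expr k G a b) (g : Expr k G b c) :
    homMk R (f.comp g) = homMk R f ≫ homMk R g := rfl

theorem homMk_id (a : List Γ) : homMk R (Expr.id a) = 𝟙 (⟨a⟩ : PresCat R) := rfl

instance : Category.{u} (PresCat R) where
  id_comp f := by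
    obtain ⟨f, rfl⟩ := homMk_surj f
    exact homMk_eq (Cong.id_comp f)
  comp_id f := by
    obtain ⟨f, rfl⟩ := homMk_surj f
    exact homMk_eq (Cong.comp_id f)
  assoc f g h := by
    obtain ⟨f, rfl⟩ := homMk_surj f
    obtain ⟨g, rfl⟩ := homMk_surj g
    obtain ⟨h, rfl⟩ := homMk_surj h
    exact homMk_eq (Cong.comp_assoc f g h)

theorem homMk_cast {a a' b b' : List Γ} (h : a = a') (h' : b = b') (f : Expr k G a b) :
    homMk R (f.cast h h') = eqToHom (by rw [h]) ≫ homMk R f ≫ eqToHom (by rw [h']) := by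
  subst h h'
  simp [Expr.cast]

instance (X Y : PresCat R) : Zero (X ⟶ Y) := ⟨homMk R 0⟩

instance (X Y : PresCat R) : Add (X ⟶ Y) :=
  ⟨fun f g => Quotient.map₂ (sa := congSetoid R X.word Y.word)
    (sb := congSetoid R X.word Y.word) (sc := congSetoid R X.word Y.word) (· + ·)
    (fun _ _ h _ _ h' => Cong.add_congr h h') f g⟩

instance (X Y : PresCat R) : SMul k (X ⟶ Y) :=
  ⟨fun r f => Quotient.map (sa := congSetoid R X.word Y.word)
    (sb := congSetoid R X.word Y.word) (r • ·) (fun _ _ h => Cong.smul_congr r h) f⟩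

theorem homMk_zero (a b : List Γ) : homMk R (0 : Expr k G a b) = 0 := rfl

theorem homMk_add {a b : List Γ} (f g : Expr k G a b) : homMk R (f + g) = homMk R f + homMk R g := rfl

theorem homMk_smul {a b : List Γ} (r : k) (f : Expr k G a b) : homMk R (r • f) = r • homMk R f := rfl

instance (X Y : PresCat R) : AddCommMonoid (X ⟶ Y) where
  add_assoc f g h := by
    obtain ⟨f, rfl⟩ := homMk_surj f
    obtain ⟨g, rfl⟩ := homMk_surj g
    obtain ⟨h, rfl⟩ := homMk_surj h
    exact homMk_eq (Cong.add_assoc f g h)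
  add_comm f g := by
    obtain ⟨f, rfl⟩ := homMk_surj f
    obtain ⟨g, rfl⟩ := homMk_surj g
    exact homMk_eq (Cong.add_comm f g)
  zero_add f := by
    obtain ⟨f, rfl⟩ := homMk_surj f
    exact homMk_eq (Cong.zero_add f)
  add_zero f := by
    obtain ⟨f, rfl⟩ := homMk_surj f
    exact homMk_eq ((Cong.add_comm f 0).trans (Cong.zero_add f))
  nsmul := nsmulRec

instance (X Y : PresCat R) : Module k (X ⟶ Y) where
  one_smul f := by
    obtain ⟨f, rfl⟩ := homMk_surj f
    exact homMk_eq (Cong.one_smul f)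
  mul_smul r s f := by
    obtain ⟨f, rfl⟩ := homMk_surj f
    exact homMk_eq (Cong.mul_smul r s f)
  smul_add r f g := by
    obtain ⟨f, rfl⟩ := homMk_surj f
    obtain ⟨g, rfl⟩ := homMk_surj g
    exact homMk_eq (Cong.smul_add r f g)
  add_smul r s f := by
    obtain ⟨f, rfl⟩ := homMk_surj f
    exact homMk_eq (Cong.add_smul r s f)
  zero_smul f := by
    obtain ⟨f, rfl⟩ := homMk_surj f
    exact homMk_eq (Cong.zero_smul f)
  smul_zero r := homMk_eq <|
    ((Cong.smul_congr r (Cong.zero_smul 0)).symm.trans (Cong.mul_smul r 0 0).symm).trans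
      (by rw [mul_zero]; exact Cong.zero_smul 0)

instance : Preadditive (PresCat R) where
  homGroup X Y := Module.addCommMonoidToAddCommGroup k
  add_comp X Y Z f f' g := by
    obtain ⟨f, rfl⟩ := homMk_surj f
    obtain ⟨f', rfl⟩ := homMk_surj f'
    obtain ⟨g, rfl⟩ := homMk_surj g
    exact homMk_eq (Cong.add_comp f f' g)
  comp_add X Y Z f g g' := by
    obtain ⟨f, rfl⟩ := homMk_surj f
    obtain ⟨g, rfl⟩ := homMk_surj g
    obtain ⟨g', rfl⟩ := homMk_surj g'
    exact homMk_eq (Cong.comp_add f g g')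

instance : Linear k (PresCat R) where
  homModule X Y := inferInstanceAs (Module k (X ⟶ Y))
  smul_comp X Y Z r f g := by
    obtain ⟨f, rfl⟩ := homMk_surj f
    obtain ⟨g, rfl⟩ := homMk_surj g
    exact homMk_eq (Cong.smul_comp r f g)
  comp_smul X Y Z f r g := by
    obtain ⟨f, rfl⟩ := homMk_surj f
    obtain ⟨g, rfl⟩ := homMk_surj g
    exact homMk_eq (Cong.comp_smul r f g)

/-- Tensor product of morphisms, induced by that of expressions. -/
def tensorMap {X Y X' Y' : PresCat R} (f : X ⟶ Y) (g : X' ⟶ Y') :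
    (⟨X.word ++ X'.word⟩ : PresCat R) ⟶ ⟨Y.word ++ Y'.word⟩ :=
  Quotient.map₂ (sa := congSetoid R X.word Y.word) (sb := congSetoid R X'.word Y'.word)
    (sc := congSetoid R (X.word ++ X'.word) (Y.word ++ Y'.word)) Expr.tensor
    (fun _ _ h _ _ h' => Cong.tensor_congr h h') f g

theorem tensorMap_comp {X Y Z X' Y' Z' : PresCat R} (f : X ⟶ Y) (g : Y ⟶ Z) (f' : X' ⟶ Y')
    (g' : Y' ⟶ Z') : tensorMap (f ≫ g) (f' ≫ g') = tensorMap f f' ≫ tensorMap g g' := by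
  obtain ⟨f, rfl⟩ := homMk_surj f
  obtain ⟨f', rfl⟩ := homMk_surj f'
  obtain ⟨g, rfl⟩ := homMk_surj g
  obtain ⟨g', rfl⟩ := homMk_surj g'
  exact homMk_eq (Cong.tensor_comp f g f' g')

theorem tensorMap_id (X Y : PresCat R) : tensorMap (𝟙 X) (𝟙 Y) = 𝟙 (⟨X.word ++ Y.word⟩ : PresCat R) :=
  homMk_eq (Cong.tensor_id X.word Y.word)

theorem tensorMap_eqToHom_id {X Y : PresCat R} (h : X = Y) (Z : PresCat R) :
    tensorMap (eqToHom h) (𝟙 Z) = eqToHom (by rw [h]) := by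
  subst h
  exact tensorMap_id X Z

theorem tensorMap_id_eqToHom (Z : PresCat R) {X Y : PresCat R} (h : X = Y) :
    tensorMap (𝟙 Z) (eqToHom h) = eqToHom (by rw [h]) := by
  subst h
  exact tensorMap_id Z X

theorem eqToHom_comp_three {X Y Z W V : PresCat R} (p : X = Y) (q : Y = Z) (r : Z = W)
    (p' : X = V) (q' : V = W) :
    eqToHom p ≫ eqToHom q ≫ eqToHom r = eqToHom p' ≫ eqToHom q' := by
  simp

theorem tensorMap_assoc {X Y Z X' Y' Z' : PresCat R} (f : X ⟶ X') (g : Y ⟶ Y') (h : Z ⟶ Z') :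
    tensorMap (tensorMap f g) h ≫ eqToHom (by simp) =
      eqToHom (by simp) ≫ tensorMap f (tensorMap g h) := by
  obtain ⟨f, rfl⟩ := homMk_surj f
  obtain ⟨g, rfl⟩ := homMk_surj g
  obtain ⟨h, rfl⟩ := homMk_surj h
  have := homMk_eq (R := R) (Cong.tensor_assoc f g h)
  rw [homMk_cast] at this
  change homMk R ((f.tensor g).tensor h) ≫ _ = _ ≫ homMk R (f.tensor (g.tensor h))
  rw [← this]
  simp

theorem tensorMap_unit_left {X Y : PresCat R} (f : X ⟶ Y) :
    tensorMap (𝟙 (⟨[]⟩ : PresCat R)) f ≫ eqToHom (by simp) = eqToHom (by simp) ≫ f := by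
  obtain ⟨f, rfl⟩ := homMk_surj f
  have := homMk_eq (R := R) (Cong.unit_tensor f)
  rw [homMk_cast] at this
  change homMk R ((Expr.id []).tensor f) ≫ _ = _ ≫ homMk R f
  conv_rhs => rw [← this]
  simp

theorem tensorMap_unit_right {X Y : PresCat R} (f : X ⟶ Y) :
    tensorMap f (𝟙 (⟨[]⟩ : PresCat R)) ≫ eqToHom (by simp) = eqToHom (by simp) ≫ f := by
  obtain ⟨f, rfl⟩ := homMk_surj f
  have := homMk_eq (R := R) (Cong.tensor_unit f)
  rw [homMk_cast] at this
  change homMk R (f.tensor (Expr.id [])) ≫ _ = _ ≫ homMk R f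
  conv_rhs => rw [← this]
  simp

instance : MonoidalCategoryStruct (PresCat R) where
  tensorObj X Y := ⟨X.word ++ Y.word⟩
  tensorUnit := ⟨[]⟩
  tensorHom f g := tensorMap f g
  whiskerLeft X _ _ f := tensorMap (𝟙 X) f
  whiskerRight f X := tensorMap f (𝟙 X)
  associator X Y Z := eqToIso (PresCat.ext (List.append_assoc X.word Y.word Z.word))
  leftUnitor X := eqToIso (PresCat.ext (List.nil_append X.word))
  rightUnitor X := eqToIso (PresCat.ext (List.append_nil X.word))

/-- The monoidal structure; it is strict, as the associators and unitors are the identities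
`eqToIso` coming from equalities of objects. -/
instance : MonoidalCategory (PresCat R) :=
  MonoidalCategory.ofTensorHom
    (id_tensorHom_id := tensorMap_id)
    (id_tensorHom := fun _ _ _ _ => rfl)
    (tensorHom_id := fun _ _ => rfl)
    (tensorHom_comp_tensorHom := fun f₁ f₂ g₁ g₂ => (tensorMap_comp f₁ g₁ f₂ g₂).symm)
    (associator_naturality := fun f g h => tensorMap_assoc f g h)
    (leftUnitor_naturality := fun f => tensorMap_unit_left f)
    (rightUnitor_naturality := fun f => tensorMap_unit_right f)
    (pentagon := fun W X Y Z => by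
      have h₁ := tensorMap_eqToHom_id (PresCat.ext (List.append_assoc W.word X.word Y.word)) Z
      have h₂ := tensorMap_id_eqToHom W (PresCat.ext (List.append_assoc X.word Y.word Z.word))
      refine (congr_arg₂ (· ≫ ·) h₁ (congr_arg₂ (· ≫ ·) rfl h₂)).trans ?_
      exact eqToHom_comp_three _
        (PresCat.ext (List.append_assoc W.word (X.word ++ Y.word) Z.word)) _
        (PresCat.ext (List.append_assoc (W.word ++ X.word) Y.word Z.word))
        (PresCat.ext (List.append_assoc W.word X.word (Y.word ++ Z.word))))
    (triangle := fun X Y => by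
      have h₁ := tensorMap_eqToHom_id (PresCat.ext (List.append_nil X.word)) Y
      have h₂ := tensorMap_id_eqToHom X (PresCat.ext (List.nil_append Y.word))
      refine (congr_arg₂ (· ≫ ·) rfl h₂).trans (Eq.trans ?_ h₁.symm)
      exact eqToHom_trans (PresCat.ext (List.append_assoc X.word [] Y.word)) _)

theorem homMk_tensor {a b c d : List Γ} (f : Expr k G a b) (g : Expr k G c d) :
    homMk R (f.tensor g) = homMk R f ⊗ₘ homMk R g := rfl

instance : MonoidalPreadditive (PresCat R) where
  whiskerLeft_zero {X Y Z} := by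
    change tensorMap (𝟙 X) (homMk R 0) = homMk R 0
    rw [← homMk_eq (Cong.zero_smul (R := R) 0), ← homMk_eq (Cong.zero_smul (R := R) 0)]
    exact (homMk_eq (Cong.tensor_smul 0 _ _)).trans <|
      (homMk_eq (Cong.zero_smul _)).trans (homMk_eq (Cong.zero_smul _)).symm
  zero_whiskerRight {X Y Z} := by
    change tensorMap (homMk R 0) (𝟙 X) = homMk R 0
    rw [← homMk_eq (Cong.zero_smul (R := R) 0), ← homMk_eq (Cong.zero_smul (R := R) 0)]
    exact (homMk_eq (Cong.smul_tensor 0 _ _)).trans <|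
      (homMk_eq (Cong.zero_smul _)).trans (homMk_eq (Cong.zero_smul _)).symm
  whiskerLeft_add f g := by
    obtain ⟨f, rfl⟩ := homMk_surj f
    obtain ⟨g, rfl⟩ := homMk_surj g
    exact homMk_eq (Cong.tensor_add _ f g)
  add_whiskerRight f g := by
    obtain ⟨f, rfl⟩ := homMk_surj f
    obtain ⟨g, rfl⟩ := homMk_surj g
    exact homMk_eq (Cong.add_tensor f g _)

instance : MonoidalLinear k (PresCat R) where
  whiskerLeft_smul X Y Z r f := by
    obtain ⟨f, rfl⟩ := homMk_surj f
    exact homMk_eq (Cong.tensor_smul r _ f)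
  smul_whiskerRight r Y Z f X := by
    obtain ⟨f, rfl⟩ := homMk_surj f
    exact homMk_eq (Cong.smul_tensor r f _)

end PresCat

end

end StrictPresentation

/-- An isomorphism of strict `k`-linear monoidal categories: a `k`-linear functor which is strict
monoidal (its coherence isomorphisms are the identities `F X ⊗ F Y = F (X ⊗ Y)` and `𝟙 = F 𝟙`) and
has a two-sided inverse functor on the nose.  (The inverse is then automatically `k`-linear and
strict monoidal.) -/
structure StrictMonoidalIso (k : Type*) [CommRing k] (C D : Type*)
    [Category C] [Preadditive C] [Linear k C] [MonoidalCategory C]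
    [Category D] [Preadditive D] [Linear k D] [MonoidalCategory D] where
  functor : C ⥤ D
  inverse : D ⥤ C
  functor_comp_inverse : functor ⋙ inverse = 𝟭 C
  inverse_comp_functor : inverse ⋙ functor = 𝟭 D
  additive : functor.Additive
  linear : functor.Linear k
  monoidal : functor.Monoidal
  obj_unit : functor.obj (𝟙_ C) = 𝟙_ D
  obj_tensor : ∀ X Y : C, functor.obj (X ⊗ Y) = functor.obj X ⊗ functor.obj Y
  ε_eq : Functor.LaxMonoidal.ε functor = eqToHom obj_unit.symm
  μ_eq : ∀ X Y : C, Functor.LaxMonoidal.μ functor X Y = eqToHom (obj_tensor X Y).symm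

/-! ## The affine web categories -/

namespace AffineWeb

open StrictPresentation

/-- Merges, splits and crossings, together with a dot on a strand of thickness `a` for every `a`
in `D`. -/
inductive Gen (D : Set ℕ+) : List ℕ+ → List ℕ+ → Type
  | merge (a b : ℕ+) : Gen D [a, b] [a + b]
  | split (a b : ℕ+) : Gen D [a + b] [a, b]
  | cross (a b : ℕ+) : Gen D [a, b] [b, a]
  | dot (a : ℕ+) (h : a ∈ D) : Gen D [a] [a]

/-- The object "one strand of thickness `n`"; a strand of thickness `0` is the unit object. -/
def strand : ℕ → List ℕ+
  | 0 => []
  | n + 1 => [n.succPNat]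

theorem strand_coe (a : ℕ+) : strand a = [a] := by
  obtain ⟨a, ha⟩ := a
  obtain ⟨n, rfl⟩ := Nat.exists_eq_succ_of_ne_zero ha.ne'
  rfl

section diagrams

variable (k : Type u) (D : Set ℕ+)

/-- The merge `(a, b) → (a + b)`, an identity if a strand has thickness `0`. -/
def merge : ∀ a b : ℕ, Expr k (Gen D) (strand a ++ strand b) (strand (a + b))
  | 0, b => (Expr.id (strand b)).cast rfl (by rw [Nat.zero_add])
  | a + 1, 0 => Expr.id (strand (a + 1))
  | a + 1, b + 1 => Expr.gen (Gen.merge a.succPNat b.succPNat)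

/-- The split `(a + b) → (a, b)`, an identity if a strand has thickness `0`. -/
def split : ∀ a b : ℕ, Expr k (Gen D) (strand (a + b)) (strand a ++ strand b)
  | 0, b => (Expr.id (strand b)).cast (by rw [Nat.zero_add]) rfl
  | a + 1, 0 => Expr.id (strand (a + 1))
  | a + 1, b + 1 => Expr.gen (Gen.split a.succPNat b.succPNat)

/-- The crossing `(a, b) → (b, a)`, an identity if a strand has thickness `0`. -/
def cross : ∀ a b : ℕ, Expr k (Gen D) (strand a ++ strand b) (strand b ++ strand a)
  | 0, b => (Expr.id (strand b)).cast rfl (List.append_nil (strand b)).symm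
  | a + 1, 0 => Expr.id (strand (a + 1))
  | a + 1, b + 1 => Expr.gen (Gen.cross a.succPNat b.succPNat)

variable {k D} in
/-- The diagram in which `s + p` at the bottom left splits into `(s, p)`, `q + t` at the bottom
right splits into `(q, t)`, the middle strands go through `m : (p, q) → (q, p)`, and finally
`(s, q)` merges into `s + q` and `(p, t)` merges into `p + t`. -/
def exchange (s p q t : ℕ) (m : Expr k (Gen D) (strand p ++ strand q) (strand q ++ strand p)) :
    Expr k (Gen D) (strand (s + p) ++ strand (q + t)) (strand (s + q) ++ strand (p + t)) :=
  (((split k D s p).tensor (split k D q t)).comp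
    ((((Expr.id (strand s)).tensor m).tensor (Expr.id (strand t))).cast
      (by simp) (by simp))).comp
    ((merge k D s q).tensor (merge k D p t))

/-- The dot on a strand of thickness `1`. -/
def thinDot (h : 1 ∈ D) : Expr k (Gen D) [1] [1] := Expr.gen (Gen.dot 1 h)

/-- The `n`-fold split `n → (1, …, 1)`. -/
def fullSplit : ∀ n : ℕ, Expr k (Gen D) (strand n) (List.replicate n 1)
  | 0 => Expr.id []
  | n + 1 => ((split k D 1 n).cast (by rw [Nat.add_comm]) rfl).comp
      ((Expr.id [1]).tensor (fullSplit n))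

/-- The `n`-fold merge `(1, …, 1) → n`. -/
def fullMerge : ∀ n : ℕ, Expr k (Gen D) (List.replicate n 1) (strand n)
  | 0 => Expr.id []
  | n + 1 => ((Expr.id [1]).tensor (fullMerge n)).comp
      ((merge k D 1 n).cast rfl (by rw [Nat.add_comm]))

/-- One dot on each of `n` thin strands. -/
def thinDots (h : 1 ∈ D) : ∀ n : ℕ, Expr k (Gen D) (List.replicate n 1) (List.replicate n 1)
  | 0 => Expr.id []
  | n + 1 => (thinDot k D h).tensor (thinDots h n)

/-- The dotted balloon on a strand of thickness `n`: split the strand into `n` thin strands, put a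
dot on each of them, and merge them again. -/
def balloon (h : 1 ∈ D) (n : ℕ) : Expr k (Gen D) (strand n) (strand n) :=
  ((fullSplit k D n).comp (thinDots k D h n)).comp (fullMerge k D n)

/-- The dot `ω_n` on a strand of thickness `n`, when all thicknesses are allowed; `ω_0` is the
identity. -/
def omega : ∀ n : ℕ, Expr k (Gen Set.univ) (strand n) (strand n)
  | 0 => Expr.id []
  | n + 1 => Expr.gen (Gen.dot n.succPNat (Set.mem_univ _))

end diagrams

/-- The web relations: associativity of merges and of splits, the merge-split relation, and the
removal of a digon. -/
inductive WebRel (k : Type u) [CommRing k] (D : Set ℕ+) :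
    ∀ X Y : List ℕ+, Expr k (Gen D) X Y → Expr k (Gen D) X Y → Prop
  | merge_assoc (a b c : ℕ) (ha : 0 < a) (hb : 0 < b) (hc : 0 < c) :
      WebRel k D _ _
        (((merge k D a b).tensor (Expr.id (strand c))).comp (merge k D (a + b) c))
        ((((Expr.id (strand a)).tensor (merge k D b c)).comp (merge k D a (b + c))).cast
          (List.append_assoc _ _ _).symm (by rw [Nat.add_assoc]))
  | split_assoc (a b c : ℕ) (ha : 0 < a) (hb : 0 < b) (hc : 0 < c) :
      WebRel k D _ _
        ((split k D (a + b) c).comp ((split k D a b).tensor (Expr.id (strand c))))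
        (((split k D a (b + c)).comp ((Expr.id (strand a)).tensor (split k D b c))).cast
          (by rw [Nat.add_assoc]) (List.append_assoc _ _ _).symm)
  | merge_split (a b c d : ℕ) (ha : 0 < a) (hb : 0 < b) (hc : 0 < c) (hd : 0 < d)
      (h : a + c = b + d) :
      WebRel k D (strand a ++ strand c) (strand b ++ strand d)
        ((merge k D a c).comp ((split k D b d).cast (by rw [h]) rfl))
        ((List.range (min a b + 1)).map fun s => ((List.range (min c d + 1)).map fun t =>
          if hst : (s ≤ a ∧ s ≤ b) ∧ (t ≤ c ∧ t ≤ d) ∧ t + a = s + d then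
            (exchange s (a - s) (c - t) t (cross k D (a - s) (c - t))).cast
              (by congr 2 <;> omega) (by congr 2 <;> omega)
          else 0).sum).sum
  | digon (a b : ℕ) (ha : 0 < a) (hb : 0 < b) :
      WebRel k D _ _ ((split k D a b).comp (merge k D a b))
        (((a + b).choose a : k) • Expr.id (strand (a + b)))

/-- The defining relations of the affine web category. -/
inductive AffRel (k : Type u) [CommRing k] :
    ∀ X Y : List ℕ+, Expr k (Gen Set.univ) X Y → Expr k (Gen Set.univ) X Y → Prop
  | web {X Y : List ℕ+} {f g : Expr k (Gen Set.univ) X Y} (h : WebRel k Set.univ X Y f g) :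
      AffRel k X Y f g
  | cross_dot (a b : ℕ) (ha : 0 < a) (hb : 0 < b) :
      AffRel k (strand a ++ strand b) (strand b ++ strand a)
        ((cross k _ a b).comp ((omega k b).tensor (Expr.id (strand a))))
        ((List.range (min a b + 1)).map fun t =>
          if ht : t ≤ a ∧ t ≤ b then
            (t.factorial : k) • (exchange t (a - t) (b - t) t
              (((Expr.id (strand (a - t))).tensor (omega k (b - t))).comp
                (cross k _ (a - t) (b - t)))).cast
              (by congr 2 <;> omega) (by congr 2 <;> omega)
          else 0).sum
  | dot_cross (a b : ℕ) (ha : 0 < a) (hb : 0 < b) :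
      AffRel k (strand b ++ strand a) (strand a ++ strand b)
        (((omega k b).tensor (Expr.id (strand a))).comp (cross k _ b a))
        ((List.range (min a b + 1)).map fun t =>
          if ht : t ≤ a ∧ t ≤ b then
            (t.factorial : k) • (exchange t (b - t) (a - t) t
              ((cross k _ (b - t) (a - t)).comp
                ((Expr.id (strand (a - t))).tensor (omega k (b - t))))).cast
              (by congr 2 <;> omega) (by congr 2 <;> omega)
          else 0).sum
  | dot_split (a b : ℕ) (ha : 0 < a) (hb : 0 < b) :
      AffRel k _ _ ((omega k (a + b)).comp (split k _ a b))
        ((split k _ a b).comp ((omega k a).tensor (omega k b)))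
  | merge_dot (a b : ℕ) (ha : 0 < a) (hb : 0 < b) :
      AffRel k _ _ ((merge k _ a b).comp (omega k (a + b)))
        (((omega k a).tensor (omega k b)).comp (merge k _ a b))
  | balloon_eq (a : ℕ) (ha : 0 < a) :
      AffRel k _ _ (balloon k _ (Set.mem_univ _) a) ((a.factorial : k) • omega k a)

/-- The defining relations of the reduced affine web category, whose only dot is the one on a
strand of thickness `1`. -/
inductive ReducedRel (k : Type u) [CommRing k] :
    ∀ X Y : List ℕ+, Expr k (Gen {1}) X Y → Expr k (Gen {1}) X Y → Prop
  | web {X Y : List ℕ+} {f g : Expr k (Gen {1}) X Y} (h : WebRel k {1} X Y f g) :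
      ReducedRel k X Y f g
  | cross_dot :
      ReducedRel k [1, 1] [1, 1]
        ((cross k _ 1 1).comp ((thinDot k _ (Set.mem_singleton 1)).tensor (Expr.id [1])))
        (((Expr.id [1]).tensor (thinDot k _ (Set.mem_singleton 1))).comp (cross k _ 1 1) + Expr.id [1, 1])
  | dot_cross :
      ReducedRel k [1, 1] [1, 1]
        (((thinDot k _ (Set.mem_singleton 1)).tensor (Expr.id [1])).comp (cross k _ 1 1))
        ((cross k _ 1 1).comp ((Expr.id [1]).tensor (thinDot k _ (Set.mem_singleton 1))) + Expr.id [1, 1])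

/-- The affine web category over `k`. -/
abbrev AW (k : Type u) [CommRing k] : Type := PresCat (AffRel k)

/-- The reduced affine web category over `k`. -/
abbrev ReducedAW (k : Type u) [CommRing k] : Type := PresCat (ReducedRel k)

end AffineWeb

/-! In characteristic zero a strand of thickness `n` is a direct summand of `n` strands of thickness
1: iterating the digon relation, the full split followed by the full merge is `n!` times the
identity. Hence sandwiching a morphism of the reduced category between full merges and full splits,
suitably normalised (`thinning`), embeds the morphisms between two words of weight `N` into the
endomorphism algebra of `N` thin strands, compatibly with composition and tensor products. Relations
in the reduced category can therefore be checked inside one algebra.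

In that algebra the thin crossings and dots satisfy the relations of the degenerate affine Hecke
algebra. The Coxeter relations are not imposed; they follow from merge-split. Let `e n` be the image
of the identity of the thick strand, and `e' n` its copy on the last `n` of `n + 1` strands.
Merge-split from `(1, n)` to itself reads `(n + 1) e (n + 1) = e' n + n (e' n) s (e' n)`. For `n =
1` it gives `2 (e 2) = 1 + s`, hence `s * s = 1`; for `n = 2`, compared with its mirror image, it
gives the braid relation; in general it identifies `e n` with the symmetrizer (`thickId_eq`).
Comparing merge-split from `(a, b)` to `(b, a)` with the double coset decomposition of a symmetrizer
(`double_coset`) shows by induction that a thick crossing is a symmetrized block of thin crossings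
(`thinning_cross`).

The balloon divided by `a!` becomes the symmetrizer times the product of `a` dots. That product
commutes with the symmetrizer, which gives compatibility with merges and splits. The dot-crossing
relations become `pair_mul_block_mul_dots` and its reflection: pulling dots through a block leaves
error terms, which the symmetrizers collect with multiplicity `t! * choose a t * choose b t`, and
the two binomials are exactly what the splits in `E_{t,t}` contribute. Conversely, sending the
single dot to `ω_1` respects the relations, which are the case `a = b = 1`. The two functors are
mutually inverse on generators because `B_1(x) = x` and `B_a(ω_1) = a! ω_a`. -/

/-! ## Symmetrizers in a ring with an action of simple transpositions -/

namespace SymRing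

section elements

variable {A : Type*} [Monoid A]

/-- The product `s i * s (i + 1) * ⋯ * s (i + j - 1)`, which moves the strand at position `i` past
the next `j` strands. -/
def cyc (s : ℕ → A) (i : ℕ) : ℕ → A
  | 0 => 1
  | j + 1 => cyc s i j * s (i + j)

/-- The element in which `a` strands starting from position `i` cross the next `b` strands. -/
def block (s : ℕ → A) : ℕ → ℕ → ℕ → A
  | _, 0, _ => 1
  | i, a + 1, b => block s (i + 1) a b * cyc s i b

/-- The symmetrizing idempotent on the `n` strands starting from position `i`. -/
def symm (k : Type*) {A : Type*} [Field k] [Ring A] [Algebra k A] (s : ℕ → A) : ℕ → ℕ → A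
  | _, 0 => 1
  | i, n + 1 => ((n + 1 : k)⁻¹) • (symm k s (i + 1) n * ∑ j ∈ Finset.range (n + 1), cyc s i j)

theorem cyc_zero (s : ℕ → A) (i : ℕ) : cyc s i 0 = 1 := rfl

theorem cyc_succ (s : ℕ → A) (i j : ℕ) : cyc s i (j + 1) = cyc s i j * s (i + j) := rfl

theorem cyc_one (s : ℕ → A) (i : ℕ) : cyc s i 1 = s i := by simp [cyc]

theorem cyc_add (s : ℕ → A) (i m n : ℕ) : cyc s i (m + n) = cyc s i m * cyc s (i + m) n := by
  induction n with
  | zero => simp [cyc]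
  | succ n ih => rw [← add_assoc, cyc_succ, ih, cyc_succ, mul_assoc, ← add_assoc]

theorem cyc_succ' (s : ℕ → A) (i j : ℕ) : cyc s i (j + 1) = s i * cyc s (i + 1) j := by
  rw [add_comm j 1, cyc_add, cyc_one]

theorem block_zero (s : ℕ → A) (i b : ℕ) : block s i 0 b = 1 := rfl

theorem block_succ (s : ℕ → A) (i a b : ℕ) :
    block s i (a + 1) b = block s (i + 1) a b * cyc s i b := rfl

theorem block_zero_right (s : ℕ → A) (i a : ℕ) : block s i a 0 = 1 := by
  induction a generalizing i with
  | zero => rfl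
  | succ a ih => rw [block_succ, ih, cyc_zero, one_mul]

theorem commute_cyc {s : ℕ → A} {y : A} {i j : ℕ} (h : ∀ l, i ≤ l → l < i + j → Commute y (s l)) :
    Commute y (cyc s i j) := by
  induction j with
  | zero => exact Commute.one_right y
  | succ j ih =>
    exact (ih fun l h₁ h₂ => h l h₁ (by omega)).mul_right (h _ (by omega) (by omega))

theorem commute_block {s : ℕ → A} {y : A} {i a b : ℕ}
    (h : ∀ l, i ≤ l → l + 1 < i + a + b → Commute y (s l)) : Commute y (block s i a b) := by
  induction a generalizing i with
  | zero => exact Commute.one_right y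
  | succ a ih =>
    exact (ih fun l h₁ h₂ => h l (by omega) (by omega)).mul_right
      (commute_cyc fun l h₁ h₂ => h l h₁ (by omega))

theorem mul_cyc_eq {s : ℕ → A} {z : A} {i j : ℕ} (h : ∀ l, i ≤ l → l < i + j → z * s l = z) :
    z * cyc s i j = z := by
  induction j with
  | zero => rw [cyc_zero, mul_one]
  | succ j ih =>
    rw [cyc_succ, ← mul_assoc, ih fun l h₁ h₂ => h l h₁ (by omega), h _ (by omega) (by omega)]

theorem cyc_mul_eq {s : ℕ → A} {z : A} {i j : ℕ} (h : ∀ l, i ≤ l → l < i + j → s l * z = z) :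
    cyc s i j * z = z := by
  induction j with
  | zero => rw [cyc_zero, one_mul]
  | succ j ih =>
    rw [cyc_succ, mul_assoc, h _ (by omega) (by omega), ih fun l h₁ h₂ => h l h₁ (by omega)]

theorem block_mul_eq {s : ℕ → A} {z : A} {i a b : ℕ}
    (h : ∀ l, i ≤ l → l + 1 < i + a + b → s l * z = z) : block s i a b * z = z := by
  induction a generalizing i with
  | zero => rw [block_zero, one_mul]
  | succ a ih =>
    rw [block_succ, mul_assoc, cyc_mul_eq fun l h₁ h₂ => h l h₁ (by omega),
      ih fun l h₁ h₂ => h l (by omega) (by omega)]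

theorem map_cyc {B F : Type*} [Monoid B] [FunLike F A B] [MonoidHomClass F A B] (f : F)
    (s : ℕ → A) (s' : ℕ → B) (i d j : ℕ) (h : ∀ l, i ≤ l → l < i + j → f (s l) = s' (d + l)) :
    f (cyc s i j) = cyc s' (d + i) j := by
  induction j with
  | zero => simp [cyc]
  | succ j ih =>
    rw [cyc_succ, cyc_succ, map_mul, ih fun l h₁ h₂ => h l h₁ (by omega), h _ (by omega) (by omega),
      add_assoc]

theorem map_block {B F : Type*} [Monoid B] [FunLike F A B] [MonoidHomClass F A B] (f : F)
    (s : ℕ → A) (s' : ℕ → B) (i d a b : ℕ)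
    (h : ∀ l, i ≤ l → l + 1 < i + a + b → f (s l) = s' (d + l)) :
    f (block s i a b) = block s' (d + i) a b := by
  induction a generalizing i with
  | zero => simp [block]
  | succ a ih =>
    rw [block_succ, block_succ, map_mul, ih (i + 1) fun l h₁ h₂ => h l (by omega) (by omega),
      map_cyc f s s' i d b fun l h₁ h₂ => h l h₁ (by omega), add_assoc]

end elements

section symmetrizer

variable (k : Type*) [Field k] {A : Type*} [Ring A] [Algebra k A]

theorem symm_zero (s : ℕ → A) (i : ℕ) : symm k s i 0 = 1 := rfl

theorem symm_one (s : ℕ → A) (i : ℕ) : symm k s i 1 = 1 := by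
  simp [symm, cyc]

theorem commute_symm {s : ℕ → A} {y : A} {i n : ℕ}
    (h : ∀ l, i ≤ l → l + 1 < i + n → Commute y (s l)) : Commute y (symm k s i n) := by
  induction n generalizing i with
  | zero => exact Commute.one_right y
  | succ n ih =>
    refine Commute.smul_right ((ih fun l h₁ h₂ => h l (by omega) (by omega)).mul_right ?_) _
    refine Commute.sum_right _ _ _ fun j hj => commute_cyc fun l h₁ h₂ => h l h₁ ?_
    have := Finset.mem_range.1 hj
    omega

theorem map_symm {B : Type*} [Ring B] [Algebra k B] (f : A →ₐ[k] B)
    (s : ℕ → A) (s' : ℕ → B) (i d n : ℕ)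
    (h : ∀ l, i ≤ l → l + 1 < i + n → f (s l) = s' (d + l)) :
    f (symm k s i n) = symm k s' (d + i) n := by
  induction n generalizing i with
  | zero => simp [symm]
  | succ n ih =>
    rw [symm, symm, map_smul, map_mul, ih (i + 1) fun l h₁ h₂ => h l (by omega) (by omega),
      map_sum, add_assoc]
    congr 2
    refine Finset.sum_congr rfl fun j hj => map_cyc f s s' i d j fun l h₁ h₂ => h l h₁ ?_
    have := Finset.mem_range.1 hj
    omega

variable [CharZero k]

theorem succ_smul_symm (s : ℕ → A) (i n : ℕ) :
    (n + 1 : k) • symm k s i (n + 1) =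
      symm k s (i + 1) n * ∑ j ∈ Finset.range (n + 1), cyc s i j := by
  rw [symm, smul_smul, mul_inv_cancel₀ (Nat.cast_add_one_ne_zero n), one_smul]

/-- The symmetrizer is a normalised average of products of generators, each of which fixes `z`; no
relations between the generators are needed. -/
theorem symm_mul_eq {s : ℕ → A} {z : A} {i n : ℕ}
    (h : ∀ l, i ≤ l → l + 1 < i + n → s l * z = z) : symm k s i n * z = z := by
  induction n generalizing i with
  | zero => rw [symm_zero, one_mul]
  | succ n ih =>
    have : (∑ j ∈ Finset.range (n + 1), cyc s i j) * z = (n + 1 : k) • z := by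
      rw [Finset.sum_mul, Finset.sum_congr rfl (g := fun _ => z)]
      · simp [← Nat.cast_smul_eq_nsmul k]
      · intro j hj
        have := Finset.mem_range.1 hj
        exact cyc_mul_eq fun l h₁ h₂ => h l h₁ (by omega)
    rw [symm, smul_mul_assoc, mul_assoc, this, mul_smul_comm,
      ih fun l h₁ h₂ => h l (by omega) (by omega), smul_smul,
      inv_mul_cancel₀ (Nat.cast_add_one_ne_zero n), one_smul]

theorem mul_symm_eq {s : ℕ → A} {z : A} {i n : ℕ}
    (h : ∀ l, i ≤ l → l + 1 < i + n → z * s l = z) : z * symm k s i n = z := by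
  induction n generalizing i with
  | zero => rw [symm_zero, mul_one]
  | succ n ih =>
    have : z * (∑ j ∈ Finset.range (n + 1), cyc s i j) = (n + 1 : k) • z := by
      rw [Finset.mul_sum, Finset.sum_congr rfl (g := fun _ => z)]
      · simp [← Nat.cast_smul_eq_nsmul k]
      · intro j hj
        have := Finset.mem_range.1 hj
        exact mul_cyc_eq fun l h₁ h₂ => h l h₁ (by omega)
    rw [symm, mul_smul_comm, ← mul_assoc, ih fun l h₁ h₂ => h l (by omega) (by omega), this,
      smul_smul, inv_mul_cancel₀ (Nat.cast_add_one_ne_zero n), one_smul]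

end symmetrizer

/-! ### Coxeter relations and absorption of crossings by symmetrizers. -/

/-- The relations of the simple transpositions of `N` letters. -/
structure Rel {A : Type*} [Monoid A] (N : ℕ) (s : ℕ → A) : Prop where
  sq : ∀ i, i + 1 < N → s i * s i = 1
  braid : ∀ i, i + 2 < N → s i * s (i + 1) * s i = s (i + 1) * s i * s (i + 1)
  comm : ∀ i j, i + 1 < j → j + 1 < N → Commute (s i) (s j)

namespace Rel

section monoid

variable {A : Type*} [Monoid A] {N : ℕ} {s : ℕ → A}

/-- The relations are stable under reversing products, so a statement about multiplication on one
side yields the other one in the opposite ring. -/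
theorem op (H : Rel N s) : Rel N fun i => MulOpposite.op (s i) where
  sq i hi := by rw [← MulOpposite.op_mul, H.sq i hi, MulOpposite.op_one]
  braid i hi := by
    simp only [← MulOpposite.op_mul]
    rw [← mul_assoc, H.braid i hi, mul_assoc]
  comm i j h₁ h₂ := (H.comm i j h₁ h₂).op

theorem comm' (H : Rel N s) {i j : ℕ} (h : i + 1 < j ∨ j + 1 < i) (hi : i + 1 < N)
    (hj : j + 1 < N) : Commute (s i) (s j) := by
  rcases h with h | h
  · exact H.comm i j h hj
  · exact (H.comm j i h hi).symm

/-- A crossing between two strands slides through a third strand that passes both: far generators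
commute away and a single braid relation remains. -/
theorem mul_cyc (H : Rel N s) {i j l : ℕ} (h₁ : i ≤ l) (h₂ : l + 1 < i + j) (h : i + j < N) :
    s (l + 1) * cyc s i j = cyc s i j * s l := by
  obtain ⟨d, rfl⟩ := Nat.exists_eq_add_of_le h₁
  obtain ⟨r, rfl⟩ : ∃ r, j = d + (r + 2) := ⟨j - d - 2, by omega⟩
  have c₁ : Commute (s (i + d + 1)) (cyc s i d) :=
    commute_cyc fun m _ _ => H.comm' (by omega) (by omega) (by omega)
  have c₂ : Commute (s (i + d)) (cyc s (i + d + 1 + 1) r) :=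
    commute_cyc fun m _ _ => H.comm' (by omega) (by omega) (by omega)
  have b := H.braid (i + d) (by omega)
  rw [cyc_add, cyc_succ', cyc_succ', ← mul_assoc, c₁.eq]
  simp only [mul_assoc]
  rw [← c₂.eq]
  congr 1
  simp only [← mul_assoc]
  rw [b]

theorem block_add (H : Rel N s) {i a b c : ℕ} (h : i + a + b + c ≤ N) :
    block s i a (b + c) = block s i a b * block s (i + b) a c := by
  induction a generalizing i with
  | zero => simp [block]
  | succ a ih =>
    have : Commute (block s (i + 1 + b) a c) (cyc s i b) :=
      commute_cyc fun l _ _ => (commute_block fun m _ _ =>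
        H.comm' (by omega) (by omega) (by omega)).symm
    rw [block_succ, block_succ, block_succ, ih (by omega), cyc_add, add_right_comm i b 1]
    simp only [mul_assoc]
    rw [← mul_assoc (block s (i + 1 + b) a c), this.eq, mul_assoc]

theorem block_mul (H : Rel N s) {i a b l : ℕ} (h₁ : i ≤ l) (h₂ : l + 1 < i + b)
    (h : i + a + b ≤ N) : block s i a b * s l = s (l + a) * block s i a b := by
  induction a generalizing i l with
  | zero => simp [block]
  | succ a ih =>
    rw [block_succ, mul_assoc, ← H.mul_cyc h₁ h₂ (by omega), ← mul_assoc,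
      ih (by omega) (by omega) (by omega), mul_assoc, add_assoc, add_comm 1 a]

/-- Reflecting a diagram exchanges the two bundles. The case of a single strand is `key`; the
general case cuts the block with `block_add`. -/
theorem op_block (H : Rel N s) {i a b : ℕ} (h : i + a + b ≤ N) :
    block (fun i => MulOpposite.op (s i)) i a b = MulOpposite.op (block s i b a) := by
  have key : ∀ i j, cyc (fun i => MulOpposite.op (s i)) i j = MulOpposite.op (block s i j 1) := by
    intro i j
    induction j generalizing i with
    | zero => rfl
    | succ j ih => rw [cyc_succ', block_succ, cyc_one, MulOpposite.op_mul, ih]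
  induction a generalizing i with
  | zero => rw [block_zero, block_zero_right, MulOpposite.op_one]
  | succ a ih =>
    rw [block_succ, key, add_comm a 1, H.block_add (by omega), MulOpposite.op_mul,
      ih (by omega)]

theorem block_mul' (H : Rel N s) {i a b l : ℕ} (h₁ : i ≤ l) (h₂ : l + 1 < i + a)
    (h : i + a + b ≤ N) : block s i a b * s (l + b) = s l * block s i a b := by
  have := H.op.block_mul (a := b) (b := a) h₁ h₂ (by omega)
  rw [H.op_block (by omega)] at this
  exact (MulOpposite.op_injective this).symm

end monoid

variable (k : Type*) [Field k] {A : Type*} [Ring A] [Algebra k A] {N : ℕ} {s : ℕ → A}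

theorem symm_mul_gen (H : Rel N s) {i n l : ℕ} (h₁ : i ≤ l) (h₂ : l + 1 < i + n) (h : i + n ≤ N) :
    symm k s i n * s l = symm k s i n := by
  induction n generalizing i l with
  | zero => omega
  | succ n ih =>
    rw [symm, smul_mul_assoc, mul_assoc, Finset.sum_mul, Finset.mul_sum, Finset.mul_sum]
    congr 1
    -- Right multiplication by `s l` exchanges the two coset representatives of lengths `l - i` and
    -- `l - i + 1`. It slides through every other one and is then absorbed by the smaller
    -- symmetrizer.
    refine Finset.sum_equiv (Equiv.swap (l - i) (l - i + 1)) ?_ ?_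
    · intro j
      simp only [Finset.mem_range]
      rcases eq_or_ne j (l - i) with rfl | hj
      · rw [Equiv.swap_apply_left]; omega
      rcases eq_or_ne j (l - i + 1) with rfl | hj'
      · rw [Equiv.swap_apply_right]; omega
      rw [Equiv.swap_apply_of_ne_of_ne hj hj']
    · intro j hj
      have hj := Finset.mem_range.1 hj
      rcases eq_or_ne j (l - i) with rfl | h₃
      · rw [Equiv.swap_apply_left, cyc_succ, Nat.add_sub_cancel' h₁]
      rcases eq_or_ne j (l - i + 1) with rfl | h₄
      · rw [Equiv.swap_apply_right, cyc_succ, Nat.add_sub_cancel' h₁, mul_assoc, H.sq l (by omega),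
          mul_one]
      rw [Equiv.swap_apply_of_ne_of_ne h₃ h₄]
      rcases lt_or_gt_of_ne h₃ with h₃ | h₃
      · have : Commute (s l) (cyc s i j) :=
          commute_cyc fun m _ _ => H.comm' (by omega) (by omega) (by omega)
        rw [← this.eq, ← mul_assoc, ih (by omega) (by omega) (by omega)]
      · rw [← H.mul_cyc h₁ (by omega) (by omega), ← mul_assoc,
          ih (by omega) (by omega) (by omega)]

theorem commute_symm_symm (H : Rel N s) {i n j m : ℕ} (h₁ : i + n ≤ j) (h : j + m ≤ N) :
    Commute (symm k s i n) (symm k s j m) :=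
  commute_symm k fun _ _ _ => (commute_symm k fun _ _ _ =>
    H.comm' (by omega) (by omega) (by omega)).symm

variable [CharZero k]

/-- The symmetrizer absorbs generators on the right and its reflection absorbs them on the left, so
their product equals each of them. This gives left absorption without another coset computation. -/
theorem op_symm (H : Rel N s) {i n : ℕ} (h : i + n ≤ N) :
    symm k (fun i => MulOpposite.op (s i)) i n = MulOpposite.op (symm k s i n) := by
  have h₁ : symm k s i n * (symm k (fun i => MulOpposite.op (s i)) i n).unop = symm k s i n := by
    apply MulOpposite.op_injective
    rw [MulOpposite.op_mul, MulOpposite.op_unop]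
    refine symm_mul_eq k fun l hl hl' => ?_
    rw [← MulOpposite.op_mul, H.symm_mul_gen k hl hl' h]
  have h₂ : symm k s i n * (symm k (fun i => MulOpposite.op (s i)) i n).unop =
      (symm k (fun i => MulOpposite.op (s i)) i n).unop := by
    refine symm_mul_eq k fun l hl hl' => ?_
    apply MulOpposite.op_injective
    rw [MulOpposite.op_mul, MulOpposite.op_unop]
    exact H.op.symm_mul_gen k hl hl' h
  exact (MulOpposite.unop_injective (h₁.symm.trans h₂)).symm

theorem gen_mul_symm (H : Rel N s) {i n l : ℕ} (h₁ : i ≤ l) (h₂ : l + 1 < i + n) (h : i + n ≤ N) :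
    s l * symm k s i n = symm k s i n := by
  have := H.op.symm_mul_gen k h₁ h₂ h
  rw [H.op_symm k h] at this
  exact MulOpposite.op_injective this

theorem symm_mul_symm (H : Rel N s) {i n j m : ℕ} (h₁ : i ≤ j) (h₂ : j + m ≤ i + n)
    (h : i + n ≤ N) : symm k s i n * symm k s j m = symm k s i n :=
  mul_symm_eq k fun _ _ _ => H.symm_mul_gen k (by omega) (by omega) h

/-- A symmetrizer as a sum over the positions to which its last strand is moved. -/
theorem sum_cyc_mul_symm (H : Rel N s) {i n : ℕ} (h : i + n < N) :
    ∑ j ∈ Finset.range (n + 1), cyc s (i + n - j) j * symm k s i n =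
      (n + 1 : k) • symm k s i (n + 1) := by
  have h₁ : symm k s i (n + 1) * ∑ j ∈ Finset.range (n + 1), cyc s (i + n - j) j * symm k s i n =
      (n + 1 : k) • symm k s i (n + 1) := by
    rw [Finset.mul_sum, Finset.sum_congr rfl (g := fun _ => symm k s i (n + 1))]
    · simp [← Nat.cast_smul_eq_nsmul k]
    · intro j hj
      have hj := Finset.mem_range.1 hj
      rw [← mul_assoc, mul_cyc_eq fun l h₁ h₂ => H.symm_mul_gen k (by omega) (by omega) (by omega)]
      exact H.symm_mul_symm k (by omega) (by omega) (by omega)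
  -- By `h₁` the symmetrizer times the sum is the right-hand side. It remains to see that the sum is
  -- already fixed by left multiplication by each generator, which again swaps two terms and
  -- preserves the others.
  rw [← h₁]
  refine (symm_mul_eq k fun l hl hl' => ?_).symm
  rw [Finset.mul_sum]
  refine Finset.sum_equiv (Equiv.swap (i + n - l - 1) (i + n - l)) ?_ ?_
  · intro j
    simp only [Finset.mem_range]
    rcases eq_or_ne j (i + n - l - 1) with rfl | hj
    · rw [Equiv.swap_apply_left]; omega
    rcases eq_or_ne j (i + n - l) with rfl | hj'
    · rw [Equiv.swap_apply_right]; omega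
    rw [Equiv.swap_apply_of_ne_of_ne hj hj']
  · intro j hj
    have hj := Finset.mem_range.1 hj
    rcases eq_or_ne j (i + n - l - 1) with rfl | h₃
    · rw [Equiv.swap_apply_left, ← mul_assoc, show i + n - (i + n - l) = l by omega,
        show i + n - (i + n - l - 1) = l + 1 by omega, ← cyc_succ',
        show i + n - l - 1 + 1 = i + n - l by omega]
    rcases eq_or_ne j (i + n - l) with rfl | h₄
    · obtain ⟨r, hr⟩ : ∃ r, i + n - l = r + 1 := ⟨i + n - l - 1, by omega⟩
      rw [Equiv.swap_apply_right, hr, show i + n - (r + 1) = l by omega, cyc_succ', ← mul_assoc,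
        ← mul_assoc, H.sq l (by omega), one_mul, show i + n - (r + 1 - 1) = l + 1 by omega,
        Nat.add_sub_cancel]
    rw [Equiv.swap_apply_of_ne_of_ne h₃ h₄]
    rcases lt_or_gt_of_ne h₄ with h₄ | h₄
    · have : Commute (s l) (cyc s (i + n - j) j) :=
        commute_cyc fun m _ _ => H.comm' (by omega) (by omega) (by omega)
      rw [← mul_assoc, this.eq, mul_assoc, H.gen_mul_symm k (by omega) (by omega) (by omega)]
    · obtain ⟨m, rfl⟩ : ∃ m, l = m + 1 := ⟨l - 1, by omega⟩
      rw [← mul_assoc, H.mul_cyc (by omega) (by omega) (by omega), mul_assoc,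
        H.gen_mul_symm k (by omega) (by omega) (by omega)]

/-- All nontrivial coset representatives start with `s i`. The smaller symmetrizer on the left can
emit a symmetrizer on one strand fewer, which commutes past `s i` and completes the remaining sum to
a symmetrizer. Merge-split produces the same recursion in `thickId_recursion`. -/
theorem symm_recursion (H : Rel N s) {i n : ℕ} (h : i + n < N) :
    (n + 1 : k) • symm k s i (n + 1) =
      symm k s (i + 1) n + (n : k) • (symm k s (i + 1) n * s i * symm k s (i + 1) n) := by
  rw [succ_smul_symm, Finset.sum_range_succ', mul_add, cyc_zero, mul_one, add_comm]
  congr 1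
  rcases n with _ | n
  · simp
  have := succ_smul_symm k s (i + 1) n
  push_cast
  rw [← mul_smul_comm, this, ← mul_assoc, mul_assoc _ (s i)]
  have c : Commute (s i) (symm k s (i + 1 + 1) n) :=
    commute_symm k fun _ _ _ => H.comm' (by omega) (by omega) (by omega)
  rw [c.eq, ← mul_assoc, H.symm_mul_symm k (by omega) (by omega) (by omega), mul_assoc,
    Finset.mul_sum]
  simp only [cyc_succ', Finset.mul_sum]

end Rel

end SymRing

/-! ### Double coset decomposition of a symmetrizer. -/

namespace SymRing

variable (k : Type*) [Field k] {A : Type*} [Ring A] [Algebra k A]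

/-- The symmetrizer of two adjacent groups of `a` and `b` strands, starting from position `i`. -/
def pair (s : ℕ → A) (i a b : ℕ) : A := symm k s i a * symm k s (i + a) b

theorem mul_pair_eq [CharZero k] {s : ℕ → A} {z : A} {i a b : ℕ}
    (h : ∀ l, i ≤ l → l + 1 < i + a + b → l + 1 ≠ i + a → z * s l = z) :
    z * pair k s i a b = z := by
  rw [pair, ← mul_assoc, mul_symm_eq k fun l _ _ => h l (by omega) (by omega) (by omega),
    mul_symm_eq k fun l _ _ => h l (by omega) (by omega) (by omega)]

theorem pair_mul_eq [CharZero k] {s : ℕ → A} {z : A} {i a b : ℕ}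
    (h : ∀ l, i ≤ l → l + 1 < i + a + b → l + 1 ≠ i + a → s l * z = z) :
    pair k s i a b * z = z := by
  rw [pair, mul_assoc, symm_mul_eq k fun l _ _ => h l (by omega) (by omega) (by omega),
    symm_mul_eq k fun l _ _ => h l (by omega) (by omega) (by omega)]

theorem commute_pair {s : ℕ → A} {y : A} {i a b : ℕ}
    (h : ∀ l, i ≤ l → l + 1 < i + a + b → l + 1 ≠ i + a → Commute y (s l)) :
    Commute y (pair k s i a b) :=
  (commute_symm k fun l _ _ => h l (by omega) (by omega) (by omega)).mul_right
    (commute_symm k fun l _ _ => h l (by omega) (by omega) (by omega))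

namespace Rel

variable {k} {N : ℕ} {s : ℕ → A}

theorem pair_mul_gen (H : Rel N s) {i a b l : ℕ} (h₁ : i ≤ l) (h₂ : l + 1 < i + a + b)
    (h₃ : l + 1 ≠ i + a) (h : i + a + b ≤ N) : pair k s i a b * s l = pair k s i a b := by
  rw [pair]
  rcases lt_or_gt_of_ne h₃ with h₃ | h₃
  · rw [(H.commute_symm_symm k le_rfl h).eq, mul_assoc,
      H.symm_mul_gen k h₁ h₃ (by omega)]
  · rw [mul_assoc, H.symm_mul_gen k (by omega) h₂ h]

variable [CharZero k]

theorem gen_mul_pair (H : Rel N s) {i a b l : ℕ} (h₁ : i ≤ l) (h₂ : l + 1 < i + a + b)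
    (h₃ : l + 1 ≠ i + a) (h : i + a + b ≤ N) : s l * pair k s i a b = pair k s i a b := by
  rw [pair]
  rcases lt_or_gt_of_ne h₃ with h₃ | h₃
  · rw [← mul_assoc, H.gen_mul_symm k h₁ h₃ (by omega)]
  · rw [(H.commute_symm_symm k le_rfl h).eq, ← mul_assoc, H.gen_mul_symm k (by omega) h₂ h]

theorem op_pair (H : Rel N s) {i a b : ℕ} (h : i + a + b ≤ N) :
    pair k (fun i => MulOpposite.op (s i)) i a b = MulOpposite.op (pair k s i a b) := by
  rw [pair, pair, H.op_symm k (by omega), H.op_symm k h, (H.commute_symm_symm k le_rfl h).eq,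
    MulOpposite.op_mul]

/-- Blocks of strands that are symmetrized may be crossed. -/
theorem pair_mul_block (H : Rel N s) {i a b : ℕ} (h : i + a + b ≤ N) :
    pair k s i a b * block s i a b * pair k s i b a = pair k s i a b * block s i a b := by
  refine mul_pair_eq k fun l h₁ h₂ h₃ => ?_
  rcases lt_or_gt_of_ne h₃ with h₃ | h₃
  · rw [mul_assoc, H.block_mul h₁ h₃ h, ← mul_assoc,
      H.pair_mul_gen (by omega) (by omega) (by omega) h]
  · obtain ⟨m, rfl⟩ : ∃ m, l = m + b := ⟨l - b, by omega⟩
    rw [mul_assoc, H.block_mul' (by omega) (by omega) h, ← mul_assoc,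
      H.pair_mul_gen (by omega) (by omega) (by omega) h]

theorem pair_mul_inner (H : Rel N s) {i a b : ℕ} (h : i + (a + 1) + b ≤ N) :
    pair k s i (a + 1) b * pair k s (i + 1) a b = pair k s i (a + 1) b :=
  mul_pair_eq k fun _ _ _ _ => H.pair_mul_gen (by omega) (by omega) (by omega) h

/-- One more strand, at position `i`, is added to a bundle of `a` strands and passes all `b` others.
The inner right symmetrizers slide through it and are absorbed; its first `t` crossings commute with
`m` and are absorbed on the left. The remaining `b - t` crossings extend a block of parameter `t` by
one strand. -/
theorem pair_mul_cyc_mul_pair (H : Rel N s) {i a b t : ℕ} {m : A} (h : i + (a + 1) + b ≤ N)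
    (hta : t ≤ a) (htb : t ≤ b) (hm : Commute m (cyc s i t)) :
    pair k s i (a + 1) b * (pair k s (i + 1) a b * m * pair k s (i + 1) b a) *
        (cyc s i b * pair k s i b (a + 1)) =
      pair k s i (a + 1) b * (m * cyc s (i + t) (b - t)) * pair k s i b (a + 1) := by
  have h₁ : pair k s (i + 1) b a * (cyc s i b * pair k s i b (a + 1)) =
      cyc s i b * pair k s i b (a + 1) := by
    refine pair_mul_eq k fun l h₁ h₂ h₃ => ?_
    rcases lt_or_gt_of_ne h₃ with h₃ | h₃
    · obtain ⟨r, rfl⟩ : ∃ r, l = r + 1 := ⟨l - 1, by omega⟩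
      rw [← mul_assoc, H.mul_cyc (by omega) (by omega) (by omega), mul_assoc,
        H.gen_mul_pair (by omega) (by omega) (by omega) (by omega)]
    · have : Commute (s l) (cyc s i b) :=
        commute_cyc fun m _ _ => H.comm' (by omega) (by omega) (by omega)
      rw [← mul_assoc, this.eq, mul_assoc,
        H.gen_mul_pair (by omega) (by omega) (by omega) (by omega)]
  have h₂ : pair k s i (a + 1) b * cyc s i t = pair k s i (a + 1) b :=
    mul_cyc_eq fun l _ _ => H.pair_mul_gen (by omega) (by omega) (by omega) h
  calc _ = pair k s i (a + 1) b * pair k s (i + 1) a b * m *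
        (pair k s (i + 1) b a * (cyc s i b * pair k s i b (a + 1))) := by
        simp only [mul_assoc]
    _ = pair k s i (a + 1) b * m * (cyc s i (t + (b - t)) * pair k s i b (a + 1)) := by
        rw [h₁, H.pair_mul_inner h, Nat.add_sub_cancel' htb]
    _ = pair k s i (a + 1) b * (m * cyc s i t) * cyc s (i + t) (b - t) * pair k s i b (a + 1) := by
        rw [cyc_add]
        simp only [mul_assoc]
    _ = _ := by
        rw [hm.eq, ← mul_assoc, h₂]
        simp only [mul_assoc]

/-- The complementary case, in which the new strand does not pass the others. The inner symmetrizer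
on `b` strands is expanded over the positions of its last strand; `b - t` of these raise the
parameter of the block to `t + 1`, and the other `t` keep it at `t`. -/
theorem pair_mul_block_mul_pair (H : Rel N s) {i a b t : ℕ} (h : i + (a + 1) + b ≤ N)
    (hta : t ≤ a) (htb : t ≤ b) :
    pair k s i (a + 1) b * (pair k s (i + 1) a b * block s (i + 1 + t) (a - t) (b - t) *
        pair k s (i + 1) b a) * ((b : k) • pair k s i b (a + 1)) =
      ((b - t : ℕ) : k) • (pair k s i (a + 1) b * block s (i + (t + 1)) (a + 1 - (t + 1))
          (b - (t + 1)) * pair k s i b (a + 1)) +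
        (t : k) • (pair k s i (a + 1) b * block s (i + t) (a + 1 - t) (b - t) *
          pair k s i b (a + 1)) := by
  rcases b with _ | b
  · obtain rfl : t = 0 := by omega
    simp
  have h₁ : pair k s (i + 1) (b + 1) a * (((b + 1 : ℕ) : k) • pair k s i (b + 1) (a + 1)) =
      ∑ j ∈ Finset.range (b + 1), cyc s (i + 1 + b - j) j * pair k s i (b + 1) (a + 1) := by
    have e₁ : symm k s (i + 1 + (b + 1)) a * pair k s i (b + 1) (a + 1) =
        pair k s i (b + 1) (a + 1) :=
      symm_mul_eq k fun _ _ _ => H.gen_mul_pair (by omega) (by omega) (by omega) (by omega)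
    have e₂ : symm k s (i + 1) b * pair k s i (b + 1) (a + 1) = pair k s i (b + 1) (a + 1) :=
      symm_mul_eq k fun _ _ _ => H.gen_mul_pair (by omega) (by omega) (by omega) (by omega)
    have e₃ := H.sum_cyc_mul_symm k (i := i + 1) (n := b) (by omega)
    rw [pair, mul_assoc, mul_smul_comm, mul_smul_comm, e₁, ← smul_mul_assoc, Nat.cast_succ, ← e₃,
      Finset.sum_mul]
    exact Finset.sum_congr rfl fun j _ => by rw [mul_assoc, e₂]
  -- These crossings lie among the strands entering the block, so they move through it and are
  -- absorbed on the left; one column of the block is then absorbed on the right.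
  have h₂ : ∀ j ∈ Finset.range (b + 1 - t),
      pair k s i (a + 1) (b + 1) * block s (i + 1 + t) (a - t) (b + 1 - t) *
          (cyc s (i + 1 + b - j) j * pair k s i (b + 1) (a + 1)) =
        pair k s i (a + 1) (b + 1) * block s (i + (t + 1)) (a + 1 - (t + 1)) (b + 1 - (t + 1)) *
          pair k s i (b + 1) (a + 1) := by
    intro j hj
    have hj := Finset.mem_range.1 hj
    rw [← mul_assoc, mul_cyc_eq fun l h₁ h₂ => ?_]
    · rw [show b + 1 - t = b - t + 1 by omega, H.block_add (by omega), mul_assoc, mul_assoc,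
        block_mul_eq fun l _ _ => H.gen_mul_pair (by omega) (by omega) (by omega) (by omega),
        ← mul_assoc]
      congr 3 <;> omega
    · rw [mul_assoc, H.block_mul (by omega) (by omega) (by omega), ← mul_assoc,
        H.pair_mul_gen (by omega) (by omega) (by omega) h]
  -- Here the moved strand leaves the range of the block: `j` crossings commute with the block and
  -- are absorbed on the left, and the other `b + 1 - t` add a row to it.
  have h₃ : ∀ j ∈ Finset.range t,
      pair k s i (a + 1) (b + 1) * block s (i + 1 + t) (a - t) (b + 1 - t) *
          (cyc s (i + 1 + b - (b + 1 - t + j)) (b + 1 - t + j) * pair k s i (b + 1) (a + 1)) =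
        pair k s i (a + 1) (b + 1) * block s (i + t) (a + 1 - t) (b + 1 - t) *
          pair k s i (b + 1) (a + 1) := by
    intro j hj
    have hj := Finset.mem_range.1 hj
    have c : Commute (block s (i + 1 + t) (a - t) (b + 1 - t)) (cyc s (i + t - j) j) :=
      commute_cyc fun l _ _ => (commute_block fun m _ _ =>
        H.comm' (by omega) (by omega) (by omega)).symm
    rw [show i + 1 + b - (b + 1 - t + j) = i + t - j by omega, add_comm (b + 1 - t) j, cyc_add,
      ← mul_assoc, ← mul_assoc, mul_assoc _ _ (cyc s (i + t - j) j), c.eq, ← mul_assoc,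
      mul_cyc_eq fun l _ _ => H.pair_mul_gen (by omega) (by omega) (by omega) h,
      show i + t - j + j = i + t by omega, show a + 1 - t = a - t + 1 by omega, block_succ,
      add_right_comm i t 1]
    simp only [mul_assoc]
  calc _ = pair k s i (a + 1) (b + 1) * pair k s (i + 1) a (b + 1) *
        block s (i + 1 + t) (a - t) (b + 1 - t) *
        (pair k s (i + 1) (b + 1) a * (((b + 1 : ℕ) : k) • pair k s i (b + 1) (a + 1))) := by
        simp only [mul_assoc]
    _ = ∑ j ∈ Finset.range (b + 1 - t + t), pair k s i (a + 1) (b + 1) *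
        block s (i + 1 + t) (a - t) (b + 1 - t) *
          (cyc s (i + 1 + b - j) j * pair k s i (b + 1) (a + 1)) := by
        rw [h₁, H.pair_mul_inner h, Finset.mul_sum, Nat.sub_add_cancel htb]
    _ = _ := by
        rw [Finset.sum_range_add, Finset.sum_congr rfl h₂, Finset.sum_congr rfl h₃,
          Finset.sum_const, Finset.sum_const, Finset.card_range, Finset.card_range,
          Nat.cast_smul_eq_nsmul, Nat.cast_smul_eq_nsmul]

end Rel

/-- Coefficient bookkeeping for the induction on `a` in `double_coset`: the three contributions of
the previous two lemmas add up by the absorption identities for binomials and Pascal's rule. -/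
theorem sum_choose_smul {M : Type*} [AddCommGroup M] [Module k M] (a b : ℕ) (G : ℕ → M) :
    ∑ t ∈ Finset.range (b + 1), ((a.choose t * b.choose t : ℕ) : k) •
        ((a + 1 : k) • G t + (((b - t : ℕ) : k) • G (t + 1) + (t : k) • G t)) =
      (a + 1 : k) • ∑ t ∈ Finset.range (b + 1),
        (((a + 1).choose t * b.choose t : ℕ) : k) • G t := by
  have h₁ : ∑ t ∈ Finset.range (b + 1), ((a.choose t * b.choose t : ℕ) : k) •
        ((a + 1 : k) • G t + (((b - t : ℕ) : k) • G (t + 1) + (t : k) • G t)) =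
      ∑ t ∈ Finset.range (b + 1), ((a.choose t * b.choose t * (a + 1 + t) : ℕ) : k) • G t +
        ∑ t ∈ Finset.range (b + 1),
          ((a.choose t * b.choose t * (b - t) : ℕ) : k) • G (t + 1) := by
    rw [← Finset.sum_add_distrib]
    refine Finset.sum_congr rfl fun t _ => ?_
    push_cast
    module
  rw [h₁, Finset.sum_range_succ', Finset.sum_range_succ (fun t => _ • G (t + 1)),
    Finset.sum_range_succ' _ b, smul_add, Finset.smul_sum]
  simp only [Nat.sub_self, mul_zero, Nat.cast_zero, zero_smul, add_zero, Nat.choose_zero_right,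
    mul_one, one_mul, Nat.cast_one, one_smul, Nat.cast_add]
  rw [add_right_comm, ← Finset.sum_add_distrib]
  congr 1
  refine Finset.sum_congr rfl fun t _ => ?_
  rw [← add_smul, smul_smul]
  congr 1
  have e₁ := Nat.choose_succ_right_eq b t
  have e₂ := Nat.add_one_mul_choose_eq a t
  have e₃ := Nat.choose_succ_succ a t
  simp only [Nat.succ_eq_add_one] at e₃
  rw [e₃] at e₂ ⊢
  have : a.choose (t + 1) * b.choose (t + 1) * (a + 1 + (t + 1)) +
      a.choose t * b.choose t * (b - t) =
      (a + 1) * ((a.choose t + a.choose (t + 1)) * b.choose (t + 1)) := by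
    rw [mul_assoc (a.choose t), ← e₁]
    zify at e₂ ⊢
    linear_combination (-(b.choose (t + 1) : ℤ)) * e₂
  exact_mod_cast congrArg (Nat.cast : ℕ → k) this

namespace Rel

variable {k} [CharZero k] {N : ℕ} {s : ℕ → A}

/-- The decomposition of the symmetrizer on `a + b` strands along double cosets. -/
theorem double_coset (H : Rel N s) {i a b : ℕ} (h : i + a + b ≤ N) :
    ((a + b).choose a : k) • symm k s i (a + b) =
      ∑ t ∈ Finset.range (b + 1), ((a.choose t * b.choose t : ℕ) : k) •
        (pair k s i a b * block s (i + t) (a - t) (b - t) * pair k s i b a) := by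
  induction a generalizing i with
  | zero =>
    rw [Finset.sum_range_succ']
    have := H.symm_mul_symm k (i := i) (n := b) (j := i) (m := b) le_rfl le_rfl h
    simp [pair, symm_zero, block_zero, this]
  | succ a ih =>
    have ih := ih (i := i + 1) (by omega)
    have h₁ : pair k s i (a + 1) b * symm k s i (a + 1 + b) * pair k s i b (a + 1) =
        symm k s i (a + 1 + b) := by
      rw [mul_assoc, mul_pair_eq k fun _ _ _ _ => H.symm_mul_gen k (by omega) (by omega) (by omega),
        pair_mul_eq k fun _ _ _ _ => H.gen_mul_symm k (by omega) (by omega) (by omega)]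
    -- A representative shorter than `b` is absorbed by the pair; a longer one is absorbed except
    -- for its first `b` crossings. This separates the two cases for the added strand.
    have h₂ : (∑ j ∈ Finset.range (b + (a + 1)), cyc s i j) * pair k s i b (a + 1) =
        (b : k) • pair k s i b (a + 1) + (a + 1 : k) • (cyc s i b * pair k s i b (a + 1)) := by
      rw [Finset.sum_range_add, add_mul, Finset.sum_mul, Finset.sum_mul,
        Finset.sum_congr rfl (g := fun _ => pair k s i b (a + 1)),
        Finset.sum_congr (s₁ := Finset.range (a + 1)) rfl
          (g := fun _ => cyc s i b * pair k s i b (a + 1))]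
      · simp [← Nat.cast_smul_eq_nsmul k]
      · intro j hj
        have hj := Finset.mem_range.1 hj
        rw [cyc_add, mul_assoc,
          cyc_mul_eq fun _ _ _ => H.gen_mul_pair (by omega) (by omega) (by omega) (by omega)]
      · intro j hj
        have hj := Finset.mem_range.1 hj
        exact cyc_mul_eq fun _ _ _ => H.gen_mul_pair (by omega) (by omega) (by omega) (by omega)
    have h₃ := succ_smul_symm k s i (a + b)
    rw [show a + b + 1 = b + (a + 1) by omega] at h₃
    have h₄ : (a + 1 : k) • (((a + 1 + b).choose (a + 1) : k) • symm k s i (a + 1 + b)) =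
        pair k s i (a + 1) b * (((a + b).choose a : k) • symm k s (i + 1) (a + b)) *
          ((b : k) • pair k s i b (a + 1) + (a + 1 : k) • (cyc s i b * pair k s i b (a + 1))) := by
      rw [← h₂, mul_smul_comm, smul_mul_assoc, ← mul_assoc, mul_assoc (pair k s i (a + 1) b), ← h₃,
        show b + (a + 1) = a + 1 + b by omega, mul_smul_comm, smul_mul_assoc, h₁, smul_smul,
        smul_smul]
      congr 1
      have := Nat.add_one_mul_choose_eq (a + b) a
      rw [show a + b + 1 = a + 1 + b by omega] at this
      have : ((a + 1 + b : ℕ) : k) * (a + b).choose a = (a + 1 + b).choose (a + 1) * (a + 1 : ℕ) := by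
        exact_mod_cast this
      push_cast at this ⊢
      linear_combination -this
    -- Both sides are multiplied by `a + 1`, so that the recursion between the binomial coefficients
    -- involves no division.
    refine smul_right_injective A (Nat.cast_add_one_ne_zero (R := k) a) ?_
    change (a + 1 : k) • _ = (a + 1 : k) • _
    rw [← sum_choose_smul k a b fun t =>
        pair k s i (a + 1) b * block s (i + t) (a + 1 - t) (b - t) * pair k s i b (a + 1),
      h₄, ih, Finset.mul_sum, Finset.sum_mul]
    refine Finset.sum_congr rfl fun t ht => ?_
    have ht := Finset.mem_range.1 ht
    rcases lt_or_ge a t with hta | hta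
    · simp [Nat.choose_eq_zero_of_lt hta]
    rw [mul_smul_comm, smul_mul_assoc, mul_add, H.pair_mul_block_mul_pair h hta (by omega),
      mul_smul_comm, H.pair_mul_cyc_mul_pair h hta (by omega), show a + 1 - t = a - t + 1 by omega,
      block_succ, add_right_comm i 1 t]
    · congr 1
      rw [add_comm]
    · exact commute_cyc fun l _ _ => (commute_block fun m _ _ =>
        H.comm' (by omega) (by omega) (by omega)).symm

end Rel

end SymRing

/-! ### Degenerate affine Hecke relations and dots passing symmetrized blocks. -/

namespace SymRing

/-- The relations between simple transpositions and dots on `N` strands. -/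
structure DotRel {A : Type*} [Ring A] (N : ℕ) (s x : ℕ → A) : Prop extends Rel N s where
  dot_comm : ∀ i j, i < N → j < N → Commute (x i) (x j)
  far : ∀ i j, i + 1 < N → j < N → j ≠ i → j ≠ i + 1 → Commute (s i) (x j)
  cross_dot : ∀ i, i + 1 < N → s i * x i = x (i + 1) * s i + 1
  dot_cross : ∀ i, i + 1 < N → x i * s i = s i * x (i + 1) + 1

/-- The product of the dots on the `n` strands starting from position `i`. -/
def dots {A : Type*} [Monoid A] (x : ℕ → A) (i : ℕ) : ℕ → A
  | 0 => 1
  | n + 1 => x i * dots x (i + 1) n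

section monoid

variable {A : Type*} [Monoid A] {x : ℕ → A}

theorem dots_zero (i : ℕ) : dots x i 0 = 1 := rfl

theorem dots_succ (i n : ℕ) : dots x i (n + 1) = x i * dots x (i + 1) n := rfl

theorem commute_dots {y : A} {i n : ℕ} (h : ∀ l, i ≤ l → l < i + n → Commute y (x l)) :
    Commute y (dots x i n) := by
  induction n generalizing i with
  | zero => exact Commute.one_right y
  | succ n ih =>
    exact (h i le_rfl (by omega)).mul_right (ih fun l _ _ => h l (by omega) (by omega))

theorem dots_add (i m n : ℕ) : dots x i (m + n) = dots x i m * dots x (i + m) n := by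
  induction m generalizing i with
  | zero => simp [dots]
  | succ m ih =>
    rw [add_right_comm, dots_succ, dots_succ, ih, mul_assoc, add_assoc, add_comm 1 m]

theorem map_dots {B F : Type*} [Monoid B] [FunLike F A B] [MonoidHomClass F A B] (f : F)
    (x' : ℕ → B) (i d n : ℕ) (h : ∀ l, i ≤ l → l < i + n → f (x l) = x' (d + l)) :
    f (dots x i n) = dots x' (d + i) n := by
  induction n generalizing i with
  | zero => simp [dots]
  | succ n ih =>
    rw [dots_succ, dots_succ, map_mul, ih (i + 1) fun l _ _ => h l (by omega) (by omega),
      h i le_rfl (by omega), add_assoc]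

end monoid

namespace DotRel

variable {A : Type*} [Ring A] {N : ℕ} {s x : ℕ → A}

/-- Reflection exchanges the two dot-crossing relations, so each sliding formula gives its mirror
image. -/
theorem op (H : DotRel N s x) :
    DotRel N (fun i => MulOpposite.op (s i)) (fun i => MulOpposite.op (x i)) where
  toRel := H.toRel.op
  dot_comm i j h₁ h₂ := (H.dot_comm i j h₁ h₂).op
  far i j h₁ h₂ h₃ h₄ := (H.far i j h₁ h₂ h₃ h₄).op
  cross_dot i hi := by
    rw [← MulOpposite.op_mul, H.dot_cross i hi, MulOpposite.op_add, MulOpposite.op_mul,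
      MulOpposite.op_one]
  dot_cross i hi := by
    rw [← MulOpposite.op_mul, H.cross_dot i hi, MulOpposite.op_add, MulOpposite.op_mul,
      MulOpposite.op_one]

theorem op_dots (H : DotRel N s x) {i n : ℕ} (h : i + n ≤ N) :
    dots (fun i => MulOpposite.op (x i)) i n = MulOpposite.op (dots x i n) := by
  induction n generalizing i with
  | zero => rfl
  | succ n ih =>
    have : Commute (x i) (dots x (i + 1) n) :=
      commute_dots fun l _ _ => H.dot_comm _ _ (by omega) (by omega)
    rw [dots_succ, dots_succ, ih (by omega), this.eq, MulOpposite.op_mul]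

/-- A crossing of two strands commutes with the product of the dots on them. -/
theorem commute_near (H : DotRel N s x) {i : ℕ} (h : i + 1 < N) :
    Commute (s i) (x i * x (i + 1)) := by
  have h₁ := H.cross_dot i h
  have h₂ := H.dot_cross i h
  have h₃ := H.dot_comm i (i + 1) (by omega) h
  calc s i * (x i * x (i + 1)) = (s i * x i) * x (i + 1) := by rw [mul_assoc]
    _ = x (i + 1) * (s i * x (i + 1) + 1) := by rw [h₁]; noncomm_ring
    _ = x (i + 1) * x i * s i := by rw [← h₂, mul_assoc]
    _ = _ := by rw [h₃.eq]

/-- The excluded values of `l` are the two ends of the dotted interval. Any other crossing involves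
either no dotted strand or two of them, and then `commute_near` applies. -/
theorem commute_dots_gen (H : DotRel N s x) {i n l : ℕ} (hl : l + 1 < N) (h : i + n ≤ N)
    (h₁ : l + 1 ≠ i) (h₂ : l + 1 ≠ i + n) : Commute (dots x i n) (s l) := by
  by_cases h₃ : i ≤ l ∧ l + 1 < i + n
  · obtain ⟨d, rfl⟩ := Nat.exists_eq_add_of_le h₃.1
    obtain ⟨r, rfl⟩ : ∃ r, n = d + (r + 2) := ⟨n - d - 2, by omega⟩
    rw [dots_add, dots_succ, dots_succ, ← mul_assoc (x (i + d))]
    refine Commute.mul_left ?_ (Commute.mul_left ?_ ?_)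
    · exact (commute_dots fun m _ _ => H.far _ _ hl (by omega) (by omega) (by omega)).symm
    · exact (H.commute_near hl).symm
    · exact (commute_dots fun m _ _ => H.far _ _ hl (by omega) (by omega) (by omega)).symm
  · exact (commute_dots fun m _ _ => H.far _ _ hl (by omega) (by omega) (by omega)).symm

/-- A single strand passes `b` strands. Each of its crossings yields an error term in which that
crossing and one dot have disappeared; absorption by `L` and `R` makes these `b` terms equal. -/
theorem mul_cyc_mul_dots_mul (H : DotRel N s x) {i b : ℕ} {L R : A} (h : i + b < N)
    (hL : ∀ l, i + 1 ≤ l → l < i + b → L * s l = L)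
    (hR : ∀ l, i ≤ l → l + 1 < i + b → s l * R = R) :
    L * (cyc s i b * dots x i b) * R =
      L * (dots x (i + 1) b * cyc s i b) * R + b • (L * dots x (i + 1) (b - 1) * R) := by
  induction b generalizing i L with
  | zero => simp [cyc, dots]
  | succ b ih =>
    have c₁ : Commute (x i) (cyc s (i + 1) b) :=
      commute_cyc fun l _ _ => (H.far _ _ (by omega) (by omega) (by omega) (by omega)).symm
    have c₂ : Commute (dots x (i + 1 + 1) b) (s i) :=
      H.commute_dots_gen (by omega) (by omega) (by omega) (by omega)
    have h₁ : L * cyc s (i + 1) b = L := mul_cyc_eq fun l _ _ => hL l (by omega) (by omega)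
    -- The first dot and the first crossing are moved into the left factor. It still absorbs the
    -- later crossings, since they commute with both.
    have ih := ih (i := i + 1) (L := L * (x (i + 1) * s i)) (by omega)
      (fun l h₁ h₂ => by
        have c := ((H.far l (i + 1) (by omega) (by omega) (by omega) (by omega)).mul_right
          (H.comm' (j := i) (by omega) (by omega) (by omega)))
        rw [mul_assoc, ← c.eq, ← mul_assoc, hL l (by omega) (by omega)])
      (fun l h₁ h₂ => hR l (by omega) (by omega))
    have h₂ : b • (L * (x (i + 1) * s i) * dots x (i + 1 + 1) (b - 1) * R) =
        b • (L * dots x (i + 1) b * R) := by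
      rcases b with _ | b
      · simp
      · have c₃ : Commute (dots x (i + 1 + 1) b) (s i) :=
          H.commute_dots_gen (by omega) (by omega) (by omega) (by omega)
        rw [Nat.add_sub_cancel, dots_succ]
        simp only [mul_assoc]
        rw [← mul_assoc (s i), ← c₃.eq, mul_assoc, hR i le_rfl (by omega)]
    calc L * (cyc s i (b + 1) * dots x i (b + 1)) * R
        = L * (s i * x i) * (cyc s (i + 1) b * dots x (i + 1) b) * R := by
          rw [cyc_succ', dots_succ, mul_assoc (s i), ← mul_assoc _ (x i), ← c₁.eq]
          simp only [mul_assoc]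
      _ = L * (x (i + 1) * s i) * (cyc s (i + 1) b * dots x (i + 1) b) * R +
          L * cyc s (i + 1) b * dots x (i + 1) b * R := by
          rw [H.cross_dot i (by omega)]
          noncomm_ring
      _ = L * x (i + 1) * (s i * dots x (i + 1 + 1) b) * cyc s (i + 1) b * R +
          (b + 1) • (L * dots x (i + 1) b * R) := by
          rw [ih, h₁, h₂, succ_nsmul, add_assoc]
          simp only [mul_assoc]
      _ = _ := by
          rw [← c₂.eq, cyc_succ', dots_succ, Nat.add_sub_cancel]
          simp only [mul_assoc]

variable {k : Type*} [Field k] [CharZero k] [Algebra k A]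

/-- The commutation of the dots on `b` symmetrized strands with their crossing with `a`
symmetrized strands. -/
theorem pair_mul_block_mul_dots (H : DotRel N s x) {i a b : ℕ} (h : i + a + b ≤ N) :
    pair k s i a b * (block s i a b * dots x i b) * pair k s i b a =
      ∑ t ∈ Finset.range (b + 1), ((t.factorial * (a.choose t * b.choose t) : ℕ) : k) •
        (pair k s i a b * (dots x (i + a) (b - t) * block s (i + t) (a - t) (b - t)) *
          pair k s i b a) := by
  induction a generalizing i b with
  | zero =>
    rw [Finset.sum_range_succ']
    simp [block_zero]
  | succ a ih =>
    have hL : ∀ l, i + 1 ≤ l → l < i + b →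
        pair k s i (a + 1) b * block s (i + 1) a b * s l =
          pair k s i (a + 1) b * block s (i + 1) a b := fun l h₁ h₂ => by
      rw [mul_assoc, H.block_mul h₁ (by omega) (by omega), ← mul_assoc,
        H.pair_mul_gen (by omega) (by omega) (by omega) h]
    have h₁ := H.mul_cyc_mul_dots_mul (i := i) (b := b) (R := pair k s i b (a + 1)) (by omega) hL
      fun l h₁ h₂ => H.gen_mul_pair (by omega) (by omega) (by omega) (by omega)
    -- Main term: all `b` dots have passed the first strand, and the induction hypothesis carries
    -- them through the other `a` strands.
    have h₂ : pair k s i (a + 1) b * block s (i + 1) a b *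
        (dots x (i + 1) b * cyc s i b) * pair k s i b (a + 1) =
        ∑ t ∈ Finset.range (b + 1), ((t.factorial * (a.choose t * b.choose t) : ℕ) : k) •
          (pair k s i (a + 1) b * (dots x (i + (a + 1)) (b - t) *
            block s (i + t) (a + 1 - t) (b - t)) * pair k s i b (a + 1)) := by
      have e₁ : pair k s (i + 1) a b * (block s (i + 1) a b * dots x (i + 1) b) *
          pair k s (i + 1) b a =
          pair k s (i + 1) a b * (block s (i + 1) a b * dots x (i + 1) b) := by
        have c : Commute (dots x (i + 1) b) (pair k s (i + 1) b a) :=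
          commute_pair k fun l _ _ _ =>
            H.commute_dots_gen (by omega) (by omega) (by omega) (by omega)
        rw [mul_assoc, mul_assoc, c.eq, ← mul_assoc, ← mul_assoc, H.pair_mul_block (by omega)]
        simp only [mul_assoc]
      have e₂ := ih (i := i + 1) (b := b) (by omega)
      rw [e₁] at e₂
      calc _ = pair k s i (a + 1) b * pair k s (i + 1) a b * block s (i + 1) a b *
          (dots x (i + 1) b * cyc s i b) * pair k s i b (a + 1) := by rw [H.pair_mul_inner h]
        _ = pair k s i (a + 1) b *
            (pair k s (i + 1) a b * (block s (i + 1) a b * dots x (i + 1) b)) *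
            (cyc s i b * pair k s i b (a + 1)) := by simp only [mul_assoc]
        _ = _ := by
          rw [e₂, Finset.mul_sum, Finset.sum_mul]
          refine Finset.sum_congr rfl fun t ht => ?_
          have ht := Finset.mem_range.1 ht
          rcases lt_or_ge a t with hta | hta
          · simp [Nat.choose_eq_zero_of_lt hta]
          rw [mul_smul_comm, smul_mul_assoc, H.pair_mul_cyc_mul_pair h hta (by omega),
            show a + 1 - t = a - t + 1 by omega, block_succ, add_right_comm i 1 t,
            add_right_comm i 1 a, ← add_assoc i a 1, mul_assoc (dots _ _ _)]
          refine commute_cyc fun l _ _ => Commute.mul_left ?_ (commute_block fun m _ _ =>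
            H.comm' (by omega) (by omega) (by omega)).symm
          exact H.commute_dots_gen (by omega) (by omega) (by omega) (by omega)
    -- Error term: one dot has been used up, so the induction hypothesis is applied with `b - 1`
    -- dots, and the index `t` of the result is shifted by one.
    have h₃ : b • (pair k s i (a + 1) b * block s (i + 1) a b * dots x (i + 1) (b - 1) *
        pair k s i b (a + 1)) =
        ∑ t ∈ Finset.range b, ((b * (t.factorial * (a.choose t * (b - 1).choose t)) : ℕ) : k) •
          (pair k s i (a + 1) b * (dots x (i + (a + 1)) (b - (t + 1)) *
            block s (i + (t + 1)) (a + 1 - (t + 1)) (b - (t + 1))) * pair k s i b (a + 1)) := by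
      rcases b with _ | b
      · simp
      rw [Nat.add_sub_cancel]
      have c : Commute (dots x (i + 1) b) (block s (i + 1 + b) a 1) :=
        commute_block fun l _ _ => H.commute_dots_gen (by omega) (by omega) (by omega) (by omega)
      have e₁ : pair k s i (a + 1) (b + 1) * pair k s (i + 1) a b = pair k s i (a + 1) (b + 1) :=
        mul_pair_eq k fun _ _ _ _ => H.pair_mul_gen (by omega) (by omega) (by omega) h
      have e₂ : pair k s (i + 1) b a * pair k s i (b + 1) (a + 1) = pair k s i (b + 1) (a + 1) :=
        pair_mul_eq k fun _ _ _ _ => H.gen_mul_pair (by omega) (by omega) (by omega) (by omega)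
      have e₃ : block s (i + 1 + b) a 1 * pair k s i (b + 1) (a + 1) =
          pair k s i (b + 1) (a + 1) :=
        block_mul_eq fun _ _ _ => H.gen_mul_pair (by omega) (by omega) (by omega) (by omega)
      -- The crossings with the strand that lost its dot commute with the other dots and are
      -- absorbed on the right, which leaves the smaller block to which the induction hypothesis
      -- applies.
      have e₄ : pair k s i (a + 1) (b + 1) * block s (i + 1) a (b + 1) * dots x (i + 1) b *
          pair k s i (b + 1) (a + 1) = pair k s i (a + 1) (b + 1) *
            (pair k s (i + 1) a b * (block s (i + 1) a b * dots x (i + 1) b) *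
              pair k s (i + 1) b a) * pair k s i (b + 1) (a + 1) := by
        calc _ = pair k s i (a + 1) (b + 1) * block s (i + 1) a b *
            (block s (i + 1 + b) a 1 * dots x (i + 1) b) * pair k s i (b + 1) (a + 1) := by
              rw [H.block_add (by omega)]
              simp only [mul_assoc]
          _ = pair k s i (a + 1) (b + 1) * pair k s (i + 1) a b * block s (i + 1) a b *
            dots x (i + 1) b * (pair k s (i + 1) b a * pair k s i (b + 1) (a + 1)) := by
              rw [← c.eq, e₁, e₂]
              simp only [mul_assoc]
              rw [e₃]
          _ = _ := by simp only [mul_assoc]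
      rw [e₄, ih (by omega), Finset.mul_sum, Finset.sum_mul, Finset.smul_sum]
      refine Finset.sum_congr rfl fun t ht => ?_
      have ht := Finset.mem_range.1 ht
      rw [mul_smul_comm, smul_mul_assoc, ← Nat.cast_smul_eq_nsmul k, smul_smul, ← Nat.cast_mul]
      congr 1
      have e₅ : pair k s i (a + 1) (b + 1) * (pair k s (i + 1) a b *
          (dots x (i + 1 + a) (b - t) * block s (i + 1 + t) (a - t) (b - t)) *
            pair k s (i + 1) b a) * pair k s i (b + 1) (a + 1) =
          pair k s i (a + 1) (b + 1) * pair k s (i + 1) a b *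
          (dots x (i + 1 + a) (b - t) * block s (i + 1 + t) (a - t) (b - t)) *
            (pair k s (i + 1) b a * pair k s i (b + 1) (a + 1)) := by
        simp only [mul_assoc]
      rw [e₅, e₁, e₂, Nat.add_sub_add_right, Nat.add_sub_add_right, add_right_comm i 1 a,
        add_right_comm i 1 t, ← add_assoc, ← add_assoc]
    have h₄ : pair k s i (a + 1) b * (block s i (a + 1) b * dots x i b) * pair k s i b (a + 1) =
        pair k s i (a + 1) b * block s (i + 1) a b * (cyc s i b * dots x i b) *
          pair k s i b (a + 1) := by
      rw [block_succ]
      simp only [mul_assoc]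
    rw [h₄, h₁, h₂, h₃, Finset.sum_range_succ', Finset.sum_range_succ' _ b, add_right_comm,
      ← Finset.sum_add_distrib]
    refine congrArg₂ _ (Finset.sum_congr rfl fun t ht => ?_)
      (by rw [Nat.choose_zero_right a, Nat.choose_zero_right (a + 1)])
    have ht := Finset.mem_range.1 ht
    rw [← add_smul, ← Nat.cast_add]
    congr 2
    -- The coefficients from the main term and the error term combine by Pascal's rule for `a` and
    -- the absorption identity `(b + 1) * choose b t = choose (b + 1) (t + 1) * (t + 1)`.
    obtain ⟨b, rfl⟩ : ∃ c, b = c + 1 := ⟨b - 1, by omega⟩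
    have e₁ := Nat.add_one_mul_choose_eq b t
    have e₃ := Nat.choose_succ_succ a t
    simp only [Nat.succ_eq_add_one] at e₃
    rw [e₃, Nat.add_sub_cancel, Nat.factorial_succ]
    linear_combination t.factorial * a.choose t * e₁

/-- The relation of `pair_mul_block_mul_dots` read in the opposite direction. -/
theorem dots_mul_block_mul_pair (H : DotRel N s x) {i a b : ℕ} (h : i + a + b ≤ N) :
    pair k s i b a * (dots x i b * block s i b a) * pair k s i a b =
      ∑ t ∈ Finset.range (b + 1), ((t.factorial * (a.choose t * b.choose t) : ℕ) : k) •
        (pair k s i b a * (block s (i + t) (b - t) (a - t) * dots x (i + a) (b - t)) *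
          pair k s i a b) := by
  apply MulOpposite.op_injective
  have := H.op.pair_mul_block_mul_dots (k := k) h
  rw [Finset.op_sum]
  rw [H.op_block h, H.op_dots (by omega), H.toRel.op_pair h, H.toRel.op_pair (by omega)] at this
  simp only [MulOpposite.op_mul, MulOpposite.op_smul, mul_assoc] at this ⊢
  rw [this]
  refine Finset.sum_congr rfl fun t ht => ?_
  have ht := Finset.mem_range.1 ht
  rcases lt_or_ge a t with hta | hta
  · simp [Nat.choose_eq_zero_of_lt hta]
  rw [H.op_block (by omega), H.op_dots (by omega)]

end DotRel

end SymRing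

/-! ## Morphisms of a presented category up to equality of words -/

namespace StrictPresentation

namespace PresCat

variable {k : Type u} [CommRing k] {Γ : Type} {G : List Γ → List Γ → Type}
variable {R : ∀ a b : List Γ, Expr k G a b → Expr k G a b → Prop}

/-- Equality of morphisms between words that are not syntactically equal. -/
inductive Same : ∀ {a b c d : List Γ}, ((⟨a⟩ : PresCat R) ⟶ ⟨b⟩) → ((⟨c⟩ : PresCat R) ⟶ ⟨d⟩) → Prop
  | refl {a b : List Γ} (f : (⟨a⟩ : PresCat R) ⟶ ⟨b⟩) : Same f f

/-- The tensor product of morphisms. -/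
def tens {a b c d : List Γ} (f : (⟨a⟩ : PresCat R) ⟶ ⟨b⟩) (g : (⟨c⟩ : PresCat R) ⟶ ⟨d⟩) :
    (⟨a ++ c⟩ : PresCat R) ⟶ ⟨b ++ d⟩ := tensorMap f g

/-- The same morphism, with its source and target rewritten along equalities of words. -/
def castHom {a b c d : List Γ} (h : a = c) (h' : b = d) (f : (⟨a⟩ : PresCat R) ⟶ ⟨b⟩) :
    (⟨c⟩ : PresCat R) ⟶ ⟨d⟩ := h ▸ h' ▸ f

section

variable {a b c d a' b' c' d' : List Γ}

theorem Same.of_eq {f g : (⟨a⟩ : PresCat R) ⟶ ⟨b⟩} (h : f = g) : Same f g := h ▸ .refl f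

theorem Same.eq {f g : (⟨a⟩ : PresCat R) ⟶ ⟨b⟩} (h : Same f g) : f = g := by
  cases h
  rfl

theorem Same.symm {f : (⟨a⟩ : PresCat R) ⟶ ⟨b⟩} {g : (⟨c⟩ : PresCat R) ⟶ ⟨d⟩} (h : Same f g) :
    Same g f := by
  cases h
  exact .refl _

theorem Same.trans {e e' : List Γ} {f : (⟨a⟩ : PresCat R) ⟶ ⟨b⟩} {g : (⟨c⟩ : PresCat R) ⟶ ⟨d⟩}
    {h : (⟨e⟩ : PresCat R) ⟶ ⟨e'⟩} (h₁ : Same f g) (h₂ : Same g h) : Same f h := by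
  cases h₁
  exact h₂

theorem Same.comp {f : (⟨a⟩ : PresCat R) ⟶ ⟨b⟩} {g : (⟨b⟩ : PresCat R) ⟶ ⟨c⟩}
    {f' : (⟨a'⟩ : PresCat R) ⟶ ⟨b'⟩} {g' : (⟨b'⟩ : PresCat R) ⟶ ⟨c'⟩} (hf : Same f f')
    (hg : Same g g') : Same (f ≫ g) (f' ≫ g') := by
  cases hf
  cases hg
  exact .refl _

theorem Same.tens {f : (⟨a⟩ : PresCat R) ⟶ ⟨b⟩} {g : (⟨c⟩ : PresCat R) ⟶ ⟨d⟩}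
    {f' : (⟨a'⟩ : PresCat R) ⟶ ⟨b'⟩} {g' : (⟨c'⟩ : PresCat R) ⟶ ⟨d'⟩} (hf : Same f f')
    (hg : Same g g') : Same (tens f g) (PresCat.tens f' g') := by
  cases hf
  cases hg
  exact .refl _

theorem Same.smul (r : k) {f : (⟨a⟩ : PresCat R) ⟶ ⟨b⟩} {g : (⟨c⟩ : PresCat R) ⟶ ⟨d⟩}
    (h : Same f g) : Same (r • f) (r • g) := by
  cases h
  exact .refl _

theorem Same.id (h : a = b) : Same (𝟙 (⟨a⟩ : PresCat R)) (𝟙 (⟨b⟩ : PresCat R)) := by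
  subst h
  exact .refl _

theorem Same.id_comp {f : (⟨a⟩ : PresCat R) ⟶ ⟨b⟩} {g : (⟨b⟩ : PresCat R) ⟶ ⟨c⟩}
    (h : Same f (𝟙 (⟨d⟩ : PresCat R))) : Same (f ≫ g) g := by
  have h := h.symm
  cases h
  exact .of_eq (Category.id_comp g)

theorem Same.comp_id {f : (⟨a⟩ : PresCat R) ⟶ ⟨b⟩} {g : (⟨b⟩ : PresCat R) ⟶ ⟨c⟩}
    (h : Same g (𝟙 (⟨d⟩ : PresCat R))) : Same (f ≫ g) f := by
  have h := h.symm
  cases h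
  exact .of_eq (Category.comp_id f)

theorem castHom_same (h : a = c) (h' : b = d) (f : (⟨a⟩ : PresCat R) ⟶ ⟨b⟩) :
    Same (castHom h h' f) f := by
  subst h h'
  exact .refl _

theorem castHom_add (h : a = c) (h' : b = d) (f g : (⟨a⟩ : PresCat R) ⟶ ⟨b⟩) :
    castHom h h' (f + g) = castHom h h' f + castHom h h' g := by
  subst h h'
  rfl

theorem castHom_smul (h : a = c) (h' : b = d) (r : k) (f : (⟨a⟩ : PresCat R) ⟶ ⟨b⟩) :
    castHom h h' (r • f) = r • castHom h h' f := by
  subst h h'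
  rfl

theorem homMk_cast_same (h : a = c) (h' : b = d) (f : Expr k G a b) :
    Same (homMk R (f.cast h h')) (homMk R f) := by
  subst h h'
  exact .refl _

theorem tens_comp (f : (⟨a⟩ : PresCat R) ⟶ ⟨b⟩) (g : (⟨b⟩ : PresCat R) ⟶ ⟨c⟩)
    (f' : (⟨a'⟩ : PresCat R) ⟶ ⟨b'⟩) (g' : (⟨b'⟩ : PresCat R) ⟶ ⟨c'⟩) :
    tens f f' ≫ tens g g' = tens (f ≫ g) (f' ≫ g') := (tensorMap_comp f g f' g').symm

theorem tens_id (a b : List Γ) :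
    tens (𝟙 (⟨a⟩ : PresCat R)) (𝟙 (⟨b⟩ : PresCat R)) = 𝟙 (⟨a ++ b⟩ : PresCat R) :=
  tensorMap_id (⟨a⟩ : PresCat R) ⟨b⟩

theorem tens_assoc (f : (⟨a⟩ : PresCat R) ⟶ ⟨a'⟩) (g : (⟨b⟩ : PresCat R) ⟶ ⟨b'⟩)
    (h : (⟨c⟩ : PresCat R) ⟶ ⟨c'⟩) : Same (tens (tens f g) h) (tens f (tens g h)) := by
  obtain ⟨f, rfl⟩ := homMk_surj f
  obtain ⟨g, rfl⟩ := homMk_surj g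
  obtain ⟨h, rfl⟩ := homMk_surj h
  exact (homMk_cast_same _ _ _).symm.trans (Same.of_eq (homMk_eq (Cong.tensor_assoc f g h)))

theorem id_tens (f : (⟨a⟩ : PresCat R) ⟶ ⟨b⟩) : Same (tens (𝟙 (⟨[]⟩ : PresCat R)) f) f := by
  obtain ⟨f, rfl⟩ := homMk_surj f
  exact (homMk_cast_same _ _ _).symm.trans (Same.of_eq (homMk_eq (Cong.unit_tensor f)))

theorem tens_one (f : (⟨a⟩ : PresCat R) ⟶ ⟨b⟩) : Same (tens f (𝟙 (⟨[]⟩ : PresCat R))) f := by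
  obtain ⟨f, rfl⟩ := homMk_surj f
  exact (homMk_cast_same _ _ _).symm.trans (Same.of_eq (homMk_eq (Cong.tensor_unit f)))

theorem add_tens (f f' : (⟨a⟩ : PresCat R) ⟶ ⟨b⟩) (g : (⟨c⟩ : PresCat R) ⟶ ⟨d⟩) :
    tens (f + f') g = tens f g + tens f' g := by
  obtain ⟨f, rfl⟩ := homMk_surj f
  obtain ⟨f', rfl⟩ := homMk_surj f'
  obtain ⟨g, rfl⟩ := homMk_surj g
  exact homMk_eq (Cong.add_tensor f f' g)

theorem tens_add (f : (⟨a⟩ : PresCat R) ⟶ ⟨b⟩) (g g' : (⟨c⟩ : PresCat R) ⟶ ⟨d⟩) :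
    tens f (g + g') = tens f g + tens f g' := by
  obtain ⟨f, rfl⟩ := homMk_surj f
  obtain ⟨g, rfl⟩ := homMk_surj g
  obtain ⟨g', rfl⟩ := homMk_surj g'
  exact homMk_eq (Cong.tensor_add f g g')

theorem smul_tens (r : k) (f : (⟨a⟩ : PresCat R) ⟶ ⟨b⟩) (g : (⟨c⟩ : PresCat R) ⟶ ⟨d⟩) :
    tens (r • f) g = r • tens f g := by
  obtain ⟨f, rfl⟩ := homMk_surj f
  obtain ⟨g, rfl⟩ := homMk_surj g
  exact homMk_eq (Cong.smul_tensor r f g)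

theorem tens_smul (r : k) (f : (⟨a⟩ : PresCat R) ⟶ ⟨b⟩) (g : (⟨c⟩ : PresCat R) ⟶ ⟨d⟩) :
    tens f (r • g) = r • tens f g := by
  obtain ⟨f, rfl⟩ := homMk_surj f
  obtain ⟨g, rfl⟩ := homMk_surj g
  exact homMk_eq (Cong.tensor_smul r f g)

end

section

variable {a b c d : List Γ}

theorem tens_id_comp_id_tens (f : (⟨a⟩ : PresCat R) ⟶ ⟨b⟩) (g : (⟨c⟩ : PresCat R) ⟶ ⟨d⟩) :
    tens f (𝟙 _) ≫ tens (𝟙 _) g = tens f g := by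
  rw [tens_comp, Category.id_comp, Category.comp_id]

theorem id_tens_comp_tens_id (f : (⟨a⟩ : PresCat R) ⟶ ⟨b⟩) (g : (⟨c⟩ : PresCat R) ⟶ ⟨d⟩) :
    tens (𝟙 _) g ≫ tens f (𝟙 _) = tens f g := by
  rw [tens_comp, Category.id_comp, Category.comp_id]

end

variable (R) in
/-- The endomorphism algebra of a word, with the multiplication "first `f`, then `g`". -/
def DiagEnd (a : List Γ) : Type u := (⟨a⟩ : PresCat R) ⟶ ⟨a⟩

instance (a : List Γ) : AddCommGroup (DiagEnd R a) :=
  inferInstanceAs (AddCommGroup ((⟨a⟩ : PresCat R) ⟶ ⟨a⟩))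

instance (a : List Γ) : Ring (DiagEnd R a) where
  __ := (inferInstance : AddCommGroup (DiagEnd R a))
  mul f g := CategoryStruct.comp (X := (⟨a⟩ : PresCat R)) f g
  one := 𝟙 (⟨a⟩ : PresCat R)
  mul_assoc f g h := Category.assoc (X := (⟨a⟩ : PresCat R)) f g h
  one_mul f := Category.id_comp (X := (⟨a⟩ : PresCat R)) f
  mul_one f := Category.comp_id (X := (⟨a⟩ : PresCat R)) f
  left_distrib f g h := Preadditive.comp_add (⟨a⟩ : PresCat R) ⟨a⟩ ⟨a⟩ f g h
  right_distrib f g h := Preadditive.add_comp (⟨a⟩ : PresCat R) ⟨a⟩ ⟨a⟩ f g h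
  zero_mul f := Limits.zero_comp (X := (⟨a⟩ : PresCat R)) (f := f)
  mul_zero f := Limits.comp_zero (X := (⟨a⟩ : PresCat R)) (f := f)

instance (a : List Γ) : Module k (DiagEnd R a) :=
  inferInstanceAs (Module k ((⟨a⟩ : PresCat R) ⟶ ⟨a⟩))

instance (a : List Γ) : Algebra k (DiagEnd R a) :=
  Algebra.ofModule (fun r f g => Linear.smul_comp (⟨a⟩ : PresCat R) ⟨a⟩ ⟨a⟩ r f g)
    (fun r f g => Linear.comp_smul (⟨a⟩ : PresCat R) ⟨a⟩ ⟨a⟩ f r g)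

end PresCat

end StrictPresentation

/-! ## Thick strands as summands of bundles of thin strands -/

namespace AffineWeb

open StrictPresentation StrictPresentation.PresCat

section degenerate

variable {k : Type u} [CommRing k] {D : Set ℕ+}
  {R : ∀ X Y : List ℕ+, Expr k (Gen D) X Y → Expr k (Gen D) X Y → Prop}

theorem homMk_merge_zero_left (b : ℕ) :
    Same (homMk R (merge k D 0 b)) (𝟙 (⟨strand b⟩ : PresCat R)) :=
  homMk_cast_same rfl (by rw [Nat.zero_add]) (Expr.id (strand b))

theorem homMk_merge_zero_right (a : ℕ) :
    Same (homMk R (merge k D a 0)) (𝟙 (⟨strand a⟩ : PresCat R)) := by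
  cases a
  · exact homMk_merge_zero_left 0
  · exact .refl _

theorem homMk_split_zero_left (b : ℕ) :
    Same (homMk R (split k D 0 b)) (𝟙 (⟨strand b⟩ : PresCat R)) :=
  homMk_cast_same (by rw [Nat.zero_add]) rfl (Expr.id (strand b))

theorem homMk_split_zero_right (a : ℕ) :
    Same (homMk R (split k D a 0)) (𝟙 (⟨strand a⟩ : PresCat R)) := by
  cases a
  · exact homMk_split_zero_left 0
  · exact .refl _

end degenerate

section web

variable (k : Type u) [Field k]

/-- The merge in the reduced affine web category. -/
def mergeHom (a b : ℕ) : (⟨strand a ++ strand b⟩ : ReducedAW k) ⟶ ⟨strand (a + b)⟩ :=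
  homMk _ (merge k _ a b)

/-- The split in the reduced affine web category. -/
def splitHom (a b : ℕ) : (⟨strand (a + b)⟩ : ReducedAW k) ⟶ ⟨strand a ++ strand b⟩ :=
  homMk _ (split k _ a b)

/-- The crossing in the reduced affine web category. -/
def crossHom (a b : ℕ) : (⟨strand a ++ strand b⟩ : ReducedAW k) ⟶ ⟨strand b ++ strand a⟩ :=
  homMk _ (cross k _ a b)

/-- The word of `n` thin strands. -/
abbrev thin (n : ℕ) : List ℕ+ := List.replicate n 1

/-- The full merge in the reduced affine web category. -/
def fullMergeHom (n : ℕ) : (⟨thin n⟩ : ReducedAW k) ⟶ ⟨strand n⟩ := homMk _ (fullMerge k _ n)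

/-- The full split in the reduced affine web category. -/
def fullSplitHom (n : ℕ) : (⟨strand n⟩ : ReducedAW k) ⟶ ⟨thin n⟩ := homMk _ (fullSplit k _ n)

theorem web_eq {X Y : List ℕ+} {f g : Expr k (Gen {1}) X Y} (h : WebRel k {1} X Y f g) :
    homMk (ReducedRel k) f = homMk _ g := homMk_eq (Cong.rel (.web h))

theorem mergeHom_zero_left (b : ℕ) : Same (mergeHom k 0 b) (𝟙 (⟨strand b⟩ : ReducedAW k)) :=
  homMk_merge_zero_left b

theorem mergeHom_zero_right (a : ℕ) : Same (mergeHom k a 0) (𝟙 (⟨strand a⟩ : ReducedAW k)) :=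
  homMk_merge_zero_right a

theorem splitHom_zero_left (b : ℕ) : Same (splitHom k 0 b) (𝟙 (⟨strand b⟩ : ReducedAW k)) :=
  homMk_split_zero_left b

theorem splitHom_zero_right (a : ℕ) : Same (splitHom k a 0) (𝟙 (⟨strand a⟩ : ReducedAW k)) :=
  homMk_split_zero_right a

theorem mergeHom_congr {a b a' b' : ℕ} (ha : a = a') (hb : b = b') :
    Same (mergeHom k a b) (mergeHom k a' b') := by
  subst ha hb
  exact .refl _

theorem splitHom_congr {a b a' b' : ℕ} (ha : a = a') (hb : b = b') :
    Same (splitHom k a b) (splitHom k a' b') := by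
  subst ha hb
  exact .refl _

/-- The defining relation covers positive thicknesses only. If a thickness is zero, the merges with
it are identities up to equality of words, which is why the statement uses `Same`. -/
theorem mergeHom_assoc (a b c : ℕ) :
    Same (tens (mergeHom k a b) (𝟙 (⟨strand c⟩ : ReducedAW k)) ≫ mergeHom k (a + b) c)
      (tens (𝟙 (⟨strand a⟩ : ReducedAW k)) (mergeHom k b c) ≫ mergeHom k a (b + c)) := by
  rcases Nat.eq_zero_or_pos a with rfl | ha
  · refine (Same.id_comp (((mergeHom_zero_left k b).tens (.refl _)).trans
      (.of_eq (tens_id _ _)))).trans ?_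
    refine (mergeHom_congr k (zero_add b) rfl).trans ?_
    exact ((Same.comp_id (mergeHom_zero_left k _)).trans (id_tens _)).symm
  rcases Nat.eq_zero_or_pos b with rfl | hb
  · refine (Same.id_comp (((mergeHom_zero_right k a).tens (.refl _)).trans
      (.of_eq (tens_id _ _)))).trans ?_
    refine (mergeHom_congr k rfl (zero_add c).symm).trans (Same.symm ?_)
    exact Same.id_comp (((Same.refl _).tens (mergeHom_zero_left k c)).trans
      (.of_eq (tens_id _ _)))
  rcases Nat.eq_zero_or_pos c with rfl | hc
  · refine ((Same.comp_id (mergeHom_zero_right k _)).trans (tens_one _)).trans (Same.symm ?_)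
    exact Same.id_comp (((Same.refl _).tens (mergeHom_zero_right k b)).trans
      (.of_eq (tens_id _ _)))
  exact (Same.of_eq (web_eq k (.merge_assoc a b c ha hb hc))).trans (homMk_cast_same _ _ _)

theorem splitHom_assoc (a b c : ℕ) :
    Same (splitHom k (a + b) c ≫ tens (splitHom k a b) (𝟙 (⟨strand c⟩ : ReducedAW k)))
      (splitHom k a (b + c) ≫ tens (𝟙 (⟨strand a⟩ : ReducedAW k)) (splitHom k b c)) := by
  rcases Nat.eq_zero_or_pos a with rfl | ha
  · refine (Same.comp_id (((splitHom_zero_left k b).tens (.refl _)).trans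
      (.of_eq (tens_id _ _)))).trans ?_
    refine (splitHom_congr k (zero_add b) rfl).trans ?_
    exact ((Same.id_comp (splitHom_zero_left k _)).trans (id_tens _)).symm
  rcases Nat.eq_zero_or_pos b with rfl | hb
  · refine (Same.comp_id (((splitHom_zero_right k a).tens (.refl _)).trans
      (.of_eq (tens_id _ _)))).trans ?_
    refine (splitHom_congr k rfl (zero_add c).symm).trans (Same.symm ?_)
    exact Same.comp_id (((Same.refl _).tens (splitHom_zero_left k c)).trans
      (.of_eq (tens_id _ _)))
  rcases Nat.eq_zero_or_pos c with rfl | hc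
  · refine ((Same.id_comp (splitHom_zero_right k _)).trans (tens_one _)).trans (Same.symm ?_)
    exact Same.comp_id (((Same.refl _).tens (splitHom_zero_right k b)).trans
      (.of_eq (tens_id _ _)))
  exact (Same.of_eq (web_eq k (.split_assoc a b c ha hb hc))).trans (homMk_cast_same _ _ _)

theorem splitHom_comp_mergeHom (a b : ℕ) :
    splitHom k a b ≫ mergeHom k a b = ((a + b).choose a : k) • 𝟙 _ := by
  rcases Nat.eq_zero_or_pos a with rfl | ha
  · rw [Nat.choose_zero_right, Nat.cast_one, one_smul]
    exact (((splitHom_zero_left k b).comp (mergeHom_zero_left k b)).trans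
      ((Same.of_eq (Category.id_comp _)).trans (.id (by rw [zero_add])))).eq
  rcases Nat.eq_zero_or_pos b with rfl | hb
  · rw [show (a + 0).choose a = 1 from Nat.choose_self a, Nat.cast_one, one_smul]
    exact (((splitHom_zero_right k a).comp (mergeHom_zero_right k a)).trans
      (Same.of_eq (Category.id_comp _))).eq
  exact web_eq k (.digon a b ha hb)

theorem fullMergeHom_succ (n : ℕ) : Same (fullMergeHom k (n + 1))
    (tens (𝟙 (⟨strand 1⟩ : ReducedAW k)) (fullMergeHom k n) ≫ mergeHom k 1 n) :=
  Same.comp (.refl (homMk _ ((Expr.id [1]).tensor (fullMerge k _ n)))) (homMk_cast_same _ _ _)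

theorem fullSplitHom_succ (n : ℕ) : Same (fullSplitHom k (n + 1))
    (splitHom k 1 n ≫ tens (𝟙 (⟨strand 1⟩ : ReducedAW k)) (fullSplitHom k n)) :=
  Same.comp (homMk_cast_same _ _ _) (.refl (homMk _ ((Expr.id [1]).tensor (fullSplit k _ n))))

theorem fullMergeHom_congr {a b : ℕ} (h : a = b) : Same (fullMergeHom k a) (fullMergeHom k b) := by
  subst h
  exact .refl _

theorem fullSplitHom_congr {a b : ℕ} (h : a = b) : Same (fullSplitHom k a) (fullSplitHom k b) := by
  subst h
  exact .refl _

theorem fullMergeHom_add (a b : ℕ) :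
    Same (tens (fullMergeHom k a) (fullMergeHom k b) ≫ mergeHom k a b)
      (fullMergeHom k (a + b)) := by
  induction a with
  | zero =>
    refine (Same.comp_id (mergeHom_zero_left k b)).trans ?_
    exact (id_tens _).trans (fullMergeHom_congr k (zero_add b).symm)
  | succ a ih =>
    have h₁ : Same (tens (fullMergeHom k (a + 1)) (fullMergeHom k b))
        (tens (tens (𝟙 (⟨strand 1⟩ : ReducedAW k)) (fullMergeHom k a)) (fullMergeHom k b) ≫
          tens (mergeHom k 1 a) (𝟙 (⟨strand b⟩ : ReducedAW k))) := by
      rw [tens_comp, Category.comp_id]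
      exact (fullMergeHom_succ k a).tens (.refl _)
    refine (h₁.comp (mergeHom_congr k (add_comm a 1) rfl)).trans ?_
    rw [Category.assoc]
    refine ((tens_assoc _ _ _).comp (mergeHom_assoc k 1 a b)).trans ?_
    rw [← Category.assoc, tens_comp, Category.comp_id]
    refine (((Same.refl _).tens ih).comp (.refl _)).trans ?_
    exact (fullMergeHom_succ k (a + b)).symm.trans (fullMergeHom_congr k (by omega))

theorem fullSplitHom_add (a b : ℕ) :
    Same (splitHom k a b ≫ tens (fullSplitHom k a) (fullSplitHom k b))
      (fullSplitHom k (a + b)) := by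
  induction a with
  | zero =>
    refine (Same.id_comp (splitHom_zero_left k b)).trans ?_
    exact (id_tens _).trans (fullSplitHom_congr k (zero_add b).symm)
  | succ a ih =>
    have h₁ : Same (tens (fullSplitHom k (a + 1)) (fullSplitHom k b))
        (tens (splitHom k 1 a) (𝟙 (⟨strand b⟩ : ReducedAW k)) ≫
          tens (tens (𝟙 (⟨strand 1⟩ : ReducedAW k)) (fullSplitHom k a)) (fullSplitHom k b)) := by
      rw [tens_comp, Category.id_comp]
      exact (fullSplitHom_succ k a).tens (.refl _)
    refine ((splitHom_congr k (add_comm a 1) rfl).comp h₁).trans ?_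
    rw [← Category.assoc]
    refine ((splitHom_assoc k 1 a b).comp (tens_assoc _ _ _)).trans ?_
    rw [Category.assoc, tens_comp, Category.id_comp]
    refine ((Same.refl _).comp ((Same.refl _).tens ih)).trans ?_
    exact (fullSplitHom_succ k (a + b)).symm.trans (fullSplitHom_congr k (by omega))

/-- Removing the digons from the inside outwards multiplies the binomials `choose (n + 1) 1`, hence
the factorial. -/
theorem fullSplitHom_comp_fullMergeHom (n : ℕ) :
    fullSplitHom k n ≫ fullMergeHom k n = (n.factorial : k) • 𝟙 _ := by
  induction n with
  | zero =>
    rw [Nat.factorial_zero, Nat.cast_one, one_smul]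
    exact Category.id_comp _
  | succ n ih =>
    refine (((fullSplitHom_succ k n).comp (fullMergeHom_succ k n)).trans (Same.trans (.of_eq ?_)
      ((Same.id (congrArg strand (add_comm 1 n))).smul ((n + 1).factorial : k)))).eq
    rw [Category.assoc, ← Category.assoc (tens _ _), tens_comp, Category.id_comp, ih, tens_smul,
      tens_id, Linear.smul_comp, Linear.comp_smul, Category.id_comp, splitHom_comp_mergeHom,
      smul_smul, Nat.choose_one_right, Nat.factorial_succ, Nat.cast_mul, add_comm 1 n, mul_comm]

/-- The sum of the thicknesses of the strands in a word. -/
def weight : List ℕ+ → ℕ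
  | [] => 0
  | a :: u => a + weight u

theorem weight_append (u v : List ℕ+) : weight (u ++ v) = weight u + weight v := by
  induction u with
  | nil => exact (zero_add _).symm
  | cons a u ih => rw [List.cons_append, weight, weight, ih, add_assoc]

theorem weight_strand (n : ℕ) : weight (strand n) = n := by
  cases n <;> rfl

theorem weight_thin (n : ℕ) : weight (thin n) = n := by
  induction n with
  | zero => rfl
  | succ n ih => rw [thin, List.replicate_succ, weight, ih, PNat.one_coe, add_comm]

/-- The product of the factorials of the thicknesses of the strands in a word. -/
def wordFactorial : List ℕ+ → ℕ
  | [] => 1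
  | a :: u => (a : ℕ).factorial * wordFactorial u

theorem wordFactorial_append (u v : List ℕ+) :
    wordFactorial (u ++ v) = wordFactorial u * wordFactorial v := by
  induction u with
  | nil => exact (one_mul _).symm
  | cons a u ih => rw [List.cons_append, wordFactorial, wordFactorial, ih, mul_assoc]

theorem wordFactorial_strand (n : ℕ) : wordFactorial (strand n) = n.factorial := by
  cases n
  · rfl
  · exact mul_one _

theorem wordFactorial_thin (n : ℕ) : wordFactorial (thin n) = 1 := by
  induction n with
  | zero => rfl
  | succ n ih => rw [thin, List.replicate_succ, wordFactorial, ih, PNat.one_coe, Nat.factorial_one]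

theorem wordFactorial_ne_zero [CharZero k] (u : List ℕ+) : (wordFactorial u : k) ≠ 0 := by
  rw [Nat.cast_ne_zero]
  induction u with
  | nil => exact one_ne_zero
  | cons a u ih => exact mul_ne_zero (Nat.factorial_ne_zero _) ih

theorem thin_add (a b : ℕ) : thin a ++ thin b = thin (a + b) :=
  List.replicate_append_replicate

theorem strand_append (a : ℕ+) (u : List ℕ+) : strand a ++ u = a :: u := by
  rw [strand_coe]
  rfl

/-- The merge of a bundle of thin strands into a given word. -/
def wordMerge : ∀ u : List ℕ+, (⟨thin (weight u)⟩ : ReducedAW k) ⟶ ⟨u⟩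
  | [] => 𝟙 _
  | a :: u => castHom (thin_add a (weight u)) (strand_append a u)
      (tens (fullMergeHom k a) (wordMerge u))

/-- The split of a given word into a bundle of thin strands. -/
def wordSplit : ∀ u : List ℕ+, (⟨u⟩ : ReducedAW k) ⟶ ⟨thin (weight u)⟩
  | [] => 𝟙 _
  | a :: u => castHom (strand_append a u) (thin_add a (weight u))
      (tens (fullSplitHom k a) (wordSplit u))

theorem wordMerge_cons (a : ℕ+) (u : List ℕ+) :
    Same (wordMerge k (a :: u)) (tens (fullMergeHom k a) (wordMerge k u)) :=
  castHom_same _ _ _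

theorem wordSplit_cons (a : ℕ+) (u : List ℕ+) :
    Same (wordSplit k (a :: u)) (tens (fullSplitHom k a) (wordSplit k u)) :=
  castHom_same _ _ _

theorem wordMerge_append (u v : List ℕ+) :
    Same (wordMerge k (u ++ v)) (tens (wordMerge k u) (wordMerge k v)) := by
  induction u with
  | nil => exact (id_tens _).symm
  | cons a u ih =>
    refine (wordMerge_cons k a (u ++ v)).trans (((Same.refl _).tens ih).trans ?_)
    exact (tens_assoc _ _ _).symm.trans ((wordMerge_cons k a u).symm.tens (.refl _))

theorem wordSplit_append (u v : List ℕ+) :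
    Same (wordSplit k (u ++ v)) (tens (wordSplit k u) (wordSplit k v)) := by
  induction u with
  | nil => exact (id_tens _).symm
  | cons a u ih =>
    refine (wordSplit_cons k a (u ++ v)).trans (((Same.refl _).tens ih).trans ?_)
    exact (tens_assoc _ _ _).symm.trans ((wordSplit_cons k a u).symm.tens (.refl _))

theorem wordMerge_strand (n : ℕ) : Same (wordMerge k (strand n)) (fullMergeHom k n) := by
  cases n
  · exact .refl _
  · exact (wordMerge_cons k _ []).trans (tens_one _)

theorem wordSplit_strand (n : ℕ) : Same (wordSplit k (strand n)) (fullSplitHom k n) := by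
  cases n
  · exact .refl _
  · exact (wordSplit_cons k _ []).trans (tens_one _)

theorem fullMergeHom_one : Same (fullMergeHom k 1) (𝟙 (⟨thin 1⟩ : ReducedAW k)) :=
  (fullMergeHom_succ k 0).trans ((Same.comp_id (mergeHom_zero_right k 1)).trans
    (.of_eq (tens_id [1] [])))

theorem fullSplitHom_one : Same (fullSplitHom k 1) (𝟙 (⟨thin 1⟩ : ReducedAW k)) :=
  (fullSplitHom_succ k 0).trans ((Same.id_comp (splitHom_zero_right k 1)).trans
    (.of_eq (tens_id [1] [])))

theorem wordMerge_thin (n : ℕ) : Same (wordMerge k (thin n)) (𝟙 (⟨thin n⟩ : ReducedAW k)) := by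
  induction n with
  | zero => exact .refl _
  | succ n ih =>
    exact (wordMerge_cons k 1 _).trans (((fullMergeHom_one k).tens ih).trans
      (.of_eq (tens_id [1] (thin n))))

theorem wordSplit_thin (n : ℕ) : Same (wordSplit k (thin n)) (𝟙 (⟨thin n⟩ : ReducedAW k)) := by
  induction n with
  | zero => exact .refl _
  | succ n ih =>
    exact (wordSplit_cons k 1 _).trans (((fullSplitHom_one k).tens ih).trans
      (.of_eq (tens_id [1] (thin n))))

/-- In characteristic zero this scalar is invertible, so `u` is a direct summand of a bundle of thin
strands. -/
theorem wordSplit_comp_wordMerge (u : List ℕ+) :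
    wordSplit k u ≫ wordMerge k u = (wordFactorial u : k) • 𝟙 _ := by
  induction u with
  | nil =>
    rw [wordFactorial, Nat.cast_one, one_smul]
    exact Category.id_comp _
  | cons a u ih =>
    refine (((wordSplit_cons k a u).comp (wordMerge_cons k a u)).trans (Same.trans (.of_eq ?_)
      ((Same.id (strand_append a u)).smul (wordFactorial (a :: u) : k)))).eq
    rw [tens_comp, fullSplitHom_comp_fullMergeHom, ih, smul_tens, tens_smul, tens_id, smul_smul,
      wordFactorial, Nat.cast_mul]

end web

end AffineWeb

/-! ### Endomorphism algebras of bundles of thin strands. -/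

namespace AffineWeb

open StrictPresentation StrictPresentation.PresCat

section embedding

variable {k : Type u} [Field k]

/-- The endomorphism algebra of a bundle of thin strands. -/
abbrev ThinEnd (k : Type u) [Field k] (n : ℕ) : Type u := DiagEnd (ReducedRel k) (thin n)

theorem thin_add_three {i m N : ℕ} (h : i + m ≤ N) :
    thin i ++ (thin m ++ thin (N - i - m)) = thin N := by
  rw [thin_add, thin_add]
  congr 1
  omega

/-- The endomorphism of `N` thin strands which is a given one on the `m` strands from position
`i` onwards. -/
def emb (i : ℕ) {m N : ℕ} (h : i + m ≤ N) : ThinEnd k m →ₐ[k] ThinEnd k N :=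
  AlgHom.ofLinearMap
    { toFun := fun f => castHom (thin_add_three h) (thin_add_three h)
        (tens (𝟙 (⟨thin i⟩ : ReducedAW k)) (tens f (𝟙 (⟨thin (N - i - m)⟩ : ReducedAW k))))
      map_add' := fun _ _ => (congrArg _ ((congrArg _ (add_tens _ _ _)).trans
        (tens_add _ _ _))).trans (castHom_add _ _ _ _)
      map_smul' := fun _ _ => (congrArg _ ((congrArg _ (smul_tens _ _ _)).trans
        (tens_smul _ _ _))).trans (castHom_smul _ _ _ _) }
    (((castHom_same _ _ _).trans (.of_eq ((congrArg _ (tens_id _ _)).trans (tens_id _ _)))).trans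
      (.id (thin_add_three h))).eq
    (fun f g => ((castHom_same _ _ _).trans (Same.trans
      (.of_eq ((congrArg₂ tens (Category.id_comp (𝟙 (⟨thin i⟩ : ReducedAW k))).symm
        ((congrArg (tens _) (Category.id_comp (𝟙 (⟨thin (N - i - m)⟩ : ReducedAW k))).symm).trans
          (tens_comp f g _ _).symm)).trans (tens_comp _ _ _ _).symm))
      ((castHom_same (thin_add_three h) (thin_add_three h) _).comp
        (castHom_same (thin_add_three h) (thin_add_three h) _)).symm)).eq)

theorem emb_same (i : ℕ) {m N : ℕ} (h : i + m ≤ N) (f : ThinEnd k m) : Same (emb i h f)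
    (tens (𝟙 (⟨thin i⟩ : ReducedAW k)) (tens f (𝟙 (⟨thin (N - i - m)⟩ : ReducedAW k)))) :=
  castHom_same _ _ _

theorem emb_same_left {n m N : ℕ} (h : n + m = N) (f : ThinEnd k n) :
    Same (emb 0 (by omega : 0 + n ≤ N) f) (tens f (𝟙 (⟨thin m⟩ : ReducedAW k))) :=
  (emb_same _ _ f).trans ((id_tens _).trans ((Same.refl f).tens
    (.id (congrArg thin (by omega)))))

theorem emb_same_right {n m N : ℕ} (h : n + m = N) (f : ThinEnd k m) :
    Same (emb n h.le f) (tens (𝟙 (⟨thin n⟩ : ReducedAW k)) f) := by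
  refine (emb_same _ _ f).trans ((Same.refl _).tens ?_)
  have h' : N - n - m = 0 := by omega
  exact ((Same.refl f).tens (.id (congrArg thin h'))).trans (tens_one f)

theorem emb_mul_emb_same {n m N : ℕ} (h : n + m = N) (f : ThinEnd k n) (g : ThinEnd k m) :
    Same (emb 0 (by omega : 0 + n ≤ N) f * emb n h.le g) (tens f g) := by
  refine ((emb_same_left h f).comp (emb_same_right h g)).trans (.of_eq ?_)
  exact tens_id_comp_id_tens _ _

theorem emb_mul_emb_same' {n m N : ℕ} (h : n + m = N) (f : ThinEnd k n) (g : ThinEnd k m) :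
    Same (emb n h.le g * emb 0 (by omega : 0 + n ≤ N) f) (tens f g) := by
  refine ((emb_same_right h g).comp (emb_same_left h f)).trans (.of_eq ?_)
  exact id_tens_comp_tens_id _ _

theorem emb_emb (i j : ℕ) {l m N : ℕ} (h : j + l ≤ m) (h' : i + m ≤ N) (f : ThinEnd k l) :
    emb i h' (emb j h f) = emb (i + j) (by omega : i + j + l ≤ N) f := by
  refine Same.eq ?_
  refine (emb_same _ _ _).trans (Same.trans ?_ (emb_same _ _ _).symm)
  have h₁ : Same (tens (emb j h f) (𝟙 (⟨thin (N - i - m)⟩ : ReducedAW k)))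
      (tens (𝟙 (⟨thin j⟩ : ReducedAW k))
        (tens f (𝟙 (⟨thin (N - (i + j) - l)⟩ : ReducedAW k)))) := by
    refine ((emb_same j h f).tens (.refl _)).trans ((tens_assoc _ _ _).trans
      ((Same.refl _).tens ((tens_assoc _ _ _).trans ((Same.refl f).tens ?_))))
    refine (Same.of_eq (tens_id _ _)).trans (.id ?_)
    rw [thin_add]
    congr 1
    omega
  refine ((Same.refl _).tens h₁).trans ((tens_assoc _ _ _).symm.trans (Same.tens ?_ (.refl _)))
  exact (Same.of_eq (tens_id _ _)).trans (.id (thin_add i j))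

theorem emb_self {n : ℕ} (h : 0 + n ≤ n) (f : ThinEnd k n) : emb 0 h f = f :=
  ((emb_same_left (m := 0) rfl f).trans (tens_one f)).eq

theorem emb_congr {i j m N : ℕ} (hij : i = j) (h : i + m ≤ N) (h' : j + m ≤ N)
    (f : ThinEnd k m) : emb i h f = emb j h' f := by
  subst hij
  rfl

/-- Cutting the bundle at position `j` puts the two endomorphisms into different tensor factors,
where the interchange law applies. -/
theorem commute_emb {i j m n N : ℕ} (h : i + m ≤ N) (h' : j + n ≤ N) (hij : i + m ≤ j)
    (f : ThinEnd k m) (g : ThinEnd k n) : Commute (emb i h f) (emb j h' g) := by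
  have h₁ := emb_emb 0 i hij (by omega : 0 + j ≤ N) f
  have h₂ := emb_emb j 0 (by omega : 0 + n ≤ N - j) (by omega : j + (N - j) ≤ N) g
  rw [emb_congr (zero_add i) _ h] at h₁
  rw [emb_congr (add_zero j) _ h'] at h₂
  rw [← h₁, ← h₂]
  exact ((emb_mul_emb_same (by omega) _ _).trans (emb_mul_emb_same' (by omega) _ _).symm).eq

variable (k) in
/-- The crossing of two thin strands. -/
def thinCrossing : ThinEnd k 2 := crossHom k 1 1

variable (k) in
/-- The crossing of the thin strands at positions `i` and `i + 1`. -/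
def crossAt (N i : ℕ) : ThinEnd k N :=
  -- Positions out of range get the identity, so that the crossings form a family indexed by all of
  -- `ℕ`; `Rel N` concerns only positions in range.
  if h : i + 2 ≤ N then emb i h (thinCrossing k) else 1

variable (k) in
/-- The dot on a single thin strand. -/
def dotHom : ThinEnd k 1 := homMk (ReducedRel k) (thinDot k _ (Set.mem_singleton 1))

variable (k) in
/-- The dot on the thin strand at position `i`. -/
def dotAt (N i : ℕ) : ThinEnd k N := if h : i + 1 ≤ N then emb i h (dotHom k) else 1

theorem emb_crossAt {i j n N : ℕ} (h : i + n ≤ N) (hj : j + 1 < n) :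
    emb i h (crossAt k n j) = crossAt k N (i + j) := by
  rw [crossAt, crossAt, dif_pos (by omega), dif_pos (by omega), emb_emb]

theorem emb_dotAt {i j n N : ℕ} (h : i + n ≤ N) (hj : j < n) :
    emb i h (dotAt k n j) = dotAt k N (i + j) := by
  rw [dotAt, dotAt, dif_pos (by omega), dif_pos (by omega), emb_emb]

theorem crossAt_two : crossAt k 2 0 = thinCrossing k := by
  rw [crossAt, dif_pos (by omega), emb_self]

end embedding

/-! ### Embedding morphisms between words into endomorphisms of thin strands. -/

section thinning

variable {k : Type u} [Field k]

/-- The endomorphism of a bundle of thin strands which corresponds to a morphism between words. -/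
def thinning {N : ℕ} {u v : List ℕ+} (hu : weight u = N) (hv : weight v = N) :
    ((⟨u⟩ : ReducedAW k) ⟶ ⟨v⟩) →ₗ[k] ThinEnd k N where
  -- Dividing by the factorial of the target cancels the scalar of `wordSplit_comp_wordMerge` when
  -- two such morphisms are composed.
  toFun f := (wordFactorial v : k)⁻¹ • (castHom (congrArg thin hu) rfl (wordMerge k u) ≫ f ≫
    castHom rfl (congrArg thin hv) (wordSplit k v) : (⟨thin N⟩ : ReducedAW k) ⟶ ⟨thin N⟩)
  map_add' f g := by
    rw [Preadditive.add_comp, Preadditive.comp_add]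
    exact smul_add _ _ _
  map_smul' r f := by
    rw [Linear.smul_comp, Linear.comp_smul, smul_comm]
    rfl

variable {N : ℕ} {u v w : List ℕ+}

theorem thinning_same (hu : weight u = N) (hv : weight v = N) (f : (⟨u⟩ : ReducedAW k) ⟶ ⟨v⟩) :
    Same (thinning hu hv f) ((wordFactorial v : k)⁻¹ • (wordMerge k u ≫ f ≫ wordSplit k v)) :=
  Same.smul _ ((castHom_same _ _ _).comp ((Same.refl f).comp (castHom_same _ _ _)))

theorem thinning_congr {u' v' : List ℕ+} (hu : weight u = N) (hv : weight v = N)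
    (hu' : weight u' = N) (hv' : weight v' = N) {f : (⟨u⟩ : ReducedAW k) ⟶ ⟨v⟩}
    {g : (⟨u'⟩ : ReducedAW k) ⟶ ⟨v'⟩} (h : Same f g) : thinning hu hv f = thinning hu' hv' g := by
  cases h
  rfl

theorem thinning_thin (h h' : weight (thin N) = N) (f : ThinEnd k N) :
    thinning h h' f = f := by
  refine ((thinning_same _ _ f).trans (Same.trans (.of_eq ?_) ((Same.id_comp
    (wordMerge_thin k N)).trans (Same.comp_id (wordSplit_thin k N))))).eq
  rw [wordFactorial_thin, Nat.cast_one, inv_one, one_smul]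

theorem thinning_comp [CharZero k] (hu : weight u = N) (hv : weight v = N) (hw : weight w = N)
    (f : (⟨u⟩ : ReducedAW k) ⟶ ⟨v⟩) (g : (⟨v⟩ : ReducedAW k) ⟶ ⟨w⟩) :
    thinning hu hw (f ≫ g) = thinning hu hv f * thinning hv hw g := by
  refine ((thinning_same _ _ _).trans (Same.trans (.of_eq ?_)
    ((thinning_same hu hv f).comp (thinning_same hv hw g)).symm)).eq
  have h : wordSplit k v ≫ wordMerge k v ≫ g ≫ wordSplit k w =
      (wordFactorial v : k) • (g ≫ wordSplit k w) := by
    rw [← Category.assoc, wordSplit_comp_wordMerge, Linear.smul_comp, Category.id_comp]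
  simp only [Linear.smul_comp, Linear.comp_smul, Category.assoc, h, smul_smul]
  rw [mul_comm (wordFactorial w : k)⁻¹, inv_mul_cancel₀ (wordFactorial_ne_zero k v),
    one_mul]

/-- Composing with the split of `u` before and the merge of `v` after recovers a nonzero multiple of
`f`. -/
theorem thinning_injective [CharZero k] (hu : weight u = N) (hv : weight v = N) :
    Function.Injective (thinning (k := k) hu hv) := by
  intro f g h
  have h₁ := ((thinning_same hu hv f).symm.trans
    ((Same.of_eq h).trans (thinning_same hu hv g))).eq
  have h₂ : ∀ f : (⟨u⟩ : ReducedAW k) ⟶ ⟨v⟩, wordSplit k u ≫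
      ((wordFactorial v : k)⁻¹ • (wordMerge k u ≫ f ≫ wordSplit k v)) ≫ wordMerge k v =
      (wordFactorial u : k) • f := by
    intro f
    simp only [Linear.smul_comp, Linear.comp_smul, Category.assoc, wordSplit_comp_wordMerge]
    rw [← Category.assoc, wordSplit_comp_wordMerge, Linear.smul_comp, Category.id_comp,
      Category.comp_id, smul_smul, smul_smul,
      inv_mul_cancel₀ (wordFactorial_ne_zero k v), one_mul]
  have h₃ := (h₂ f).symm.trans ((congrArg (fun x => wordSplit k u ≫ x ≫ wordMerge k v) h₁).trans
    (h₂ g))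
  exact smul_right_injective _ (wordFactorial_ne_zero k u) h₃

theorem thinning_tens {u' v' : List ℕ+} {n m : ℕ} (hu : weight u = n) (hv : weight v = n)
    (hu' : weight u' = m) (hv' : weight v' = m) (h : n + m = N) (h₁ : weight (u ++ u') = N)
    (h₂ : weight (v ++ v') = N) (f : (⟨u⟩ : ReducedAW k) ⟶ ⟨v⟩)
    (g : (⟨u'⟩ : ReducedAW k) ⟶ ⟨v'⟩) :
    thinning h₁ h₂ (tens f g) =
      emb 0 (by omega : 0 + n ≤ N) (thinning hu hv f) * emb n h.le (thinning hu' hv' g) := by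
  refine ((thinning_same _ _ _).trans (Same.trans ?_ ((emb_mul_emb_same h _ _).trans
    ((thinning_same hu hv f).tens (thinning_same hu' hv' g))).symm)).eq
  rw [smul_tens, tens_smul, smul_smul, ← mul_inv, ← Nat.cast_mul, ← wordFactorial_append]
  refine Same.smul _ (Same.trans ?_ (.of_eq ((congrArg _ (tens_comp _ _ _ _)).trans
    (tens_comp _ _ _ _))))
  exact (wordMerge_append k u u').comp ((Same.refl _).comp (wordSplit_append k v v'))

variable (k) in
/-- The endomorphism of `n` thin strands which corresponds to a strand of thickness `n`. -/
def thickId (n : ℕ) : ThinEnd k n :=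
  thinning (weight_strand n) (weight_strand n) (𝟙 _)

/-- By associativity, merging in two stages is the full merge, so the merge becomes
indistinguishable from the identity of the thick strand. -/
theorem thinning_mergeHom (a b : ℕ) (h : weight (strand a ++ strand b) = a + b) :
    thinning h (weight_strand (a + b)) (mergeHom k a b) = thickId k (a + b) := by
  refine ((thinning_same _ _ _).trans (Same.trans (Same.smul _ ?_) (thinning_same _ _ _).symm)).eq
  rw [Category.id_comp, ← Category.assoc]
  refine Same.comp ?_ (.refl _)
  refine Same.trans (((wordMerge_append k _ _).trans ((wordMerge_strand k a).tens
    (wordMerge_strand k b))).comp (.refl _)) ?_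
  exact (fullMergeHom_add k a b).trans (wordMerge_strand k _).symm

/-- The binomial is the ratio of the normalisations: the target contributes `a! * b!` here and `(a +
b)!` in `thickId`. Merges have no such factor because only the target is normalised. -/
theorem thinning_splitHom [CharZero k] (a b : ℕ) (h : weight (strand a ++ strand b) = a + b) :
    thinning (weight_strand (a + b)) h (splitHom k a b) =
      ((a + b).choose a : k) • thickId k (a + b) := by
  refine ((thinning_same _ _ _).trans (Same.trans ?_ ((thinning_same _ _ _).smul _).symm)).eq
  rw [smul_smul]
  have h₁ : (wordFactorial (strand a ++ strand b) : k)⁻¹ =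
      ((a + b).choose a : k) * (wordFactorial (strand (a + b)) : k)⁻¹ := by
    rw [wordFactorial_append, wordFactorial_strand, wordFactorial_strand, wordFactorial_strand,
      ← Nat.choose_mul_factorial_mul_factorial (Nat.le_add_right a b), Nat.add_sub_cancel_left]
    have h₂ : ((a + b).choose a : k) ≠ 0 :=
      Nat.cast_ne_zero.2 (Nat.choose_pos (Nat.le_add_right a b)).ne'
    have h₃ : (a.factorial : k) ≠ 0 := Nat.cast_ne_zero.2 a.factorial_ne_zero
    have h₄ : (b.factorial : k) ≠ 0 := Nat.cast_ne_zero.2 b.factorial_ne_zero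
    push_cast
    field_simp
  rw [h₁, Category.id_comp]
  refine Same.smul _ ((Same.refl _).comp ?_)
  refine Same.trans ((Same.refl _).comp ((wordSplit_append k _ _).trans ((wordSplit_strand k a).tens
    (wordSplit_strand k b)))) ?_
  exact (fullSplitHom_add k a b).trans (wordSplit_strand k _).symm

theorem thinning_crossHom_one (h h' : weight (strand 1 ++ strand 1) = 2) :
    thinning h h' (crossHom k 1 1) = crossAt k 2 0 :=
  (thinning_thin (N := 2) h h' (crossHom k 1 1)).trans crossAt_two.symm

theorem thickId_mul_self [CharZero k] (n : ℕ) : thickId k n * thickId k n = thickId k n := by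
  rw [thickId, ← thinning_comp, Category.id_comp]

theorem thickId_zero : thickId k 0 = 1 := thinning_thin (N := 0) _ _ (𝟙 _)

theorem thickId_one : thickId k 1 = 1 := thinning_thin (N := 1) _ _ (𝟙 _)

theorem weight_strand_append (a b : ℕ) : weight (strand a ++ strand b) = a + b := by
  rw [weight_append, weight_strand, weight_strand]

theorem thinning_tens_id (a b : ℕ) (h : weight (strand a ++ strand b) = N)
    (h' : a + b = N) : thinning h h (𝟙 (⟨strand a ++ strand b⟩ : ReducedAW k)) =
      emb 0 (by omega : 0 + a ≤ N) (thickId k a) * emb a h'.le (thickId k b) := by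
  rw [← tens_id, thinning_tens (weight_strand a) (weight_strand a) (weight_strand b)
    (weight_strand b) h']
  rfl

/-- A thick strand absorbs adjacent thick strands. -/
theorem emb_mul_thickId [CharZero k] (a b : ℕ) :
    emb 0 (by omega : 0 + a ≤ a + b) (thickId k a) * emb a le_rfl (thickId k b) *
      thickId k (a + b) = thickId k (a + b) := by
  rw [← thinning_tens_id a b (weight_strand_append a b) rfl,
    ← thinning_mergeHom a b (weight_strand_append a b), ← thinning_comp, Category.id_comp]

/-- The outer factors come from the splits and the merges, and the two binomials from the splits.
The totals `a b c d` are separate variables, so that the expressions in applications need not have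
the syntactic form `s + p`. -/
theorem thinning_exchange [CharZero k] {s p q t a b c d : ℕ} (ha : s + p = a) (hb : s + q = b)
    (hc : q + t = c) (hd : p + t = d) (hN : s + p + q + t = N)
    (m : Expr k (Gen {1}) (strand p ++ strand q) (strand q ++ strand p))
    (hm : weight (strand p ++ strand q) = p + q) (hm' : weight (strand q ++ strand p) = p + q)
    (h : strand (s + p) ++ strand (q + t) = u) (h' : strand (s + q) ++ strand (p + t) = v)
    (hu : weight u = N) (hv : weight v = N) :
    thinning hu hv (homMk (ReducedRel k) ((exchange s p q t m).cast h h')) =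
      (a.choose s * c.choose q : k) •
        (emb 0 (by omega : 0 + a ≤ N) (thickId k a) * emb a (by omega : a + c ≤ N) (thickId k c) *
          (emb 0 (by omega : 0 + s ≤ N) (thickId k s) *
            emb s (by omega : s + (p + q) ≤ N) (thinning hm hm' (homMk _ m)) *
            emb (s + p + q) hN.le (thickId k t)) *
          (emb 0 (by omega : 0 + b ≤ N) (thickId k b) *
            emb b (by omega : b + d ≤ N) (thickId k d))) := by
  subst ha hb hc hd h h'
  have w₁ : weight (strand s ++ strand p ++ (strand q ++ strand t)) = N := by
    rw [weight_append, weight_strand_append, weight_strand_append]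
    omega
  have w₂ : weight (strand s ++ strand q ++ (strand p ++ strand t)) = N := by
    rw [weight_append, weight_strand_append, weight_strand_append]
    omega
  have w₃ : weight (strand s ++ (strand p ++ strand q)) = s + (p + q) := by
    rw [weight_append, weight_strand_append, weight_strand]
  have w₄ : weight (strand s ++ (strand q ++ strand p)) = s + (p + q) := by
    rw [weight_append, weight_strand_append, weight_strand]
    omega
  have w₅ : weight (strand s ++ (strand p ++ strand q) ++ strand t) = N := by
    rw [weight_append, w₃, weight_strand]
    omega
  have w₆ : weight (strand s ++ (strand q ++ strand p) ++ strand t) = N := by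
    rw [weight_append, w₄, weight_strand]
    omega
  let middle : (⟨strand s ++ strand p ++ (strand q ++ strand t)⟩ : ReducedAW k) ⟶
      ⟨strand s ++ strand q ++ (strand p ++ strand t)⟩ :=
    castHom (by simp) (by simp)
      (tens (tens (𝟙 (⟨strand s⟩ : ReducedAW k)) (homMk _ m)) (𝟙 (⟨strand t⟩ : ReducedAW k)))
  have e : Same (homMk (ReducedRel k) ((exchange s p q t m).cast rfl rfl))
      ((tens (splitHom k s p) (splitHom k q t) ≫ middle) ≫
        tens (mergeHom k s q) (mergeHom k p t)) := by
    have e₀ : Same (homMk (ReducedRel k) (Expr.cast (a' := strand s ++ strand p ++ (strand q ++ strand t))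
        (b' := strand s ++ strand q ++ (strand p ++ strand t)) (by simp) (by simp)
        (((Expr.id (strand s)).tensor m).tensor (Expr.id (strand t))))) middle :=
      (homMk_cast_same _ _ _).trans (castHom_same _ _ _).symm
    exact Same.comp (Same.comp (.refl (homMk _ ((split k _ s p).tensor (split k _ q t)))) e₀)
      (.refl (homMk _ ((merge k _ s q).tensor (merge k _ p t))))
  have e₁ : thinning w₁ w₂ middle = emb 0 (by omega : 0 + s ≤ N) (thickId k s) *
      emb s (by omega : s + (p + q) ≤ N) (thinning hm hm' (homMk _ m)) *
        emb (s + p + q) hN.le (thickId k t) := by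
    rw [thinning_congr w₁ w₂ w₅ w₆ (castHom_same _ _ _),
      thinning_tens w₃ w₄ (weight_strand t) (weight_strand t) (by omega),
      thinning_tens (weight_strand s) (weight_strand s) hm hm' rfl, map_mul, emb_emb, emb_emb,
      emb_congr (zero_add s), emb_congr (by omega : s + (p + q) = s + p + q)]
    rfl
  rw [thinning_congr _ _ hu hv e, thinning_comp hu w₂ hv, thinning_comp hu w₁ w₂, e₁,
    thinning_tens (weight_strand _) (weight_strand_append s p) (weight_strand _)
      (weight_strand_append q t) (by omega),
    thinning_tens (weight_strand_append s q) (weight_strand _) (weight_strand_append p t)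
      (weight_strand _) (by omega), thinning_splitHom, thinning_splitHom, thinning_mergeHom,
    thinning_mergeHom, map_smul, map_smul]
  simp only [smul_mul_assoc, mul_smul_comm, smul_smul, mul_comm]

end thinning

end AffineWeb

/-! ### The merge-split relation on thin strands. -/

namespace StrictPresentation.PresCat

theorem homMk_list_sum {k : Type u} [CommRing k] {Γ : Type} {G : List Γ → List Γ → Type}
    {R : ∀ a b : List Γ, Expr k G a b → Expr k G a b → Prop} {a b : List Γ}
    (l : List (Expr k G a b)) : homMk R l.sum = (l.map (homMk R)).sum := by
  induction l with
  | nil => rfl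
  | cons f l ih =>
    rw [List.sum_cons, List.map_cons, List.sum_cons, ← ih]
    rfl

end StrictPresentation.PresCat

namespace SymRing

/-- The braid relation for two reflections in idempotents. -/
theorem braid_of_idempotents {A : Type*} [Ring A] {f g s t : A} (hs : s = 2 * g - 1)
    (ht : t = 2 * f - 1) (h : f + 2 * (f * s * f) = g + 2 * (g * t * g)) :
    s * t * s = t * s * t := by
  subst hs ht
  linear_combination (norm := noncomm_ring) (-2) * h

end SymRing

namespace AffineWeb

open StrictPresentation StrictPresentation.PresCat SymRing

variable {k : Type u} [Field k] {N : ℕ} {u v : List ℕ+}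

theorem thinning_list_sum (hu : weight u = N) (hv : weight v = N) (n : ℕ)
    (f : ℕ → Expr k (Gen {1}) u v) :
    thinning hu hv (homMk (ReducedRel k) ((List.range n).map f).sum) =
      ∑ i ∈ Finset.range n, thinning hu hv (homMk (ReducedRel k) (f i)) := by
  rw [homMk_list_sum, map_list_sum, List.map_map, List.map_map]
  rfl

theorem thinning_zero (hu : weight u = N) (hv : weight v = N) :
    thinning hu hv (homMk (ReducedRel k) 0) = 0 :=
  map_zero (thinning hu hv)

section merge_split

variable [CharZero k]

theorem thinning_split_cast {b d n : ℕ} (hn : b + d = n) (hs : strand (b + d) = strand n)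
    (h : weight (strand b ++ strand d) = n) :
    thinning (weight_strand n) h (homMk (ReducedRel k) ((split k _ b d).cast hs rfl)) =
      (n.choose b : k) • thickId k n := by
  subst hn
  exact thinning_splitHom b d h

/-- The merge-split relation, in the case in which one summand is determined by the other one. -/
theorem thickId_eq_sum {a b c d : ℕ} (ha : 0 < a) (hb : 0 < b) (hc : 0 < c) (hd : 0 < d)
    (h : a + c = b + d) (T : ℕ → ThinEnd k (a + c)) (n : ℕ) (hn : n = min a b + 1)
    (hT : ∀ s t, s ≤ a → s ≤ b → t ≤ c → t ≤ d → t + a = s + d →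
      ∀ (h₁ : strand (s + (a - s)) ++ strand (c - t + t) = strand a ++ strand c)
        (h₂ : strand (s + (c - t)) ++ strand (a - s + t) = strand b ++ strand d)
        (hu : weight (strand a ++ strand c) = a + c) (hv : weight (strand b ++ strand d) = a + c),
      thinning hu hv (homMk (ReducedRel k)
        ((exchange s (a - s) (c - t) t (cross k _ (a - s) (c - t))).cast h₁ h₂)) = T s)
    (hT' : ∀ s, s ≤ a → s ≤ b → (s + d < a ∨ min c d + a < s + d) → T s = 0) :
    ((a + c).choose b : k) • thickId k (a + c) = ∑ s ∈ Finset.range n, T s := by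
  subst hn
  have hu := weight_strand_append a c
  have hv : weight (strand b ++ strand d) = a + c := (weight_strand_append b d).trans h.symm
  have e := congrArg (thinning hu hv) (web_eq k (.merge_split a b c d ha hb hc hd h))
  rw [homMk_comp, thinning_comp hu (weight_strand (a + c)) hv,
    thinning_split_cast h.symm] at e
  have e' := thinning_mergeHom (k := k) a c hu
  rw [mergeHom] at e'
  -- The left side of merge-split is the thick idempotent times a multiple of itself, coming from
  -- the merge and the split.
  rw [e', mul_smul_comm, thickId_mul_self] at e
  rw [e, thinning_list_sum]
  refine Finset.sum_congr rfl fun s hs => ?_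
  have hs := Finset.mem_range.1 hs
  rw [thinning_list_sum]
  -- For given `s` only `t = s + d - a` can contribute. When this value is out of range the inner
  -- sum vanishes, which is what `hT'` requires of `T s`.
  by_cases hst : a ≤ s + d ∧ s + d ≤ min c d + a
  · rw [Finset.sum_eq_single (s + d - a), dif_pos (by omega)]
    · exact hT _ _ (by omega) (by omega) (by omega) (by omega) (by omega) _ _ _ _
    · intro t _ ht
      rw [dif_neg (by omega), thinning_zero]
    · intro ht
      rw [Finset.mem_range] at ht
      omega
  · rw [hT' s (by omega) (by omega) (by omega)]
    refine Finset.sum_eq_zero fun t ht => ?_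
    have ht := Finset.mem_range.1 ht
    rw [dif_neg (by omega), thinning_zero]

end merge_split

theorem crossHom_zero_left (b : ℕ) :
    Same (crossHom k 0 b) (𝟙 (⟨strand 0 ++ strand b⟩ : ReducedAW k)) :=
  homMk_cast_same rfl (by simp [strand]) (Expr.id (strand b))

theorem crossHom_zero_right (a : ℕ) :
    Same (crossHom k a 0) (𝟙 (⟨strand a ++ strand 0⟩ : ReducedAW k)) := by
  cases a
  · exact crossHom_zero_left 0
  · exact .refl _

theorem emb_thinning_cross_zero {s p q : ℕ} (hp : p = 0) (hq : q = 0) (h : s + (p + q) ≤ N)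
    (hm : weight (strand p ++ strand q) = p + q) (hm' : weight (strand q ++ strand p) = p + q) :
    emb s h (thinning hm hm' (homMk (ReducedRel k) (cross k _ p q))) = 1 := by
  subst hp hq
  have e : thinning hm hm' (crossHom k 0 0) = 1 :=
    (thinning_congr hm hm' hm hm (crossHom_zero_left 0)).trans (thinning_thin (N := 0) hm hm (𝟙 _))
  exact (congrArg _ e).trans (map_one _)

theorem emb_thinning_cross_one {s p q : ℕ} (hp : p = 1) (hq : q = 1) (h : s + (p + q) ≤ N)
    (hm : weight (strand p ++ strand q) = p + q) (hm' : weight (strand q ++ strand p) = p + q) :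
    emb s h (thinning hm hm' (homMk (ReducedRel k) (cross k _ p q))) = crossAt k N s := by
  subst hp hq
  exact (congrArg (emb s h) (thinning_crossHom_one (k := k) hm hm')).trans
    (emb_crossAt (n := 2) h (by omega))

section recursion

variable [CharZero k]

theorem emb_thickId_mul_emb_thickId {i n : ℕ} (h : i + (1 + n) ≤ N) :
    emb (i + 1) (by omega : i + 1 + n ≤ N) (thickId k n) * emb i h (thickId k (1 + n)) =
      emb i h (thickId k (1 + n)) := by
  have e := congrArg (emb i h) (emb_mul_thickId (k := k) 1 n)
  rwa [thickId_one, map_one, one_mul, map_mul, emb_emb] at e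

/-- This is merge-split from `(1, n)` to itself. The summand `s = 1` has no crossing; the summand `s
= 0` has one thin crossing, and its coefficient `n` comes from splitting a thin strand off the
strand of thickness `n`. -/
theorem thickId_recursion {n : ℕ} (hn : 0 < n) :
    ((1 + n : ℕ) : k) • thickId k (1 + n) = emb 1 le_rfl (thickId k n) +
      (n : k) • (emb 1 le_rfl (thickId k n) * crossAt k (1 + n) 0 *
        emb 1 le_rfl (thickId k n)) := by
  obtain ⟨m, rfl⟩ : ∃ m, n = 1 + m := ⟨n - 1, by omega⟩
  have e := thickId_eq_sum (k := k) (a := 1) (b := 1) (c := 1 + m) (d := 1 + m) one_pos one_pos hn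
    hn rfl (fun s => if s = 0 then ((1 + m : ℕ) : k) • (emb 1 le_rfl (thickId k (1 + m)) *
      crossAt k (1 + (1 + m)) 0 * emb 1 le_rfl (thickId k (1 + m))) else
        emb 1 le_rfl (thickId k (1 + m))) 2 rfl ?_ (fun s h₁ h₂ h₃ => by omega)
  · rw [Nat.choose_one_right, Finset.sum_range_succ, Finset.sum_range_one, if_pos rfl,
      if_neg one_ne_zero] at e
    exact e.trans (add_comm _ _)
  · intro s t h₁ h₂ h₃ h₄ h₅ h₆ h₇ hu hv
    rw [thinning_exchange (a := 1) (b := 1) (c := 1 + m) (d := 1 + m) (by omega) (by omega)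
      (by omega) (by omega) (by omega) _ (weight_strand_append _ _)
      ((weight_strand_append _ _).trans (add_comm _ _))]
    rcases Nat.eq_zero_or_pos s with rfl | hs
    · obtain rfl : t = m := by omega
      have hc : (1 + t).choose (1 + t - t) = 1 + t := by
        rw [Nat.add_sub_cancel, Nat.choose_one_right]
      rw [if_pos rfl, emb_thinning_cross_one (by omega) (by omega), thickId_one, thickId_zero]
      simp only [map_one, one_mul]
      rw [mul_assoc, mul_assoc (crossAt k _ 0),
        emb_congr (by omega : 0 + (1 - 0) + (1 + t - t) = 1 + 1) _ (by omega),
        emb_thickId_mul_emb_thickId, ← mul_assoc, hc, Nat.choose_zero_right, Nat.cast_one, one_mul]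
    · obtain rfl : s = 1 := by omega
      obtain rfl : t = 1 + m := by omega
      have hc : (1 + m).choose (1 + m - (1 + m)) = 1 := by
        rw [Nat.sub_self, Nat.choose_zero_right]
      rw [if_neg one_ne_zero, emb_thinning_cross_zero (by omega) (by omega), thickId_one]
      simp only [map_one, one_mul]
      rw [emb_congr (by omega : 1 + (1 - 1) + (1 + m - (1 + m)) = 1) _ le_rfl, ← map_mul,
        ← map_mul, thickId_mul_self, thickId_mul_self, hc, Nat.choose_self, Nat.cast_one,
        one_mul, one_smul]

/-- The thin crossing is thus `2 e - 1` for an idempotent `e`, and therefore an involution. -/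
theorem thickId_two : (2 : k) • thickId k 2 = 1 + crossAt k 2 0 := by
  have e := thickId_recursion (k := k) one_pos
  rw [thickId_one, map_one, one_mul, mul_one, Nat.cast_one, one_smul] at e
  exact_mod_cast e

theorem crossAt_two_eq : crossAt k 2 0 = 2 * thickId k 2 - 1 := by
  rw [eq_sub_iff_add_eq, add_comm, ← thickId_two, two_smul, two_mul]

theorem crossAt_two_sq : crossAt k 2 0 * crossAt k 2 0 = 1 := by
  have h := thickId_mul_self (k := k) 2
  rw [crossAt_two_eq]
  linear_combination (norm := noncomm_ring) 4 * h

/-- The mirror image of the recursion, from `(2, 1)` to itself. Here `t = s - 1`, so the value at `s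
= 0` has no summand and is set to zero. -/
theorem thickId_three : (3 : k) • thickId k 3 = emb 0 (by omega) (thickId k 2) +
    (2 : k) • (emb 0 (by omega) (thickId k 2) * crossAt k 3 1 *
        emb 0 (by omega) (thickId k 2)) := by
  have e := thickId_eq_sum (k := k) (a := 2) (b := 2) (c := 1) (d := 1) two_pos two_pos one_pos
    one_pos rfl (fun s => if s = 0 then 0 else if s = 1 then (2 : k) •
      (emb 0 (by omega) (thickId k 2) * crossAt k 3 1 * emb 0 (by omega) (thickId k 2)) else
        emb 0 (by omega) (thickId k 2)) 3 rfl ?_ (fun s h₁ h₂ h₃ => if_pos (by omega))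
  · simp only [Finset.sum_range_succ, Finset.sum_range_zero, if_pos] at e
    norm_num at e
    rw [add_comm]
    exact e
  · intro s t h₁ h₂ h₃ h₄ h₅ h₆ h₇ hu hv
    rw [thinning_exchange (a := 2) (b := 2) (c := 1) (d := 1) (by omega) (by omega)
      (by omega) (by omega) (by omega) _ (weight_strand_append _ _)
      ((weight_strand_append _ _).trans (add_comm _ _)), if_neg (by omega)]
    rcases Nat.eq_zero_or_pos t with rfl | ht
    · obtain rfl : s = 1 := by omega
      rw [if_pos rfl, emb_thinning_cross_one (by omega) (by omega), thickId_one, thickId_zero]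
      simp only [map_one, one_mul, mul_one]
      norm_num
    · obtain rfl : s = 2 := by omega
      obtain rfl : t = 1 := by omega
      rw [if_neg (by omega), emb_thinning_cross_zero (by omega) (by omega), thickId_one]
      simp only [map_one, mul_one]
      rw [← map_mul, ← map_mul, thickId_mul_self, thickId_mul_self]
      norm_num

/-- The idempotent on three strands is computed in two ways, by splitting off a strand on the right
or on the left. With each crossing written as `2 e - 1`, equating the results is the braid relation.
-/
theorem crossAt_braid :
    crossAt k 3 0 * crossAt k 3 1 * crossAt k 3 0 =
      crossAt k 3 1 * crossAt k 3 0 * crossAt k 3 1 := by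
  have h₁ := emb_crossAt (k := k) (i := 0) (n := 2) (N := 3) (j := 0) (by omega) (by omega)
  have h₂ := emb_crossAt (k := k) (i := 1) (n := 2) (N := 3) (j := 0) (by omega) (by omega)
  rw [crossAt_two_eq, map_sub, map_mul, map_one, map_ofNat] at h₁ h₂
  have e₁ := thickId_three (k := k)
  have e₂ := thickId_recursion (k := k) two_pos
  refine braid_of_idempotents h₁.symm h₂.symm ?_
  rw [two_mul, two_mul, ← two_smul k, ← two_smul k, ← e₁]
  exact_mod_cast e₂.symm

end recursion

end AffineWeb

/-! ### Hecke relations for thin strands and the formula for thick crossings. -/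

namespace AffineWeb

open StrictPresentation StrictPresentation.PresCat SymRing

section relations

variable {k : Type u} [Field k] {N : ℕ} {u v : List ℕ+}

theorem crossAt_cross_dot :
    crossAt k 2 0 * dotAt k 2 0 = dotAt k 2 1 * crossAt k 2 0 + 1 := by
  have h₀ : dotAt k 2 0 = tens (dotHom k) (𝟙 (⟨[1]⟩ : ReducedAW k)) := by
    rw [dotAt, dif_pos (by omega)]
    exact (emb_same_left (n := 1) (m := 1) rfl (dotHom k)).eq
  have h₁ : dotAt k 2 1 = tens (𝟙 (⟨[1]⟩ : ReducedAW k)) (dotHom k) := by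
    rw [dotAt, dif_pos (by omega)]
    exact (emb_same_right (n := 1) (m := 1) rfl (dotHom k)).eq
  rw [h₀, h₁, crossAt_two]
  exact homMk_eq (Cong.rel ReducedRel.cross_dot)

theorem crossAt_dot_cross :
    dotAt k 2 0 * crossAt k 2 0 = crossAt k 2 0 * dotAt k 2 1 + 1 := by
  have h₀ : dotAt k 2 0 = tens (dotHom k) (𝟙 (⟨[1]⟩ : ReducedAW k)) := by
    rw [dotAt, dif_pos (by omega)]
    exact (emb_same_left (n := 1) (m := 1) rfl (dotHom k)).eq
  have h₁ : dotAt k 2 1 = tens (𝟙 (⟨[1]⟩ : ReducedAW k)) (dotHom k) := by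
    rw [dotAt, dif_pos (by omega)]
    exact (emb_same_right (n := 1) (m := 1) rfl (dotHom k)).eq
  rw [h₀, h₁, crossAt_two]
  exact homMk_eq (Cong.rel ReducedRel.dot_cross)

theorem emb_pair {i n a b : ℕ} (h : i + n ≤ N) (h' : a + b ≤ n) :
    emb i h (pair k (crossAt k n) 0 a b) = pair k (crossAt k N) i a b := by
  rw [pair, pair, map_mul, map_symm k (emb i h) _ (crossAt k N) 0 i a
      fun l _ _ => emb_crossAt _ (by omega), map_symm k (emb i h) _ (crossAt k N) (0 + a) i b
      fun l _ _ => emb_crossAt _ (by omega), zero_add, add_zero]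

theorem emb_block {i n a b : ℕ} (h : i + n ≤ N) (h' : a + b ≤ n) :
    emb i h (block (crossAt k n) 0 a b) = block (crossAt k N) i a b :=
  map_block (emb i h) _ _ 0 i a b fun l _ _ => emb_crossAt _ (by omega)

variable [CharZero k]

-- The local relations on two and three strands are transported to position `i` by the algebra maps
-- `emb`; distant crossings commute by interchange.
variable (k) in
theorem thin_rel (N : ℕ) : Rel N (crossAt k N) where
  sq i hi := by
    have h₀ := emb_crossAt (k := k) (i := i) (n := 2) (j := 0) (N := N) (by omega) (by omega)
    rw [add_zero] at h₀
    rw [← h₀, ← map_mul, crossAt_two_sq, map_one]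
  braid i hi := by
    have h₀ := emb_crossAt (k := k) (i := i) (n := 3) (j := 0) (N := N) (by omega) (by omega)
    rw [add_zero] at h₀
    rw [← h₀, ← emb_crossAt (i := i) (n := 3) (j := 1) (by omega) (by omega), ← map_mul, ← map_mul,
      ← map_mul, ← map_mul, crossAt_braid]
  comm i j hij hj := by
    rw [crossAt, crossAt, dif_pos (by omega), dif_pos (by omega)]
    exact commute_emb _ _ (by omega) _ _

variable (k) in
theorem thin_dotRel (N : ℕ) : DotRel N (crossAt k N) (dotAt k N) where
  toRel := thin_rel k N
  dot_comm i j hi hj := by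
    rw [dotAt, dotAt, dif_pos (by omega), dif_pos (by omega)]
    rcases lt_trichotomy i j with h | rfl | h
    · exact commute_emb _ _ (by omega) _ _
    · exact Commute.refl _
    · exact (commute_emb _ _ (by omega) _ _).symm
  far i j hi hj h₁ h₂ := by
    rw [crossAt, dotAt, dif_pos (by omega), dif_pos (by omega)]
    rcases lt_or_gt_of_ne h₁ with h | h
    · exact (commute_emb _ _ (by omega) _ _).symm
    · exact commute_emb _ _ (by omega) _ _
  cross_dot i hi := by
    have h₀ := emb_crossAt (k := k) (i := i) (n := 2) (j := 0) (N := N) (by omega) (by omega)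
    have h₁ := emb_dotAt (k := k) (i := i) (n := 2) (j := 0) (N := N) (by omega) (by omega)
    rw [add_zero] at h₀ h₁
    rw [← h₀, ← h₁, ← emb_dotAt (k := k) (i := i) (n := 2) (j := 1) (N := N) (by omega) (by omega),
      ← map_mul, ← map_mul, crossAt_cross_dot, map_add, map_one]
  dot_cross i hi := by
    have h₀ := emb_crossAt (k := k) (i := i) (n := 2) (j := 0) (N := N) (by omega) (by omega)
    have h₁ := emb_dotAt (k := k) (i := i) (n := 2) (j := 0) (N := N) (by omega) (by omega)
    rw [add_zero] at h₀ h₁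
    rw [← h₀, ← h₁, ← emb_dotAt (k := k) (i := i) (n := 2) (j := 1) (N := N) (by omega) (by omega),
      ← map_mul, ← map_mul, crossAt_dot_cross, map_add, map_one]

/-- Both sides satisfy the same recursion, one by merge-split and the other by coset decomposition.
-/
theorem thickId_eq (n : ℕ) : thickId k n = symm k (crossAt k n) 0 n := by
  induction n with
  | zero => rw [thickId_zero, symm_zero]
  | succ n ih =>
    rcases Nat.eq_zero_or_pos n with rfl | hn
    · rw [symm_one]
      exact thickId_one
    rw [add_comm n 1]
    have e₁ := thickId_recursion (k := k) hn
    have e₂ := (thin_rel k (1 + n)).symm_recursion k (i := 0) (n := n) (by omega)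
    have e₃ : emb 1 le_rfl (thickId k n) = symm k (crossAt k (1 + n)) (0 + 1) n := by
      rw [ih]
      exact map_symm k (emb 1 le_rfl) _ _ 0 1 n fun l _ _ => emb_crossAt _ (by omega)
    rw [e₃, ← e₂] at e₁
    have h : ((1 + n : ℕ) : k) ≠ 0 := by
      rw [Nat.cast_ne_zero]
      omega
    refine smul_right_injective _ h (e₁.trans ?_)
    simp only [add_comm 1 n, Nat.cast_succ]

theorem emb_thickId {i n : ℕ} (h : i + n ≤ N) :
    emb i h (thickId k n) = symm k (crossAt k N) i n := by
  rw [thickId_eq]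
  exact map_symm k (emb i h) _ _ 0 i n fun l _ _ => emb_crossAt _ (by omega)

theorem thinning_id {a b : ℕ} (h : weight (strand a ++ strand b) = N) :
    thinning h h (𝟙 (⟨strand a ++ strand b⟩ : ReducedAW k)) = pair k (crossAt k N) 0 a b := by
  have h' : a + b = N := (weight_strand_append a b).symm.trans h
  rw [thinning_tens_id a b h h', emb_thickId, emb_thickId, pair, zero_add]

/-- The symmetrizers on the outer strands `s` and `t` lie inside those of the bottom left and top
right thick strands and are absorbed. -/
theorem thinning_exchange_eq {s p q t a b c d : ℕ} (ha : s + p = a) (hb : s + q = b)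
    (hc : q + t = c) (hd : p + t = d) (hN : s + p + q + t = N)
    (m : Expr k (Gen {1}) (strand p ++ strand q) (strand q ++ strand p))
    (hm : weight (strand p ++ strand q) = p + q) (hm' : weight (strand q ++ strand p) = p + q)
    (h : strand (s + p) ++ strand (q + t) = u) (h' : strand (s + q) ++ strand (p + t) = v)
    (hu : weight u = N) (hv : weight v = N) :
    thinning hu hv (homMk (ReducedRel k) ((exchange s p q t m).cast h h')) =
      ((a.choose s * c.choose t : ℕ) : k) • (pair k (crossAt k N) 0 a c *
        emb s (by omega : s + (p + q) ≤ N) (thinning hm hm' (homMk _ m)) *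
          pair k (crossAt k N) 0 b d) := by
  have H := thin_rel k N
  rw [thinning_exchange ha hb hc hd hN m hm hm' h h' hu hv, emb_thickId, emb_thickId, emb_thickId,
    emb_thickId, emb_thickId, emb_thickId]
  have e₁ : pair k (crossAt k N) 0 a c * symm k (crossAt k N) 0 s = pair k (crossAt k N) 0 a c :=
    mul_symm_eq k fun _ _ _ => H.pair_mul_gen (by omega) (by omega) (by omega) (by omega)
  have e₂ : symm k (crossAt k N) (s + p + q) t * pair k (crossAt k N) 0 b d =
      pair k (crossAt k N) 0 b d :=
    symm_mul_eq k fun _ _ _ => H.gen_mul_pair (by omega) (by omega) (by omega) (by omega)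
  have e₃ : ∀ i j, symm k (crossAt k N) 0 i * symm k (crossAt k N) i j =
      pair k (crossAt k N) 0 i j := fun i j => by rw [pair, zero_add]
  have e₄ : c.choose q = c.choose t := by
    rw [← hc, Nat.choose_symm_add]
  rw [e₃, e₃, mul_assoc _ _ (pair k _ 0 b d), mul_assoc _ _ (pair k _ 0 b d), e₂, ← mul_assoc,
    ← mul_assoc, e₁, e₄, Nat.cast_mul]

theorem thinning_mul_pair {a b : ℕ} (h : weight u = N) (h' : weight (strand a ++ strand b) = N)
    (f : (⟨u⟩ : ReducedAW k) ⟶ ⟨strand a ++ strand b⟩) :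
    thinning h h' f * pair k (crossAt k N) 0 a b = thinning h h' f := by
  rw [← thinning_id h', ← thinning_comp, Category.comp_id]

theorem pair_mul_thinning {a b : ℕ} (h : weight u = N) (h' : weight (strand a ++ strand b) = N)
    (f : (⟨strand a ++ strand b⟩ : ReducedAW k) ⟶ ⟨u⟩) :
    pair k (crossAt k N) 0 a b * thinning h' h f = thinning h' h f := by
  rw [← thinning_id h', ← thinning_comp, Category.id_comp]

/-- The crossing of two thick strands in terms of crossings of thin strands. -/
theorem thinning_cross (a b : ℕ) (h : weight (strand a ++ strand b) = a + b)
    (h' : weight (strand b ++ strand a) = a + b) :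
    thinning h h' (homMk (ReducedRel k) (cross k _ a b)) =
      pair k (crossAt k (a + b)) 0 a b * block (crossAt k (a + b)) 0 a b := by
  induction a using Nat.strong_induction_on generalizing b with
  | _ a ih =>
  rcases Nat.eq_zero_or_pos a with rfl | ha
  · rw [block_zero, mul_one, ← thinning_id h]
    exact thinning_congr _ _ _ _ (crossHom_zero_left b)
  rcases Nat.eq_zero_or_pos b with rfl | hb
  · rw [block_zero_right, mul_one, ← thinning_id h]
    exact thinning_congr _ _ _ _ (crossHom_zero_right a)
  have H := thin_rel k (a + b)
  set T : ℕ → ThinEnd k (a + b) := fun s =>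
    if s = 0 then thinning h h' (homMk (ReducedRel k) (cross k _ a b)) else
      ((a.choose s * b.choose s : ℕ) : k) • (pair k (crossAt k (a + b)) 0 a b *
        block (crossAt k (a + b)) (0 + s) (a - s) (b - s) * pair k (crossAt k (a + b)) 0 b a)
    with hT
  have e₁ := thickId_eq_sum (k := k) (a := a) (b := b) (c := b) (d := a) ha hb hb ha
    (add_comm a b) T (min a b + 1) rfl ?_ (fun s h₁ h₂ h₃ => by omega)
  · have e₂ := H.double_coset (k := k) (i := 0) (a := a) (b := b) (by omega)
    rw [← thickId_eq] at e₂
    have e₃ : ∑ t ∈ Finset.range (b + 1), ((a.choose t * b.choose t : ℕ) : k) •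
        (pair k (crossAt k (a + b)) 0 a b * block (crossAt k (a + b)) (0 + t) (a - t) (b - t) *
          pair k (crossAt k (a + b)) 0 b a) =
        ∑ t ∈ Finset.range (min a b + 1), ((a.choose t * b.choose t : ℕ) : k) •
        (pair k (crossAt k (a + b)) 0 a b * block (crossAt k (a + b)) (0 + t) (a - t) (b - t) *
          pair k (crossAt k (a + b)) 0 b a) := by
      refine (Finset.sum_subset (Finset.range_mono (by omega)) fun t h₁ h₂ => ?_).symm
      rw [Finset.mem_range] at h₁ h₂
      rw [Nat.choose_eq_zero_of_lt (by omega : a < t), zero_mul, Nat.cast_zero, zero_smul]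
    have e₄ : (a + b).choose b = (a + b).choose a := Nat.choose_symm_add.symm
    -- Merge-split and the double coset formula expand the same multiple of the symmetrizer. Their
    -- summands of positive index agree by the induction hypothesis, so those of index zero, where
    -- the full crossing occurs, agree as well.
    rw [e₃, ← e₄, e₁, Finset.sum_range_succ', Finset.sum_range_succ' _ (min a b)] at e₂
    have e₅ := add_left_cancel e₂
    rw [hT] at e₅
    simp only [if_true, Nat.choose_zero_right, mul_one, Nat.cast_one, one_smul, Nat.sub_zero,
      add_zero] at e₅
    rw [e₅, H.pair_mul_block (by omega)]
  · intro s t h₁ h₂ h₃ h₄ h₅ h₆ h₇ hu hv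
    obtain rfl : t = s := by omega
    rw [thinning_exchange_eq (a := a) (b := b) (c := b) (d := a) (by omega) (by omega)
      (by omega) (by omega) (by omega) _ (weight_strand_append _ _)
      ((weight_strand_append _ _).trans (add_comm _ _))]
    rcases Nat.eq_zero_or_pos t with rfl | ht
    · simp only [hT, if_true, Nat.choose_zero_right, mul_one, Nat.cast_one, one_smul]
      exact (congrArg (fun x => pair k (crossAt k (a + b)) 0 a b * x *
        pair k (crossAt k (a + b)) 0 b a) (emb_self _ _)).trans (by
          rw [mul_assoc]
          exact (congrArg _ (thinning_mul_pair h h' (homMk _ (cross k _ a b)))).trans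
            (pair_mul_thinning h' h _))
    · rw [ih (a - t) (by omega) (b - t), map_mul, emb_pair _ le_rfl, emb_block _ le_rfl, hT]
      simp only [if_neg ht.ne', zero_add]
      congr 2
      rw [← mul_assoc, mul_pair_eq k fun _ _ _ _ =>
        H.pair_mul_gen (by omega) (by omega) (by omega) (by omega)]

end relations

end AffineWeb

/-! ## Functors between presented categories -/

namespace StrictPresentation

section functor

variable {k : Type u} {Γ : Type} {G G' : List Γ → List Γ → Type}

/-- Substitution of expressions for the generating morphisms. -/
def Expr.bind (F : ∀ a b, G a b → Expr k G' a b) : ∀ {a b : List Γ}, Expr k G a b → Expr k G' a b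
  | _, _, .gen g => F _ _ g
  | _, _, .id a => .id a
  | _, _, .comp f g => .comp (f.bind F) (g.bind F)
  | _, _, .tensor f g => .tensor (f.bind F) (g.bind F)
  | _, _, .zero a b => .zero a b
  | _, _, .add f g => .add (f.bind F) (g.bind F)
  | _, _, .smul r f => .smul r (f.bind F)

theorem Expr.bind_cast (F : ∀ a b, G a b → Expr k G' a b) {a a' b b' : List Γ} (h : a = a')
    (h' : b = b') (f : Expr k G a b) : (f.cast h h').bind F = (f.bind F).cast h h' := by
  subst h h'
  rfl

theorem Expr.bind_list_sum (F : ∀ a b, G a b → Expr k G' a b) {a b : List Γ} (n : ℕ)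
    (f : ℕ → Expr k G a b) :
    (((List.range n).map f).sum).bind F = ((List.range n).map fun i => (f i).bind F).sum := by
  have : ∀ l : List ℕ, ((l.map f).sum).bind F = (l.map fun i => (f i).bind F).sum := by
    intro l
    induction l with
    | nil => rfl
    | cons i l ih =>
      rw [List.map_cons, List.sum_cons, List.map_cons, List.sum_cons, ← ih]
      rfl
  exact this _

variable [CommRing k] {R : ∀ a b : List Γ, Expr k G a b → Expr k G a b → Prop}
  {R' : ∀ a b : List Γ, Expr k G' a b → Expr k G' a b → Prop}

theorem Cong.bind (F : ∀ a b, G a b → Expr k G' a b)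
    (hF : ∀ a b f g, R a b f g → Cong R' (f.bind F) (g.bind F)) {a b : List Γ}
    {f g : Expr k G a b} (h : Cong R f g) : Cong R' (f.bind F) (g.bind F) := by
  induction h with
  | rel h => exact hF _ _ _ _ h
  | refl f => exact .refl _
  | symm _ ih => exact .symm ih
  | trans _ _ ih₁ ih₂ => exact .trans ih₁ ih₂
  | comp_congr _ _ ih₁ ih₂ => exact .comp_congr ih₁ ih₂
  | tensor_congr _ _ ih₁ ih₂ => exact .tensor_congr ih₁ ih₂
  | add_congr _ _ ih₁ ih₂ => exact .add_congr ih₁ ih₂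
  | smul_congr r _ ih => exact .smul_congr r ih
  | id_comp f => exact .id_comp _
  | comp_id f => exact .comp_id _
  | comp_assoc f g h => exact .comp_assoc _ _ _
  | tensor_id a b => exact .tensor_id a b
  | tensor_comp f g f' g' => exact .tensor_comp _ _ _ _
  | tensor_assoc f g h =>
    rw [Expr.bind_cast]
    exact .tensor_assoc _ _ _
  | unit_tensor f =>
    rw [Expr.bind_cast]
    exact .unit_tensor _
  | tensor_unit f =>
    rw [Expr.bind_cast]
    exact .tensor_unit _
  | add_assoc f g h => exact .add_assoc _ _ _
  | add_comm f g => exact .add_comm _ _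
  | zero_add f => exact .zero_add _
  | one_smul f => exact .one_smul _
  | mul_smul r s f => exact .mul_smul r s _
  | smul_add r f g => exact .smul_add r _ _
  | add_smul r s f => exact .add_smul r s _
  | zero_smul f => exact .zero_smul _
  | add_comp f f' g => exact .add_comp _ _ _
  | comp_add f g g' => exact .comp_add _ _ _
  | smul_comp r f g => exact .smul_comp r _ _
  | comp_smul r f g => exact .comp_smul r _ _
  | add_tensor f f' g => exact .add_tensor _ _ _
  | tensor_add f g g' => exact .tensor_add _ _ _
  | smul_tensor r f g => exact .smul_tensor r _ _
  | tensor_smul r f g => exact .tensor_smul r _ _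

namespace PresCat

theorem cong_of_homMk_eq {a b : List Γ} {f g : Expr k G a b} (h : homMk R f = homMk R g) :
    Cong R f g := Quotient.exact (s := congSetoid R a b) h

/-- The functor given by a substitution that respects the defining relations. -/
def bindFunctor (F : ∀ a b, G a b → Expr k G' a b)
    (hF : ∀ a b f g, R a b f g → Cong R' (f.bind F) (g.bind F)) : PresCat R ⥤ PresCat R' where
  obj X := ⟨X.word⟩
  map {X Y} f := Quotient.map (sa := congSetoid R X.word Y.word)
    (sb := congSetoid R' X.word Y.word) (Expr.bind F) (fun _ _ h => h.bind F hF) f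
  map_id X := rfl
  map_comp f g := by
    obtain ⟨f, rfl⟩ := homMk_surj f
    obtain ⟨g, rfl⟩ := homMk_surj g
    rfl

variable (F : ∀ a b, G a b → Expr k G' a b)
  (hF : ∀ a b f g, R a b f g → Cong R' (f.bind F) (g.bind F))

instance : (bindFunctor F hF).Additive where
  map_add {X Y f g} := by
    obtain ⟨f, rfl⟩ := homMk_surj f
    obtain ⟨g, rfl⟩ := homMk_surj g
    rfl

instance : (bindFunctor F hF).Linear k where
  map_smul f r := by
    obtain ⟨f, rfl⟩ := homMk_surj f
    rfl

/-- The strict monoidal structure on `bindFunctor`. -/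
def bindFunctorCore : (bindFunctor F hF).CoreMonoidal where
  εIso := Iso.refl (⟨[]⟩ : PresCat R')
  μIso X Y := Iso.refl (⟨X.word ++ Y.word⟩ : PresCat R')
  μIso_hom_natural_left f Z := by
    obtain ⟨f, rfl⟩ := homMk_surj f
    exact (Category.comp_id _).trans (Category.id_comp _).symm
  μIso_hom_natural_right Z f := by
    obtain ⟨f, rfl⟩ := homMk_surj f
    exact (Category.comp_id _).trans (Category.id_comp _).symm
  associativity X Y Z := by
    -- Every structure morphism on either side is an identity along an equality of words, so
    -- coherence amounts to the functor preserving `eqToHom`.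
    have e : (α_ X Y Z).hom = eqToHom (PresCat.ext (List.append_assoc X.word Y.word Z.word)) := rfl
    rw [e, eqToHom_map]
    refine Eq.trans (b := eqToHom
      (PresCat.ext (List.append_assoc X.word Y.word Z.word))) ?_ (Eq.symm ?_)
    · exact (congrArg (· ≫ 𝟙 _ ≫ eqToHom _) (tensorMap_id _ _)).trans
        ((Category.id_comp _).trans (Category.id_comp _))
    · exact (congrArg (fun f => eqToHom _ ≫ f ≫ 𝟙 _) (tensorMap_id _ _)).trans
        ((congrArg _ (Category.id_comp _)).trans (Category.comp_id _))
  left_unitality X := by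
    have e : (λ_ X).hom = eqToHom (PresCat.ext (List.nil_append X.word)) := rfl
    rw [e, eqToHom_map]
    exact ((congrArg (· ≫ 𝟙 _ ≫ eqToHom _) (tensorMap_id _ _)).trans
      ((Category.id_comp _).trans (Category.id_comp _))).symm
  right_unitality X := by
    have e : (ρ_ X).hom = eqToHom (PresCat.ext (List.append_nil X.word)) := rfl
    rw [e, eqToHom_map]
    exact ((congrArg (· ≫ 𝟙 _ ≫ eqToHom _) (tensorMap_id _ _)).trans
      ((Category.id_comp _).trans (Category.id_comp _))).symm

instance : (bindFunctor F hF).Monoidal := (bindFunctorCore F hF).toMonoidal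

/-- A composite of substitutions is determined by its values on generating morphisms, by induction
on expressions. -/
theorem bindFunctor_comp_eq_id (F' : ∀ a b, G' a b → Expr k G a b)
    (hF' : ∀ a b f g, R' a b f g → Cong R (f.bind F') (g.bind F'))
    (h : ∀ a b (g : G a b), Cong R ((F a b g).bind F') (.gen g)) :
    bindFunctor F hF ⋙ bindFunctor F' hF' = 𝟭 (PresCat R) := by
  have key : ∀ {a b : List Γ} (f : Expr k G a b), Cong R ((f.bind F).bind F') f := by
    intro a b f
    induction f with
    | gen g => exact h _ _ g
    | id a => exact .refl _
    | comp f g ih₁ ih₂ => exact .comp_congr ih₁ ih₂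
    | tensor f g ih₁ ih₂ => exact .tensor_congr ih₁ ih₂
    | zero a b => exact .refl _
    | add f g ih₁ ih₂ => exact .add_congr ih₁ ih₂
    | smul r f ih => exact .smul_congr r ih
  refine CategoryTheory.Functor.ext (fun X => rfl) fun X Y f => ?_
  obtain ⟨f, rfl⟩ := homMk_surj f
  exact (homMk_eq (key f)).trans ((Category.id_comp _).trans (Category.comp_id _)).symm

end PresCat

end functor

end StrictPresentation

/-! ## Substituting for the dots -/

namespace AffineWeb

open StrictPresentation StrictPresentation.PresCat

section substitution

variable {k : Type u} {D D' : Set ℕ+}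

/-- The substitution which keeps merges, splits and crossings and replaces the dots. -/
def dotSubst (d : ∀ a : ℕ+, a ∈ D → Expr k (Gen D') [a] [a]) :
    ∀ X Y : List ℕ+, Gen D X Y → Expr k (Gen D') X Y
  | _, _, .merge a b => .gen (.merge a b)
  | _, _, .split a b => .gen (.split a b)
  | _, _, .cross a b => .gen (.cross a b)
  | _, _, .dot a h => d a h

variable (d : ∀ a : ℕ+, a ∈ D → Expr k (Gen D') [a] [a])

theorem bind_merge : ∀ a b : ℕ, (merge k D a b).bind (dotSubst d) = merge k D' a b
  | 0, b => Expr.bind_cast (a' := strand b) (b' := strand (0 + b)) (dotSubst d) rfl (by rw [Nat.zero_add])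
      (Expr.id (strand b))
  | _ + 1, 0 => rfl
  | _ + 1, _ + 1 => rfl

theorem bind_split : ∀ a b : ℕ, (split k D a b).bind (dotSubst d) = split k D' a b
  | 0, b => Expr.bind_cast (a' := strand (0 + b)) (b' := strand b) (dotSubst d) (by rw [Nat.zero_add]) rfl
      (Expr.id (strand b))
  | _ + 1, 0 => rfl
  | _ + 1, _ + 1 => rfl

theorem bind_cross : ∀ a b : ℕ, (cross k D a b).bind (dotSubst d) = cross k D' a b
  | 0, b => Expr.bind_cast (a' := strand b) (b' := strand b ++ []) (dotSubst d) rfl (List.append_nil _).symm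
      (Expr.id (strand b))
  | _ + 1, 0 => rfl
  | _ + 1, _ + 1 => rfl

theorem bind_exchange (s p q t : ℕ)
    (m : Expr k (Gen D) (strand p ++ strand q) (strand q ++ strand p)) :
    (exchange s p q t m).bind (dotSubst d) = exchange s p q t (m.bind (dotSubst d)) := by
  simp only [exchange, Expr.bind, bind_merge, bind_split, Expr.bind_cast]

theorem bind_fullSplit (n : ℕ) : (fullSplit k D n).bind (dotSubst d) = fullSplit k D' n := by
  induction n with
  | zero => rfl
  | succ n ih => simp only [fullSplit, Expr.bind, Expr.bind_cast, bind_split, ih]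

theorem bind_fullMerge (n : ℕ) : (fullMerge k D n).bind (dotSubst d) = fullMerge k D' n := by
  induction n with
  | zero => rfl
  | succ n ih =>
    have e := Expr.bind_cast (dotSubst d) (rfl : strand 1 ++ strand n = strand 1 ++ strand n)
      (by rw [Nat.add_comm] : strand (1 + n) = strand (n + 1)) (merge k D 1 n)
    rw [bind_merge] at e
    exact congrArg₂ Expr.comp (congrArg (Expr.tensor (Expr.id [1])) ih) e

theorem bind_smul (r : k) {X Y : List ℕ+} (f : Expr k (Gen D) X Y) :
    (r • f).bind (dotSubst d) = r • f.bind (dotSubst d) := rfl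

theorem bind_dite {p : Prop} [Decidable p] {X Y : List ℕ+} (f : p → Expr k (Gen D) X Y) :
    (if h : p then f h else 0).bind (dotSubst d) =
      if h : p then (f h).bind (dotSubst d) else 0 := by
  split_ifs <;> rfl

/-- No web relation contains a dot, so each is carried to the relation of the same shape. -/
theorem WebRel.bind {k : Type u} [CommRing k] (d : ∀ a : ℕ+, a ∈ D → Expr k (Gen D') [a] [a])
    {X Y : List ℕ+} {f g : Expr k (Gen D) X Y} (h : WebRel k D X Y f g) :
    WebRel k D' X Y (f.bind (dotSubst d)) (g.bind (dotSubst d)) := by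
  cases h with
  | merge_assoc a b c ha hb hc =>
    simp only [Expr.bind, bind_merge, Expr.bind_cast]
    exact .merge_assoc a b c ha hb hc
  | split_assoc a b c ha hb hc =>
    simp only [Expr.bind, bind_split, Expr.bind_cast]
    exact .split_assoc a b c ha hb hc
  | merge_split a b c d ha hb hc hd h =>
    simp only [Expr.bind, bind_merge, bind_split, Expr.bind_cast, Expr.bind_list_sum, bind_dite,
      bind_exchange, bind_cross]
    exact .merge_split a b c d ha hb hc hd h
  | digon a b ha hb =>
    have h := WebRel.digon (k := k) (D := D') a b ha hb
    rw [← bind_merge d, ← bind_split d] at h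
    exact h

end substitution

/-! ## Exchange diagrams with degenerate strands -/

section degenerate

variable {k : Type u} [CommRing k] {D : Set ℕ+}
  {R : ∀ X Y : List ℕ+, Expr k (Gen D) X Y → Expr k (Gen D) X Y → Prop}

/-- Used when the outer splits and merges all involve a strand of thickness zero. For `a = b = 1`
this covers both summands of the dot-crossing relations: `s = t = 0` and `p = q = 0`. -/
theorem homMk_exchange_same {s p q t : ℕ}
    (m : Expr k (Gen D) (strand p ++ strand q) (strand q ++ strand p))
    {X Y : List ℕ+} {f : (⟨X⟩ : PresCat R) ⟶ ⟨Y⟩} {X' Y' : List ℕ+}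
    (hf : Same (tens (tens (𝟙 (⟨strand s⟩ : PresCat R)) (homMk R m)) (𝟙 (⟨strand t⟩ : PresCat R))) f)
    (h : Same (homMk R ((split k D s p).tensor (split k D q t))) (𝟙 (⟨X'⟩ : PresCat R)))
    (h' : Same (homMk R ((merge k D s q).tensor (merge k D p t))) (𝟙 (⟨Y'⟩ : PresCat R))) :
    Same (homMk R (exchange s p q t m)) f :=
  (Same.comp_id (g := homMk R ((merge k D s q).tensor (merge k D p t))) h').trans
    ((Same.id_comp (f := homMk R ((split k D s p).tensor (split k D q t))) h).trans
      ((homMk_cast_same _ _ _).trans hf))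

theorem homMk_exchange_zero (p q : ℕ)
    (m : Expr k (Gen D) (strand p ++ strand q) (strand q ++ strand p)) :
    Same (homMk R (exchange 0 p q 0 m)) (homMk R m) := by
  refine homMk_exchange_same m (X' := strand p ++ strand q) (Y' := strand q ++ strand p)
    ((tens_one _).trans (id_tens _)) ?_ ?_
  · exact ((homMk_split_zero_left p).tens (homMk_split_zero_right q)).trans (.of_eq (tens_id _ _))
  · exact ((homMk_merge_zero_left q).tens (homMk_merge_zero_right p)).trans (.of_eq (tens_id _ _))

theorem homMk_exchange_unit (s t : ℕ)
    (m : Expr k (Gen D) (strand 0 ++ strand 0) (strand 0 ++ strand 0)) {X : List ℕ+}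
    (hm : Same (homMk R m) (𝟙 (⟨X⟩ : PresCat R))) (hX : X = []) :
    Same (homMk R (exchange s 0 0 t m)) (𝟙 (⟨strand s ++ strand t⟩ : PresCat R)) := by
  subst hX
  refine homMk_exchange_same m (X' := strand s ++ strand t) (Y' := strand s ++ strand t) ?_ ?_ ?_
  · refine ((Same.tens (.refl _) hm).tens (.refl _)).trans ?_
    exact ((tens_one _).tens (.refl _)).trans (.of_eq (tens_id _ _))
  · exact ((homMk_split_zero_right s).tens (homMk_split_zero_left t)).trans (.of_eq (tens_id _ _))
  · exact ((homMk_merge_zero_right s).tens (homMk_merge_zero_left t)).trans (.of_eq (tens_id _ _))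

end degenerate

/-! ## From the reduced affine web category to the affine web category -/

section reduced_to_affine

variable (k : Type u) [Field k]

/-- The single dot of the reduced affine web category is sent to the thin dot. -/
def thinDotSubst : ∀ X Y : List ℕ+, Gen {1} X Y → Expr k (Gen Set.univ) X Y :=
  dotSubst fun a _ => .gen (.dot a trivial)

theorem exchange_sum_one_one {X Y : List ℕ+} (f : ℕ → Expr k (Gen Set.univ) X Y)
    {m₀ m₁ : (⟨X⟩ : AW k) ⟶ ⟨Y⟩} (h₀ : homMk (AffRel k) (f 0) = m₀)
    (h₁ : homMk (AffRel k) (f 1) = m₁) :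
    homMk (AffRel k) ((List.range (min 1 1 + 1)).map f).sum = m₀ + m₁ := by
  rw [homMk_list_sum, ← h₀, ← h₁]
  simp [List.range_succ]

/-- The dot relations go to the case `a = b = 1` of those for thick dots: index `t = 0` gives the
term in which the dot has slid through, and `t = 1` gives the identity. -/
theorem thinDotSubst_rel (X Y : List ℕ+) (f g : Expr k (Gen {1}) X Y) (h : ReducedRel k X Y f g) :
    Cong (AffRel k) (f.bind (thinDotSubst k)) (g.bind (thinDotSubst k)) := by
  cases h with
  | web h => exact .rel (.web (h.bind _))
  | cross_dot =>
    refine cong_of_homMk_eq ((homMk_eq (Cong.rel (AffRel.cross_dot 1 1 one_pos one_pos))).trans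
      ((exchange_sum_one_one k (X := strand 1 ++ strand 1)
        (Y := strand 1 ++ strand 1) _ (m₀ := homMk _ (((Expr.id (strand 1)).tensor (omega k 1)).comp (cross k _ 1 1)))
        (m₁ := 𝟙 _) ?_ ?_).trans rfl))
    · rw [dif_pos (by omega), homMk_smul, Nat.factorial_zero, Nat.cast_one, one_smul]
      exact ((homMk_cast_same _ _ _).trans (homMk_exchange_zero _ _ _)).eq
    · rw [dif_pos (by omega), homMk_smul, Nat.factorial_one, Nat.cast_one, one_smul]
      refine ((homMk_cast_same _ _ _).trans (homMk_exchange_unit (X := []) 1 1 _ ?_ rfl)).eq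
      exact .of_eq ((Category.comp_id (tens (𝟙 (⟨[]⟩ : AW k)) (𝟙 (⟨[]⟩ : AW k)))).trans
        (tens_id [] []))
  | dot_cross =>
    refine cong_of_homMk_eq ((homMk_eq (Cong.rel (AffRel.dot_cross 1 1 one_pos one_pos))).trans
      ((exchange_sum_one_one k (X := strand 1 ++ strand 1)
        (Y := strand 1 ++ strand 1) _ (m₀ := homMk _ ((cross k _ 1 1).comp ((Expr.id (strand 1)).tensor (omega k 1))))
        (m₁ := 𝟙 _) ?_ ?_).trans rfl))
    · rw [dif_pos (by omega), homMk_smul, Nat.factorial_zero, Nat.cast_one, one_smul]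
      exact ((homMk_cast_same _ _ _).trans (homMk_exchange_zero _ _ _)).eq
    · rw [dif_pos (by omega), homMk_smul, Nat.factorial_one, Nat.cast_one, one_smul]
      refine ((homMk_cast_same _ _ _).trans (homMk_exchange_unit (X := []) 1 1 _ ?_ rfl)).eq
      exact .of_eq ((Category.id_comp (tens (𝟙 (⟨[]⟩ : AW k)) (𝟙 (⟨[]⟩ : AW k)))).trans
        (tens_id [] []))

end reduced_to_affine

end AffineWeb

/-! ## From the affine web category to the reduced affine web category -/

namespace AffineWeb

open StrictPresentation StrictPresentation.PresCat SymRing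

section thick_dots

variable {k : Type u} [Field k] [CharZero k] {N : ℕ} {u v : List ℕ+}

theorem cong_of_thinning_eq (hu : weight u = N) (hv : weight v = N)
    {f g : Expr k (Gen {1}) u v}
    (h : thinning hu hv (homMk (ReducedRel k) f) = thinning hu hv (homMk (ReducedRel k) g)) :
    Cong (ReducedRel k) f g :=
  cong_of_homMk_eq (thinning_injective hu hv h)

theorem thinning_fullMergeHom (n : ℕ) :
    thinning (weight_thin n) (weight_strand n) (fullMergeHom k n) = symm k (crossAt k n) 0 n := by
  rw [← thickId_eq]
  refine ((thinning_same _ _ _).trans (Same.trans (Same.smul _ ?_) (thinning_same _ _ _).symm)).eq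
  rw [Category.id_comp]
  refine (Same.id_comp (wordMerge_thin k n)).trans ?_
  exact (wordMerge_strand k n).symm.comp (.refl _)

theorem thinning_fullSplitHom (n : ℕ) :
    thinning (weight_strand n) (weight_thin n) (fullSplitHom k n) =
      (n.factorial : k) • symm k (crossAt k n) 0 n := by
  rw [← thickId_eq]
  refine ((thinning_same _ _ _).trans (Same.trans ?_ ((thinning_same _ _ _).smul _).symm)).eq
  rw [wordFactorial_thin, wordFactorial_strand, smul_smul,
    mul_inv_cancel₀ (Nat.cast_ne_zero.2 n.factorial_ne_zero), Nat.cast_one, inv_one,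
    Category.id_comp]
  refine Same.smul _ ((Same.refl _).comp ?_)
  exact (Same.comp_id (wordSplit_thin k n)).trans (wordSplit_strand k n).symm

theorem homMk_thinDots {k : Type u} [Field k] (n : ℕ) :
    homMk (ReducedRel k) (thinDots k _ (Set.mem_singleton 1) n) = dots (dotAt k n) 0 n := by
  induction n with
  | zero => rfl
  | succ n ih =>
    have e := (emb_mul_emb_same (add_comm 1 n) (dotHom k)
      (homMk (ReducedRel k) (thinDots k _ (Set.mem_singleton 1) n))).eq
    refine e.symm.trans ?_
    have e₀ : dotAt k (n + 1) 0 = emb 0 (by omega) (dotHom k) := dif_pos _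
    rw [dots_succ, e₀]
    refine congrArg _ ((congrArg _ ih).trans ?_)
    exact map_dots (emb 1 (by omega)) _ 0 1 n fun l _ _ => emb_dotAt _ (by omega)

theorem commute_dots_symm {i n j m : ℕ} (h : i + n ≤ N) (h' : j + m ≤ N)
    (hij : ∀ l, j ≤ l → l + 1 < j + m → l + 1 ≠ i ∧ l + 1 ≠ i + n) :
    Commute (dots (dotAt k N) i n) (symm k (crossAt k N) j m) :=
  commute_symm k fun l h₁ h₂ => (thin_dotRel k N).commute_dots_gen (by omega) h
    (hij l h₁ h₂).1 (hij l h₁ h₂).2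

/-- The factorial comes from the normalisation of the full split. The dots commute with the
symmetrizer, so the symmetrizers of the split and of the merge fuse into one. -/
theorem thinning_balloon (n : ℕ) :
    thinning (weight_strand n) (weight_strand n)
        (homMk (ReducedRel k) (balloon k _ (Set.mem_singleton 1) n)) =
      (n.factorial : k) • (symm k (crossAt k n) 0 n * dots (dotAt k n) 0 n) := by
  have e : homMk (ReducedRel k) (balloon k _ (Set.mem_singleton 1) n) =
      (fullSplitHom k n ≫ homMk _ (thinDots k _ (Set.mem_singleton 1) n)) ≫ fullMergeHom k n := rfl
  rw [e, thinning_comp _ (weight_thin n), thinning_comp _ (weight_thin n), thinning_fullSplitHom,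
    thinning_fullMergeHom]
  have e' := thinning_thin (weight_thin n) (weight_thin n)
    (homMk (ReducedRel k) (thinDots k _ (Set.mem_singleton 1) n))
  rw [e', homMk_thinDots, smul_mul_assoc, smul_mul_assoc, mul_assoc,
    (commute_dots_symm (by omega) (by omega) fun l _ _ => by omega).eq, ← mul_assoc,
    (thin_rel k n).symm_mul_symm k le_rfl le_rfl (by omega)]

variable (k) in
/-- The dot on a thick strand is sent to a multiple of the dotted balloon. -/
def balloonSubst : ∀ X Y : List ℕ+, Gen Set.univ X Y → Expr k (Gen {1}) X Y :=
  dotSubst fun a _ => ((a : ℕ).factorial : k)⁻¹ •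
    (balloon k _ (Set.mem_singleton 1) a).cast (strand_coe a) (strand_coe a)

variable (k) in
/-- The image of the dot on a strand of thickness `n`. -/
def thickDot (n : ℕ) : (⟨strand n⟩ : ReducedAW k) ⟶ ⟨strand n⟩ :=
  homMk _ ((omega k n).bind (balloonSubst k))

theorem thinning_thickDot (n : ℕ) :
    thinning (weight_strand n) (weight_strand n) (thickDot k n) =
      symm k (crossAt k n) 0 n * dots (dotAt k n) 0 n := by
  cases n with
  | zero =>
    rw [symm_zero, dots_zero, mul_one]
    exact thickId_zero
  | succ n =>
    have e : Same (thickDot k (n + 1)) (((n + 1).factorial : k)⁻¹ •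
        homMk (ReducedRel k) (balloon k _ (Set.mem_singleton 1) (n + 1))) :=
      Same.smul _ (homMk_cast_same _ _ _)
    rw [thinning_congr _ _ (weight_strand _) (weight_strand _) e, map_smul, thinning_balloon, smul_smul,
      inv_mul_cancel₀ (Nat.cast_ne_zero.2 (n + 1).factorial_ne_zero), one_smul]

theorem emb_thinning_thickDot {i n : ℕ} (h : i + n ≤ N) :
    emb i h (thinning (weight_strand n) (weight_strand n) (thickDot k n)) =
      symm k (crossAt k N) i n * dots (dotAt k N) i n := by
  rw [thinning_thickDot, map_mul, map_symm k (emb i h) _ (crossAt k N) 0 i n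
      fun l _ _ => emb_crossAt _ (by omega), map_dots (emb i h) (dotAt k N) 0 i n
      fun l _ _ => emb_dotAt _ (by omega), add_zero]

/-- The balloon on a thin strand is the dot itself; this is why going to the affine category and
back fixes the generating dot. -/
theorem thickDot_one : thickDot k 1 = dotHom k := by
  have e := thinning_thickDot (k := k) 1
  rw [symm_one, one_mul, dots_succ, dots_zero, mul_one] at e
  refine (thinning_thin (N := 1) _ _ (thickDot k 1)).symm.trans (e.trans ?_)
  exact (dif_pos (by omega)).trans (emb_self _ _)

theorem commute_dots_pair {i n j a b : ℕ} (h : i + n ≤ N) (h' : j + a + b ≤ N)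
    (hij : ∀ l, j ≤ l → l + 1 < j + a + b → l + 1 ≠ j + a → l + 1 ≠ i ∧ l + 1 ≠ i + n) :
    Commute (dots (dotAt k N) i n) (pair k (crossAt k N) j a b) :=
  commute_pair k fun l h₁ h₂ h₃ => (thin_dotRel k N).commute_dots_gen (by omega) h
    (hij l h₁ h₂ h₃).1 (hij l h₁ h₂ h₃).2

theorem thinning_thickDot_tens_id {a b : ℕ} (h : weight (strand b ++ strand a) = N) :
    thinning h h (tens (thickDot k b) (𝟙 (⟨strand a⟩ : ReducedAW k))) =
      dots (dotAt k N) 0 b * pair k (crossAt k N) 0 b a := by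
  have h' := (weight_strand_append b a).symm.trans h
  have e : thinning (weight_strand a) (weight_strand a) (𝟙 (⟨strand a⟩ : ReducedAW k)) =
    thickId k a := rfl
  rw [thinning_tens (weight_strand b) (weight_strand b) (weight_strand a) (weight_strand a) h',
    emb_thinning_thickDot, e, emb_thickId, pair, zero_add,
    ← (commute_dots_symm (by omega) (by omega) fun l _ _ => by omega).eq, mul_assoc]

theorem thinning_id_tens_thickDot {a b : ℕ} (h : weight (strand a ++ strand b) = N) :
    thinning h h (tens (𝟙 (⟨strand a⟩ : ReducedAW k)) (thickDot k b)) =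
      pair k (crossAt k N) 0 a b * dots (dotAt k N) a b := by
  have h' := (weight_strand_append a b).symm.trans h
  have e : thinning (weight_strand a) (weight_strand a) (𝟙 (⟨strand a⟩ : ReducedAW k)) =
    thickId k a := rfl
  rw [thinning_tens (weight_strand a) (weight_strand a) (weight_strand b) (weight_strand b) h',
    emb_thinning_thickDot, e, emb_thickId, pair, zero_add, mul_assoc]

theorem thinning_thickDot_tens_thickDot (a b : ℕ) (h : weight (strand a ++ strand b) = a + b) :
    thinning h h (tens (thickDot k a) (thickDot k b)) =
      pair k (crossAt k (a + b)) 0 a b * dots (dotAt k (a + b)) 0 (a + b) := by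
  rw [thinning_tens (weight_strand a) (weight_strand a) (weight_strand b) (weight_strand b) rfl,
    emb_thinning_thickDot, emb_thinning_thickDot, pair, zero_add, dots_add, zero_add]
  have e := (commute_dots_symm (k := k) (N := a + b) (i := 0) (n := a) (j := a) (m := b) (by omega)
    (by omega) fun l _ _ => by omega).eq
  rw [mul_assoc, ← mul_assoc (dots _ _ _), e]
  simp only [mul_assoc]

theorem pair_mul_pair (H : Rel N (crossAt k N)) {i a b : ℕ} {j p q : ℕ} (h : i + a + b ≤ N)
    (h' : i ≤ j) (h₁ : j + p = i + a) (h₂ : j + p + q ≤ i + a + b) :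
    pair k (crossAt k N) i a b * pair k (crossAt k N) j p q = pair k (crossAt k N) i a b :=
  mul_pair_eq k fun _ _ _ _ => H.pair_mul_gen (by omega) (by omega) (by omega) (by omega)

theorem thinning_thickDot_cross {p q : ℕ} (h : weight (strand p ++ strand q) = p + q)
    (h' : weight (strand q ++ strand p) = p + q) :
    thinning h h' (tens (𝟙 (⟨strand p⟩ : ReducedAW k)) (thickDot k q) ≫
        homMk (ReducedRel k) (cross k _ p q)) =
      pair k (crossAt k (p + q)) 0 p q *
        (dots (dotAt k (p + q)) p q * block (crossAt k (p + q)) 0 p q) := by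
  rw [thinning_comp h h h', thinning_id_tens_thickDot, thinning_cross, mul_assoc,
    ← mul_assoc (dots _ _ _), (commute_dots_pair (k := k) (N := p + q) (by omega) (by omega)
      fun l _ _ _ => by omega).eq, mul_assoc (pair k _ _ _ _), ← mul_assoc (pair k _ _ _ _),
    pair_mul_pair (thin_rel k _) (by omega) le_rfl rfl le_rfl]

theorem thinning_cross_thickDot {p q : ℕ} (h : weight (strand p ++ strand q) = p + q)
    (h' : weight (strand q ++ strand p) = p + q) :
    thinning h h' (homMk (ReducedRel k) (cross k _ p q) ≫
        tens (𝟙 (⟨strand q⟩ : ReducedAW k)) (thickDot k p)) =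
      pair k (crossAt k (p + q)) 0 p q *
        (block (crossAt k (p + q)) 0 p q * dots (dotAt k (p + q)) q p) := by
  rw [thinning_comp h h' h', thinning_id_tens_thickDot, thinning_cross, ← mul_assoc,
    (thin_rel k _).pair_mul_block (by omega), mul_assoc]

end thick_dots

end AffineWeb

/-! ### The defining relations of thick dots hold for the balloons. -/

namespace AffineWeb

open StrictPresentation StrictPresentation.PresCat SymRing

section affine_to_reduced

variable {k : Type u} [Field k] [CharZero k] {N : ℕ} {u v : List ℕ+}

theorem bind_thinDot : homMk (ReducedRel k)
    ((thinDot k _ (Set.mem_univ 1)).bind (balloonSubst k)) = dotHom k :=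
  thickDot_one

theorem bind_balloon (n : ℕ) : homMk (ReducedRel k)
    ((balloon k _ (Set.mem_univ 1) n).bind (balloonSubst k)) =
      homMk _ (balloon k _ (Set.mem_singleton 1) n) := by
  have h : ∀ n, homMk (ReducedRel k) ((thinDots k _ (Set.mem_univ 1) n).bind (balloonSubst k)) =
      homMk _ (thinDots k _ (Set.mem_singleton 1) n) := by
    intro n
    induction n with
    | zero => rfl
    | succ n ih => exact congrArg₂ tens bind_thinDot ih
  have h₁ : (fullSplit k Set.univ n).bind (balloonSubst k) = _ := bind_fullSplit _ n
  have h₂ : (fullMerge k Set.univ n).bind (balloonSubst k) = _ := bind_fullMerge _ n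
  simp only [balloon, Expr.bind, h₁, h₂]
  rw [homMk_comp, homMk_comp, h]
  rfl

theorem sum_range_min_eq {k : Type u} [Field k] {M : Type*} [AddCommGroup M] [Module k M] (a b : ℕ) (f : ℕ → M) :
    ∑ t ∈ Finset.range (min a b + 1),
        ((t.factorial * (a.choose t * b.choose t) : ℕ) : k) • f t =
      ∑ t ∈ Finset.range (b + 1), ((t.factorial * (a.choose t * b.choose t) : ℕ) : k) • f t := by
  refine Finset.sum_subset (Finset.range_mono (by omega)) fun t h₁ h₂ => ?_
  rw [Finset.mem_range] at h₁ h₂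
  rw [Nat.choose_eq_zero_of_lt (by omega : a < t), zero_mul, mul_zero, Nat.cast_zero, zero_smul]

theorem balloonSubst_cross_dot (a b : ℕ) (hu : weight (strand a ++ strand b) = a + b)
    (hv : weight (strand b ++ strand a) = a + b) :
    thinning hu hv (homMk (ReducedRel k) (cross k _ a b) ≫
        tens (thickDot k b) (𝟙 (⟨strand a⟩ : ReducedAW k))) =
      ∑ t ∈ Finset.range (b + 1), ((t.factorial * (a.choose t * b.choose t) : ℕ) : k) •
        (pair k (crossAt k (a + b)) 0 a b *
          (dots (dotAt k (a + b)) a (b - t) * block (crossAt k (a + b)) t (a - t) (b - t)) *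
          pair k (crossAt k (a + b)) 0 b a) := by
  have H := thin_dotRel k (a + b)
  have e := H.pair_mul_block_mul_dots (k := k) (i := 0) (a := a) (b := b) (by omega)
  simp only [zero_add] at e
  rw [← e, thinning_comp hu hv hv, thinning_cross, thinning_thickDot_tens_id]
  simp only [mul_assoc]

theorem balloonSubst_dot_cross (a b : ℕ) (hu : weight (strand b ++ strand a) = a + b)
    (hv : weight (strand a ++ strand b) = a + b) :
    thinning hu hv (tens (thickDot k b) (𝟙 (⟨strand a⟩ : ReducedAW k)) ≫
        homMk (ReducedRel k) (cross k _ b a)) =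
      ∑ t ∈ Finset.range (b + 1), ((t.factorial * (a.choose t * b.choose t) : ℕ) : k) •
        (pair k (crossAt k (a + b)) 0 b a *
          (block (crossAt k (a + b)) t (b - t) (a - t) * dots (dotAt k (a + b)) a (b - t)) *
          pair k (crossAt k (a + b)) 0 a b) := by
  have H := thin_dotRel k (a + b)
  have e := H.dots_mul_block_mul_pair (k := k) (i := 0) (a := a) (b := b) (by omega)
  simp only [zero_add] at e
  have e' : thinning hu hv (homMk (ReducedRel k) (cross k _ b a)) =
      pair k (crossAt k (a + b)) 0 b a * block (crossAt k (a + b)) 0 b a := by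
    -- The formula for the crossing from `(b, a)` lives on `b + a` strands; the number of strands is
    -- abstracted so that it can be replaced by this form.
    generalize a + b = n at hu hv
    obtain rfl := (weight_strand_append b a).symm.trans hu
    exact thinning_cross b a hu hv
  rw [← e, thinning_comp hu hu hv, e', thinning_thickDot_tens_id,
    (commute_dots_pair (k := k) (by omega) (by omega) fun l _ _ _ => by omega).eq,
    ← mul_assoc _ (dots _ _ _), ← (commute_dots_pair (k := k) (N := a + b) (i := 0) (n := b)
      (j := 0) (a := b) (b := a) (by omega) (by omega) fun l _ _ _ => by omega).eq]
  simp only [mul_assoc]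
  have e₁ := H.toRel.pair_mul_block (k := k) (i := 0) (a := b) (b := a) (by omega)
  rw [mul_assoc] at e₁
  rw [e₁, ← mul_assoc (pair k _ _ _ _) (pair k _ _ _ _),
    pair_mul_pair H.toRel (by omega) le_rfl rfl le_rfl]

/-- The binomials are those of the two splits. With the factor `t!` of the relation they give the
coefficient in `pair_mul_block_mul_dots`. -/
theorem thinning_exchange_thickDot_cross {a b t : ℕ} (hta : t ≤ a) (htb : t ≤ b)
    (h : strand (t + (a - t)) ++ strand (b - t + t) = strand a ++ strand b)
    (h' : strand (t + (b - t)) ++ strand (a - t + t) = strand b ++ strand a)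
    (hu : weight (strand a ++ strand b) = a + b) (hv : weight (strand b ++ strand a) = a + b) :
    thinning hu hv (homMk (ReducedRel k) ((exchange t (a - t) (b - t) t
        (((Expr.id (strand (a - t))).tensor ((omega k (b - t)).bind (balloonSubst k))).comp
          (cross k _ (a - t) (b - t)))).cast h h')) =
      ((a.choose t * b.choose t : ℕ) : k) • (pair k (crossAt k (a + b)) 0 a b *
        (dots (dotAt k (a + b)) a (b - t) * block (crossAt k (a + b)) t (a - t) (b - t)) *
          pair k (crossAt k (a + b)) 0 b a) := by
  have hm := weight_strand_append (a - t) (b - t)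
  have hm' := (weight_strand_append (b - t) (a - t)).trans (add_comm _ _)
  rw [thinning_exchange_eq (a := a) (b := b) (c := b) (d := a) (by omega) (by omega) (by omega)
    (by omega) (by omega) _ hm hm']
  have e := congrArg (emb t (by omega : t + (a - t + (b - t)) ≤ a + b))
    (thinning_thickDot_cross (k := k) hm hm')
  rw [map_mul, map_mul, emb_pair _ le_rfl, emb_block _ le_rfl,
    map_dots (emb t _) (dotAt k (a + b)) (a - t) t (b - t) fun l _ _ => emb_dotAt _ (by omega),
    Nat.add_sub_cancel' hta] at e
  refine congrArg _ ((congrArg (fun x => pair k (crossAt k (a + b)) 0 a b * x *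
    pair k (crossAt k (a + b)) 0 b a) e).trans ?_)
  rw [← mul_assoc (pair k _ _ _ _) (pair k _ _ _ _),
    pair_mul_pair (thin_rel k _) (by omega) (by omega) (by omega) (by omega)]

theorem thinning_exchange_cross_thickDot {a b t : ℕ} (hta : t ≤ a) (htb : t ≤ b)
    (h : strand (t + (b - t)) ++ strand (a - t + t) = strand b ++ strand a)
    (h' : strand (t + (a - t)) ++ strand (b - t + t) = strand a ++ strand b)
    (hu : weight (strand b ++ strand a) = a + b) (hv : weight (strand a ++ strand b) = a + b) :
    thinning hu hv (homMk (ReducedRel k) ((exchange t (b - t) (a - t) t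
        ((cross k _ (b - t) (a - t)).comp
          ((Expr.id (strand (a - t))).tensor ((omega k (b - t)).bind (balloonSubst k))))).cast
            h h')) =
      ((a.choose t * b.choose t : ℕ) : k) • (pair k (crossAt k (a + b)) 0 b a *
        (block (crossAt k (a + b)) t (b - t) (a - t) * dots (dotAt k (a + b)) a (b - t)) *
          pair k (crossAt k (a + b)) 0 a b) := by
  have hm := weight_strand_append (b - t) (a - t)
  have hm' := (weight_strand_append (a - t) (b - t)).trans (add_comm _ _)
  rw [thinning_exchange_eq (a := b) (b := a) (c := a) (d := b) (by omega) (by omega) (by omega)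
    (by omega) (by omega) _ hm hm', mul_comm (b.choose t)]
  have e := congrArg (emb t (by omega : t + (b - t + (a - t)) ≤ a + b))
    (thinning_cross_thickDot (k := k) hm hm')
  rw [map_mul, map_mul, emb_pair _ le_rfl, emb_block _ le_rfl,
    map_dots (emb t _) (dotAt k (a + b)) (a - t) t (b - t) fun l _ _ => emb_dotAt _ (by omega),
    Nat.add_sub_cancel' hta] at e
  refine congrArg _ ((congrArg (fun x => pair k (crossAt k (a + b)) 0 b a * x *
    pair k (crossAt k (a + b)) 0 a b) e).trans ?_)
  rw [← mul_assoc (pair k _ _ _ _) (pair k _ _ _ _),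
    pair_mul_pair (thin_rel k _) (by omega) (by omega) (by omega) (by omega)]

/-- The product of all dots commutes with the symmetrizer on `a + b` strands, which in turn absorbs
the symmetrizers on the two parts. -/
theorem balloonSubst_dot_split (a b : ℕ) :
    thickDot k (a + b) ≫ splitHom k a b =
      splitHom k a b ≫ tens (thickDot k a) (thickDot k b) := by
  have h := weight_strand_append a b
  have H := thin_rel k (a + b)
  refine thinning_injective (weight_strand _) h ?_
  rw [thinning_comp _ (weight_strand _), thinning_comp _ h, thinning_splitHom, thinning_thickDot,
    thinning_thickDot_tens_thickDot, thickId_eq, mul_smul_comm, smul_mul_assoc, mul_assoc,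
    (commute_dots_symm (k := k) (by omega) (by omega) fun l _ _ => by omega).eq, ← mul_assoc,
    ← mul_assoc, H.symm_mul_symm k le_rfl le_rfl (by omega), mul_pair_eq k fun _ _ _ _ =>
      H.symm_mul_gen k (by omega) (by omega) (by omega)]

theorem balloonSubst_merge_dot (a b : ℕ) :
    mergeHom k a b ≫ thickDot k (a + b) =
      tens (thickDot k a) (thickDot k b) ≫ mergeHom k a b := by
  have h := weight_strand_append a b
  have H := thin_rel k (a + b)
  refine thinning_injective h (weight_strand _) ?_
  rw [thinning_comp _ (weight_strand _), thinning_comp _ h, thinning_mergeHom, thinning_thickDot,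
    thinning_thickDot_tens_thickDot, thickId_eq, mul_assoc (pair k _ _ _ _),
    (commute_dots_symm (k := k) (by omega) (by omega) fun l _ _ => by omega).eq, ← mul_assoc,
    ← mul_assoc, H.symm_mul_symm k le_rfl le_rfl (by omega), pair_mul_eq k fun _ _ _ _ =>
      H.gen_mul_symm k (by omega) (by omega) (by omega)]

theorem bind_cross_balloonSubst {k : Type u} [Field k] (a b : ℕ) :
    (cross k Set.univ a b).bind (balloonSubst k) = cross k _ a b :=
  bind_cross _ a b

/-- Injectivity of `thinning` reduces the two dot-crossing relations to the Hecke identities,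
matched summand by summand. The factors `t!` are present in the relations and the binomials come
from the exchange diagrams. -/
theorem balloonSubst_rel (X Y : List ℕ+) (f g : Expr k (Gen Set.univ) X Y)
    (h : AffRel k X Y f g) :
    Cong (ReducedRel k) (f.bind (balloonSubst k)) (g.bind (balloonSubst k)) := by
  cases h with
  | web h => exact .rel (.web (h.bind _))
  | cross_dot a b ha hb =>
    have hu := weight_strand_append a b
    have hv := (weight_strand_append b a).trans (add_comm _ _)
    refine cong_of_thinning_eq hu hv ?_
    have e := balloonSubst_cross_dot (k := k) a b hu hv
    -- The algebraic identity sums up to `b` and the relation up to `min a b`; for `t > a` the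
    -- binomial coefficient vanishes.
    rw [← sum_range_min_eq, ← bind_cross_balloonSubst] at e
    refine e.trans ?_
    rw [Expr.bind_list_sum, thinning_list_sum]
    refine Finset.sum_congr rfl fun t ht => ?_
    have ht := Finset.mem_range.1 ht
    have hh : t ≤ a ∧ t ≤ b := by omega
    rw [dif_pos hh, Nat.cast_mul, mul_smul, ← thinning_exchange_thickDot_cross hh.1 hh.2
      (by congr 2 <;> omega) (by congr 2 <;> omega) hu hv, ← map_smul, ← homMk_smul, balloonSubst,
      bind_smul, Expr.bind_cast, bind_exchange]
    simp only [Expr.bind, bind_cross]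
  | dot_cross a b ha hb =>
    have hv := weight_strand_append a b
    have hu := (weight_strand_append b a).trans (add_comm _ _)
    refine cong_of_thinning_eq hu hv ?_
    have e := balloonSubst_dot_cross (k := k) a b hu hv
    rw [← sum_range_min_eq, ← bind_cross_balloonSubst] at e
    refine e.trans ?_
    rw [Expr.bind_list_sum, thinning_list_sum]
    refine Finset.sum_congr rfl fun t ht => ?_
    have ht := Finset.mem_range.1 ht
    have hh : t ≤ a ∧ t ≤ b := by omega
    rw [dif_pos hh, Nat.cast_mul, mul_smul, ← thinning_exchange_cross_thickDot hh.1 hh.2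
      (by congr 2 <;> omega) (by congr 2 <;> omega) hu hv, ← map_smul, ← homMk_smul, balloonSubst,
      bind_smul, Expr.bind_cast, bind_exchange]
    simp only [Expr.bind, bind_cross]
  | dot_split a b ha hb =>
    have e := balloonSubst_dot_split (k := k) a b
    have e' : (split k Set.univ a b).bind (balloonSubst k) = _ := bind_split _ a b
    rw [splitHom, ← e'] at e
    exact cong_of_homMk_eq e
  | merge_dot a b ha hb =>
    have e := balloonSubst_merge_dot (k := k) a b
    have e' : (merge k Set.univ a b).bind (balloonSubst k) = _ := bind_merge _ a b
    rw [mergeHom, ← e'] at e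
    exact cong_of_homMk_eq e
  | balloon_eq a ha =>
    refine cong_of_homMk_eq ((bind_balloon a).trans (thinning_injective (weight_strand a)
      (weight_strand a) ?_))
    rw [thinning_balloon, ← thinning_thickDot, ← map_smul]
    rfl

end affine_to_reduced

/-! ### The two functors are mutually inverse. -/

section isomorphism

variable (k : Type u) [Field k] [CharZero k]

/-- Only the dots need an argument: a thick dot returns as the balloon in `ω_1` divided by `a!`, and
this is where the relation `B_a(ω_1) = a! ω_a` enters. -/
theorem thinDotSubst_balloonSubst (X Y : List ℕ+) (g : Gen Set.univ X Y) :
    Cong (AffRel k) ((balloonSubst k X Y g).bind (thinDotSubst k)) (.gen g) := by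
  cases g with
  | merge a b => exact .refl _
  | split a b => exact .refl _
  | cross a b => exact .refl _
  | dot a h =>
    obtain ⟨n, rfl⟩ : ∃ n : ℕ, a = n.succPNat := ⟨a.natPred, (PNat.succPNat_natPred a).symm⟩
    refine cong_of_homMk_eq ?_
    have e : homMk (AffRel k) ((balloon k {1} (Set.mem_singleton 1) (n + 1)).bind
        (thinDotSubst k)) = ((n + 1).factorial : k) • homMk (AffRel k) (omega k (n + 1)) := by
      refine Eq.trans (congrArg _ ?_)
        (homMk_eq (Cong.rel (AffRel.balloon_eq (n + 1) n.succ_pos)))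
      have h : ∀ m, (thinDots k {1} (Set.mem_singleton 1) m).bind (thinDotSubst k) =
          thinDots k _ (Set.mem_univ 1) m := by
        intro m
        induction m with
        | zero => rfl
        | succ m ih => exact congrArg _ ih
      have h₁ : (fullSplit k {1} (n + 1)).bind (thinDotSubst k) = _ := bind_fullSplit _ _
      have h₂ : (fullMerge k {1} (n + 1)).bind (thinDotSubst k) = _ := bind_fullMerge _ _
      simp only [balloon, Expr.bind, h, h₁, h₂]
    have e' : homMk (AffRel k) ((balloonSubst k _ _ (.dot n.succPNat h)).bind (thinDotSubst k)) =
        ((n + 1).factorial : k)⁻¹ • homMk (AffRel k)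
          ((balloon k {1} (Set.mem_singleton 1) (n + 1)).bind (thinDotSubst k)) := rfl
    rw [e', e, smul_smul, inv_mul_cancel₀ (Nat.cast_ne_zero.2 (n + 1).factorial_ne_zero), one_smul]
    rfl

theorem balloonSubst_thinDotSubst (X Y : List ℕ+) (g : Gen {1} X Y) :
    Cong (ReducedRel k) ((thinDotSubst k X Y g).bind (balloonSubst k)) (.gen g) := by
  cases g with
  | merge a b => exact .refl _
  | split a b => exact .refl _
  | cross a b => exact .refl _
  | dot a h =>
    obtain rfl : a = 1 := h
    exact cong_of_homMk_eq bind_thinDot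

/-- The isomorphism from the affine web category to the reduced affine web category. -/
def affineIso : StrictMonoidalIso k (AW k) (ReducedAW k) where
  functor := bindFunctor (balloonSubst k) balloonSubst_rel
  inverse := bindFunctor (thinDotSubst k) (thinDotSubst_rel k)
  functor_comp_inverse := bindFunctor_comp_eq_id _ _ _ _ (thinDotSubst_balloonSubst k)
  inverse_comp_functor := bindFunctor_comp_eq_id _ _ _ _ (balloonSubst_thinDotSubst k)
  additive := inferInstance
  linear := inferInstance
  monoidal := inferInstance
  obj_unit := rfl
  obj_tensor _ _ := rfl
  ε_eq := rfl
  μ_eq _ _ := rfl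

end isomorphism

end AffineWeb

theorem theorem5p2 (k : Type u) [Field k] [CharZero k] :
    ∃ (Φ : StrictMonoidalIso k (AffineWeb.AW k) (AffineWeb.ReducedAW k))
      (hΦ : ∀ X : List ℕ+, Φ.functor.obj ⟨X⟩ = ⟨X⟩),
      (∀ a b : ℕ+, Φ.functor.map (StrictPresentation.PresCat.homMk _ (AffineWeb.merge k _ a b)) =
        eqToHom (hΦ _) ≫ StrictPresentation.PresCat.homMk _ (AffineWeb.merge k _ a b) ≫
          eqToHom (hΦ _).symm) ∧
      (∀ a b : ℕ+, Φ.functor.map (StrictPresentation.PresCat.homMk _ (AffineWeb.split k _ a b)) =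
        eqToHom (hΦ _) ≫ StrictPresentation.PresCat.homMk _ (AffineWeb.split k _ a b) ≫
          eqToHom (hΦ _).symm) ∧
      (∀ a b : ℕ+, Φ.functor.map (StrictPresentation.PresCat.homMk _ (AffineWeb.cross k _ a b)) =
        eqToHom (hΦ _) ≫ StrictPresentation.PresCat.homMk _ (AffineWeb.cross k _ a b) ≫
          eqToHom (hΦ _).symm) ∧
      (∀ a : ℕ+, Φ.functor.map (StrictPresentation.PresCat.homMk _ (AffineWeb.omega k a)) =
        eqToHom (hΦ _) ≫
          ((((a : ℕ).factorial : k)⁻¹) •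
            StrictPresentation.PresCat.homMk _ (AffineWeb.balloon k _ (Set.mem_singleton 1) a)) ≫
          eqToHom (hΦ _).symm) := by
  have conj : ∀ {X Y : AffineWeb.ReducedAW k} {f g : X ⟶ Y} (p : X = X) (q : Y = Y), f = g →
      f = eqToHom p ≫ g ≫ eqToHom q := by
    rintro X Y f g p q rfl
    rw [eqToHom_refl, eqToHom_refl, Category.comp_id, Category.id_comp]
  refine ⟨AffineWeb.affineIso k, fun _ => rfl,
    fun a b => conj _ _ (congrArg (StrictPresentation.PresCat.homMk _) ?_),
    fun a b => conj _ _ (congrArg (StrictPresentation.PresCat.homMk _) ?_),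
    fun a b => conj _ _ (congrArg (StrictPresentation.PresCat.homMk _) ?_),
    fun a => conj _ _ ?_⟩
  · exact AffineWeb.bind_merge _ a b
  · exact AffineWeb.bind_split _ a b
  · exact AffineWeb.bind_cross _ a b
  · obtain ⟨n, rfl⟩ : ∃ n : ℕ, a = n.succPNat := ⟨a.natPred, (PNat.succPNat_natPred a).symm⟩
    rfl
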